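/- Let $\alpha>0$, $\beta\in(0,1)$ and $\mathbb R_+=[0,\infty)$. Let $\mathcal F(\mathbb R_+)$ be the space of closed subsets of $\mathbb R_+$ with the Borel $\sigma$-algebra of the Fell topology, and let $P_\beta$ be the law on $\mathcal F(\mathbb R_+)$ of a $\beta$-stable regenerative set, that is, of the closure of the range of a strictly $\beta$-stable subordinator. Let $(U_j,V_j,R_j)_{j\in\mathbb N}$ be a measurable enumeration of the points of a Poisson point process on $\mathbb R_+\times\mathbb R_+\times\mathcal F(\mathbb R_+)$ with mean measure $$\alpha u^{-(1+\alpha)}\,du\;(1-\beta)v^{-\beta}\,dv\;dP_\beta .$$ A sup-measure on $\mathbb R_+$ is a map $m$ from the open subsets of $\mathbb R_+$ to $[0,\infty]$ with $m(\bigcup_i G_i)=\sup_i m(G_i)$ for all families of open sets; it is extended to all $B\subset\mathbb R_+$ by $m(B)=\sup_{t\in B}\inf\{m(G): G\ni t\text{ open}\}$. The space of sup-measures carries the sup-vague topology, which has as a subbase the sets $\{m: m(K)<x\}$, $K$ compact, and $\{m: m(G)>x\}$, $G$ open, $x\in\mathbb R_+$, and the corresponding Borel $\sigma$-algebra. Put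 $$\eta^{\alpha,\beta}(G)=\sup_{t\in G}\ \sum_{j} U_j\,\mathbf 1\{t\in V_j+R_j\},\qquad G\subset\mathbb R_+\ \text{open}.$$ Then $\eta^{\alpha,\beta}$ is a random sup-measure (a random element of the space of sup-measures), and, as random sup-measures, 1. (stationarity) $\eta^{\alpha,\beta}(\cdot+b)\overset{d}{=}\eta^{\alpha,\beta}(\cdot)$ for every $b\ge 0$; 2. ($H$-self-similarity) $\eta^{\alpha,\beta}(a\,\cdot)\overset{d}{=}a^{H}\,\eta^{\alpha,\beta}(\cdot)$ for every $a>0$, where $H=(1-\beta)/\alpha$. -/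

import Mathlib

open MeasureTheory ProbabilityTheory
open scoped NNReal ENNReal

noncomputable section

/-! ### The space of closed subsets of `[0, ∞)` with the Fell topology -/

/-- The space `F(ℝ₊)` of closed subsets of `ℝ₊ = [0, ∞)`. This is a type synonym of Mathlib's
`Closeds ℝ≥0`, so that it carries the Fell topology and not the Hausdorff one. -/
def ClosedSets : Type := TopologicalSpace.Closeds ℝ≥0

namespace ClosedSets

/-- The underlying set. -/
def carrier (F : ClosedSets) : Set ℝ≥0 := TopologicalSpace.Closeds.carrier F

/-- The closure of a set, as a point of `F(ℝ₊)`. -/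
def ofClosure (A : Set ℝ≥0) : ClosedSets := TopologicalSpace.Closeds.closure A

/-- The Fell topology. -/
instance : TopologicalSpace ClosedSets :=
  TopologicalSpace.generateFrom
    ({s | ∃ G : Set ℝ≥0, IsOpen G ∧ s = {F : ClosedSets | (F.carrier ∩ G).Nonempty}} ∪
     {s | ∃ K : Set ℝ≥0, IsCompact K ∧ s = {F : ClosedSets | F.carrier ∩ K = ∅}})

/-- The Borel `σ`-algebra of the Fell topology. -/
instance : MeasurableSpace ClosedSets := borel ClosedSets

/-- The shifted set `v + F`. -/
def shift (v : ℝ≥0) (F : ClosedSets) : Set ℝ≥0 := (fun r => v + r) '' F.carrier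

end ClosedSets

/-! ### Sup-measures on `[0, ∞)` -/

/-- A sup-measure on `ℝ₊`: a map `m` from the (relatively) open subsets of `ℝ₊` to `[0, ∞]` which
turns arbitrary unions into suprema (in particular `m ∅ = 0`). -/
structure SupMeasure where
  /-- The value of the sup-measure on open sets. -/
  onOpen : TopologicalSpace.Opens ℝ≥0 → ℝ≥0∞
  map_sSup : ∀ 𝒢 : Set (TopologicalSpace.Opens ℝ≥0), onOpen (sSup 𝒢) = ⨆ G ∈ 𝒢, onOpen G

namespace SupMeasure

/-- The sup-derivative `d^∨ m (t) = inf {m(G) : G open, t ∈ G}`. -/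
def supDeriv (m : SupMeasure) (t : ℝ≥0) : ℝ≥0∞ :=
  ⨅ (G : TopologicalSpace.Opens ℝ≥0) (_ : t ∈ G), m.onOpen G

/-- The canonical extension of a sup-measure to all subsets of `ℝ₊`. -/
def ext (m : SupMeasure) (B : Set ℝ≥0) : ℝ≥0∞ := ⨆ t ∈ B, m.supDeriv t

/-- The sup-integral `G ↦ sup_{t ∈ G} f t`. -/
def supIntegral (f : ℝ≥0 → ℝ≥0∞) : SupMeasure where
  onOpen G := ⨆ t ∈ G, f t
  map_sSup 𝒢 := by
    apply le_antisymm
    · refine iSup₂_le fun t ht => ?_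
      obtain ⟨G, hG, htG⟩ := TopologicalSpace.Opens.mem_sSup.1 ht
      exact le_iSup₂_of_le G hG (le_iSup₂_of_le t htG le_rfl)
    · refine iSup₂_le fun G hG => iSup₂_le fun t ht => ?_
      exact le_iSup₂_of_le t (TopologicalSpace.Opens.mem_sSup.2 ⟨G, hG, ht⟩) le_rfl

/-- The sup-vague topology: the sets `{m : m(K) < x}`, `K` compact, and `{m : m(G) > x}`, `G` open,
form a subbase. -/
instance : TopologicalSpace SupMeasure :=
  TopologicalSpace.generateFrom
    ({s | ∃ (K : Set ℝ≥0) (x : ℝ≥0), IsCompact K ∧ s = {m : SupMeasure | m.ext K < x}} ∪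
     {s | ∃ (G : TopologicalSpace.Opens ℝ≥0) (x : ℝ≥0), s = {m : SupMeasure | x < m.onOpen G}})

/-- The Borel `σ`-algebra of the sup-vague topology. -/
instance : MeasurableSpace SupMeasure := borel SupMeasure

/-- The shifted sup-measure `G ↦ m(G + b)`. If `0 ∈ G` and `b > 0`, then `G + b` is not open, and
`m(G + b)` is the value of the canonical extension. -/
def shift (b : ℝ≥0) (m : SupMeasure) : SupMeasure where
  onOpen G := m.ext ((fun t => t + b) '' (G : Set ℝ≥0))
  map_sSup 𝒢 := by
    simp only [ext, iSup_image]
    exact (supIntegral fun t => m.supDeriv (t + b)).map_sSup 𝒢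

/-- The rescaled sup-measure `G ↦ m(a G)`. -/
def dilate (a : ℝ≥0) (m : SupMeasure) : SupMeasure where
  onOpen G := m.ext ((fun t => a * t) '' (G : Set ℝ≥0))
  map_sSup 𝒢 := by
    simp only [ext, iSup_image]
    exact (supIntegral fun t => m.supDeriv (a * t)).map_sSup 𝒢

/-- The multiple `G ↦ c · m(G)`. -/
def scale (c : ℝ≥0) (m : SupMeasure) : SupMeasure where
  onOpen G := c * m.onOpen G
  map_sSup 𝒢 := by
    simp only [m.map_sSup, ENNReal.mul_iSup]

end SupMeasure

/-- A random sup-measure: a random element of the space of sup-measures with its Borel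
`σ`-algebra. -/
def IsRandomSupMeasure {Ω : Type*} [MeasurableSpace Ω] (η : Ω → SupMeasure) : Prop :=
  Measurable η

/-- Stationarity: `η(· + b)` has the same law as `η`, for all shifts `b ≥ 0`. -/
def IsStationarySupMeasure {Ω : Type*} [MeasurableSpace Ω] (η : Ω → SupMeasure)
    (P : Measure Ω) : Prop :=
  ∀ b : ℝ≥0, IdentDistrib (fun ω => (η ω).shift b) η P P

/-- `H`-self-similarity: `η(a ·)` has the same law as `a ^ H η(·)`, for all `a > 0`. -/
def IsSelfSimilarSupMeasure {Ω : Type*} [MeasurableSpace Ω] (H : ℝ) (η : Ω → SupMeasure)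
    (P : Measure Ω) : Prop :=
  ∀ a : ℝ≥0, 0 < a →
    IdentDistrib (fun ω => (η ω).dilate a) (fun ω => (η ω).scale (a ^ H)) P P

/-! ### Stable subordinators and stable regenerative sets -/

/-- A (strictly) `β`-stable subordinator: a process with values in `[0, ∞)`, started at `0`, with
independent and stationary increments, almost surely nondecreasing right-continuous paths, and
Laplace transform `E exp (-θ S_t) = exp (-c t θ ^ β)` for some constant `c > 0`. (The truncated
subtraction of `ℝ≥0` in the increments is harmless, as the paths are almost surely monotone.) -/
structure IsStableSubordinator {Ω : Type*} [MeasurableSpace Ω] (β : ℝ) (S : ℝ≥0 → Ω → ℝ≥0)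
    (P : Measure Ω) : Prop where
  measurable : ∀ t, Measurable (S t)
  zero : ∀ᵐ ω ∂P, S 0 ω = 0
  indep : HasIndepIncrements S P
  stationary : ∀ s t : ℝ≥0, IdentDistrib (fun ω => S (s + t) ω - S s ω) (S t) P P
  path : ∀ᵐ ω ∂P, Monotone (fun t => S t ω) ∧
    ∀ t, ContinuousWithinAt (fun s => S s ω) (Set.Ici t) t
  laplace : ∃ c : ℝ, 0 < c ∧ ∀ t θ : ℝ≥0,
    ∫ ω, Real.exp (-((θ : ℝ) * (S t ω : ℝ))) ∂P = Real.exp (-(c * (t : ℝ) * (θ : ℝ) ^ β))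

/-- The closure of the range of a process, as a random closed set. For a `β`-stable subordinator
this is the `β`-stable regenerative set. -/
def closedRange {Ω : Type*} (S : ℝ≥0 → Ω → ℝ≥0) (ω : Ω) : ClosedSets :=
  ClosedSets.ofClosure (Set.range fun t => S t ω)

/-! ### The Poisson point process and the random sup-measure -/

/-- The number of indices `j` such that `X j ω` lies in `A`. -/
def pointCount {Ω E : Type*} (X : ℕ → Ω → E) (A : Set E) (ω : Ω) : ℕ∞ :=
  Set.encard {j : ℕ | X j ω ∈ A}

/-- `X 0, X 1, …` is a measurable enumeration of the points of a Poisson point process with mean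
measure `ν`: the number of points in a measurable set of finite `ν`-measure has the Poisson
distribution with mean `ν A`, and the numbers of points in disjoint measurable sets are
independent. -/
structure IsPoissonEnumeration {Ω E : Type*} [MeasurableSpace Ω] [MeasurableSpace E]
    (X : ℕ → Ω → E) (ν : Measure E) (P : Measure Ω) : Prop where
  measurable : ∀ j, Measurable (X j)
  law : ∀ A : Set E, MeasurableSet A → ν A ≠ ∞ →
    P.map (pointCount X A) = (poissonMeasure (ν A).toNNReal).map (fun n : ℕ => (n : ℕ∞))
  indep : ∀ (n : ℕ) (A : Fin n → Set E), (∀ i, MeasurableSet (A i)) →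
    (∀ i j, i ≠ j → Disjoint (A i) (A j)) → iIndepFun (fun i => pointCount X (A i)) P

/-- Lebesgue measure on `ℝ₊ = [0, ∞)`. -/
def lebesgueNNReal : Measure ℝ≥0 := ((volume : Measure ℝ).restrict (Set.Ici 0)).map Real.toNNReal

/-- The measure `α u ^ (-(1 + α)) du ⊗ (1 - β) v ^ (-β) dv ⊗ Q` on `ℝ₊ × ℝ₊ × F(ℝ₊)`. -/
def meanMeasure (α β : ℝ) (Q : Measure ClosedSets) : Measure (ℝ≥0 × ℝ≥0 × ClosedSets) :=
  (lebesgueNNReal.withDensity fun u => ENNReal.ofReal (α * (u : ℝ) ^ (-(1 + α)))).prod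
    ((lebesgueNNReal.withDensity fun v =>
      ENNReal.ofReal ((1 - β) * (v : ℝ) ^ (-β))).prod Q)

/-- The random function `η(t) = ∑_j U_j 1{t ∈ V_j + R_j}`. -/
def etaFun {Ω : Type*} (U V : ℕ → Ω → ℝ≥0) (R : ℕ → Ω → ClosedSets) (ω : Ω) (t : ℝ≥0) : ℝ≥0∞ :=
  ∑' j, ((R j ω).shift (V j ω)).indicator (fun _ => (U j ω : ℝ≥0∞)) t

/-- The random sup-measure `η(G) = sup_{t ∈ G} ∑_j U_j 1{t ∈ V_j + R_j}`. -/
def eta {Ω : Type*} (U V : ℕ → Ω → ℝ≥0) (R : ℕ → Ω → ClosedSets) (ω : Ω) : SupMeasure :=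
  SupMeasure.supIntegral (etaFun U V R ω)

end

/-! Replace every point `(U_j, V_j, R_j)` by the weighted closed set `(U_j, V_j + R_j)`. These form
a Poisson process whose mean measure is the product of `α u^(-1-α) du` with `μ`, the image of `(1-β)
v^(-β) dv ⊗ P_β` under `(v, R) ↦ v + R`, and `eta` is the function `coverSup` of them. The law of
`coverSup` depends only on the mean measure (`IsPoissonEnumeration.map_coverSup_eq`), so both claims
reduce to transformation rules for `μ` and for the weight measure.

Stationarity of `μ` (`map_restart_shiftedLaw`). By the strong Markov property at the first passage
over `b` (`map_passage`), the part of `v + R` beyond `b`, moved back by `b`, is an overshoot plus an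
independent copy of `R`. It remains to see that the delay measure `(1-β) v^(-β) dv` is invariant for
the overshoot (`map_overshoot`). Its convolution with the potential measure of the subordinator has
Laplace transform `const · θ^(β-1) · θ^(-β) = const / θ`, hence is a multiple of Lebesgue measure.
Restricted to `[b, ∞)` and moved back by `b`, Lebesgue measure is unchanged; the strong Markov
property identifies the same measure as the overshoot measure convolved with the potential.
Cancelling the transform of the potential gives the invariance.

Scaling. Contraction by `a` preserves `P_β` and multiplies the delay measure by `a^(1-β)`.
Multiplying the weights by `a^H` multiplies the weight measure by `a^(Hα) = a^(1-β)`. So `η(a ·)`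
and `a^H η` come from Poisson processes with the same mean measure.

From sets to sup-measures. Shifting a sup-measure by `b` uses its canonical extension, which sees
both sides of `b`, whereas the restarted sets only see `[b, ∞)`. The two agree if the sup-derivative
at `b` vanishes, which holds almost surely (`ae_supDeriv_eq_zero`): an interval of length `ε` is hit
with `μ`-measure of order `ε^(1-β)`, so sets of weight above a given bound stay away from some
neighbourhood of `b`, and at every point fewer than `k` sets of positive weight overlap once `k
(1-β) > 1`.

Measurability and the dependence on the mean measure alone both rest on compactness: finitely many
closed sets have a common point in a compact `K` if and only if, for every `n`, they all meet `K`
inside one cell of length `1/(n+1)`. This replaces suprema over uncountably many `t` by countable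
operations on the counting measure (`cellSup_restrict_pointMeasure`). -/

noncomputable section

/-! ### A countable family of balls of `[0, ∞)` -/

/-- A countable basis of `[0, ∞)` consisting of open balls. -/
def ratBall (i : ℕ × ℕ) : Set ℝ≥0 :=
  Metric.ball (TopologicalSpace.denseSeq ℝ≥0 i.1) (1 / ((i.2 : ℝ) + 1))

/-- The closed balls corresponding to `ratBall`. -/
def ratClosedBall (i : ℕ × ℕ) : Set ℝ≥0 :=
  Metric.closedBall (TopologicalSpace.denseSeq ℝ≥0 i.1) (1 / ((i.2 : ℝ) + 1))

lemma isOpen_ratBall (i : ℕ × ℕ) : IsOpen (ratBall i) := Metric.isOpen_ball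

lemma isCompact_ratClosedBall (i : ℕ × ℕ) : IsCompact (ratClosedBall i) :=
  isCompact_closedBall _ _

lemma ratBall_subset (i : ℕ × ℕ) : ratBall i ⊆ ratClosedBall i := Metric.ball_subset_closedBall

lemma exists_ratBall {U : Set ℝ≥0} (hU : IsOpen U) {x : ℝ≥0} (hx : x ∈ U) :
    ∃ i, x ∈ ratBall i ∧ ratClosedBall i ⊆ U := by
  obtain ⟨ε, hε, hεU⟩ := Metric.isOpen_iff.1 hU x hx
  obtain ⟨n, hn⟩ := exists_nat_one_div_lt (half_pos hε)
  obtain ⟨k, hk⟩ := (TopologicalSpace.denseRange_denseSeq ℝ≥0).exists_dist_lt x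
    (Nat.one_div_pos_of_nat (α := ℝ) (n := n))
  refine ⟨(k, n), Metric.mem_ball.2 hk, fun y hy => hεU (Metric.mem_ball.2 ?_)⟩
  have h1 : dist y (TopologicalSpace.denseSeq ℝ≥0 k) ≤ 1 / ((n : ℝ) + 1) := hy
  calc dist y x ≤ dist y (TopologicalSpace.denseSeq ℝ≥0 k)
        + dist x (TopologicalSpace.denseSeq ℝ≥0 k) := dist_triangle_right _ _ _
    _ < ε := by linarith

lemma exists_finset_ratBall {K : Set ℝ≥0} (hK : IsCompact K) {p : ℕ × ℕ → Prop}
    (h : ∀ x ∈ K, ∃ i, x ∈ ratBall i ∧ p i) :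
    ∃ s : Finset (ℕ × ℕ), K ⊆ ⋃ i ∈ s, ratBall i ∧ ∀ i ∈ s, p i := by
  obtain ⟨b, hbp, hbf, hb⟩ := hK.elim_finite_subcover_image (b := {i | p i}) (c := ratBall)
    (fun i _ => isOpen_ratBall i) (fun x hx => by
      obtain ⟨i, hi, hpi⟩ := h x hx
      exact Set.mem_biUnion (x := i) hpi hi)
  refine ⟨hbf.toFinset, ?_, fun i hi => hbp (by simpa using hi)⟩
  simpa using hb

/-- Applied with `U` the complement of a closed set: missing a compact set is then witnessed by one
of countably many finite unions of balls. -/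
lemma exists_finset_subset_subset {K U : Set ℝ≥0} (hK : IsCompact K) (hU : IsOpen U)
    (hKU : K ⊆ U) :
    ∃ s : Finset (ℕ × ℕ), K ⊆ ⋃ i ∈ s, ratBall i ∧ ⋃ i ∈ s, ratClosedBall i ⊆ U := by
  obtain ⟨s, hs, hs'⟩ := exists_finset_ratBall hK (p := fun i => ratClosedBall i ⊆ U)
    fun x hx => exists_ratBall hU (hKU hx)
  exact ⟨s, hs, Set.iUnion₂_subset hs'⟩

lemma isCompact_biUnion_ratClosedBall (s : Finset (ℕ × ℕ)) :
    IsCompact (⋃ i ∈ s, ratClosedBall i) :=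
  s.isCompact_biUnion fun i _ => isCompact_ratClosedBall i

/-- The closed balls of the countable family which lie in `G` exhaust the open set `G`. -/
lemma iUnion_ratClosedBall_eq {G : Set ℝ≥0} (hG : IsOpen G) :
    ⋃ i ∈ {i | ratClosedBall i ⊆ G}, ratClosedBall i = G := by
  apply Set.Subset.antisymm
  · exact Set.iUnion₂_subset fun i hi => hi
  · intro x hx
    obtain ⟨i, hi, hiG⟩ := exists_ratBall hG hx
    exact Set.mem_biUnion (x := i) hiG (ratBall_subset i hi)

/-! ### The space of closed sets -/

namespace ClosedSets

lemma isClosed_carrier (F : ClosedSets) : IsClosed F.carrier :=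
  TopologicalSpace.Closeds.isClosed' F

lemma carrier_injective : Function.Injective carrier := by
  intro F F' h
  exact TopologicalSpace.Closeds.ext h

/-- A closed set as a point of `F(ℝ₊)`. -/
def ofIsClosed (A : Set ℝ≥0) (hA : IsClosed A) : ClosedSets :=
  (⟨A, hA⟩ : TopologicalSpace.Closeds ℝ≥0)

@[simp] lemma carrier_ofIsClosed (A : Set ℝ≥0) (hA : IsClosed A) :
    (ofIsClosed A hA).carrier = A := rfl

@[simp] lemma carrier_ofClosure (A : Set ℝ≥0) : (ofClosure A).carrier = closure A := rfl

lemma isOpen_hit {G : Set ℝ≥0} (hG : IsOpen G) :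
    IsOpen {F : ClosedSets | (F.carrier ∩ G).Nonempty} :=
  TopologicalSpace.isOpen_generateFrom_of_mem (Or.inl ⟨G, hG, rfl⟩)

lemma isOpen_miss {K : Set ℝ≥0} (hK : IsCompact K) :
    IsOpen {F : ClosedSets | F.carrier ∩ K = ∅} :=
  TopologicalSpace.isOpen_generateFrom_of_mem (Or.inr ⟨K, hK, rfl⟩)

instance : BorelSpace ClosedSets := ⟨rfl⟩

lemma hit_eq_iUnion {G : Set ℝ≥0} (hG : IsOpen G) :
    {F : ClosedSets | (F.carrier ∩ G).Nonempty}
      = ⋃ i ∈ {i | ratClosedBall i ⊆ G}, {F : ClosedSets | (F.carrier ∩ ratBall i).Nonempty} := by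
  ext F
  simp only [Set.mem_ofPred_eq, Set.mem_iUnion, exists_prop]
  constructor
  · rintro ⟨x, hxF, hxG⟩
    obtain ⟨i, hi, hiG⟩ := exists_ratBall hG hxG
    exact ⟨i, hiG, x, hxF, hi⟩
  · rintro ⟨i, hiG, x, hxF, hxi⟩
    exact ⟨x, hxF, hiG (ratBall_subset i hxi)⟩

lemma miss_eq_iUnion {K : Set ℝ≥0} (hK : IsCompact K) :
    {F : ClosedSets | F.carrier ∩ K = ∅}
      = ⋃ s ∈ {s : Finset (ℕ × ℕ) | K ⊆ ⋃ i ∈ s, ratBall i},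
        {F : ClosedSets | F.carrier ∩ (⋃ i ∈ s, ratClosedBall i) = ∅} := by
  ext F
  simp only [Set.mem_ofPred_eq, Set.mem_iUnion, exists_prop]
  constructor
  · intro h
    obtain ⟨s, hs, hs'⟩ := exists_finset_subset_subset hK F.isClosed_carrier.isOpen_compl
      (fun x hxK hxF => Set.eq_empty_iff_forall_notMem.1 h x ⟨hxF, hxK⟩)
    refine ⟨s, hs, ?_⟩
    rw [← Set.disjoint_iff_inter_eq_empty]
    exact Set.disjoint_left.2 fun x hxF hx => hs' hx hxF
  · rintro ⟨s, hs, h⟩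
    refine Set.eq_empty_of_subset_empty fun x hx => ?_
    rw [← h]
    exact ⟨hx.1, Set.iUnion₂_mono (fun i _ => ratBall_subset i) (hs hx.2)⟩

/-- With a countable base the Borel σ-algebra is generated by the subbase, so hitting events test
measurability; moreover open subsets of `ℝ≥0 × ClosedSets` become measurable for the product
σ-algebra. -/
instance : SecondCountableTopology ClosedSets := by
  refine ⟨⟨Set.range (fun i => {F : ClosedSets | (F.carrier ∩ ratBall i).Nonempty}) ∪
    Set.range (fun s : Finset (ℕ × ℕ) =>
      {F : ClosedSets | F.carrier ∩ (⋃ i ∈ s, ratClosedBall i) = ∅}),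
    (Set.countable_range _).union (Set.countable_range _), le_antisymm ?_ ?_⟩⟩
  · refine le_generateFrom ?_
    rintro _ (⟨i, rfl⟩ | ⟨s, rfl⟩)
    · exact isOpen_hit (isOpen_ratBall i)
    · exact isOpen_miss (isCompact_biUnion_ratClosedBall s)
  · refine le_generateFrom ?_
    rintro _ (⟨G, hG, rfl⟩ | ⟨K, hK, rfl⟩)
    · rw [hit_eq_iUnion hG]
      exact @isOpen_biUnion _ _ (_) _ _ fun i _ =>
        TopologicalSpace.isOpen_generateFrom_of_mem (Or.inl ⟨i, rfl⟩)
    · rw [miss_eq_iUnion hK]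
      exact @isOpen_biUnion _ _ (_) _ _ fun s _ =>
        TopologicalSpace.isOpen_generateFrom_of_mem (Or.inr ⟨s, rfl⟩)

lemma measurableSet_hit_isCompact {K : Set ℝ≥0} (hK : IsCompact K) :
    MeasurableSet {F : ClosedSets | (F.carrier ∩ K).Nonempty} := by
  convert (isOpen_miss hK).measurableSet.compl using 1
  ext F
  simp [Set.nonempty_iff_ne_empty]

/-- A map into the space of closed sets is measurable if all hitting events of compact sets are. -/
lemma measurable_of_hit_isCompact {Ω : Type*} [MeasurableSpace Ω] {f : Ω → ClosedSets}
    (h : ∀ K, IsCompact K → MeasurableSet {ω | ((f ω).carrier ∩ K).Nonempty}) : Measurable f := by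
  rw [BorelSpace.measurable_eq (α := ClosedSets),
    borel_eq_generateFrom_of_subbasis (α := ClosedSets) rfl]
  refine measurable_generateFrom ?_
  rintro _ (⟨G, hG, rfl⟩ | ⟨K, hK, rfl⟩)
  · have : f ⁻¹' {F : ClosedSets | (F.carrier ∩ G).Nonempty}
        = ⋃ i ∈ {i | ratClosedBall i ⊆ G}, {ω | ((f ω).carrier ∩ ratClosedBall i).Nonempty} := by
      ext ω
      conv_lhs => rw [← iUnion_ratClosedBall_eq hG]
      simp [Set.inter_iUnion]
    rw [this]
    exact MeasurableSet.biUnion (Set.to_countable _) fun i _ => h _ (isCompact_ratClosedBall i)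
  · convert (h K hK).compl using 1
    ext ω
    simp [Set.nonempty_iff_ne_empty]

/-- A compact set is hit by a closed set as soon as all its finite covers by balls are. -/
lemma hit_isCompact_iff {K : Set ℝ≥0} (hK : IsCompact K) (F : ClosedSets) :
    (F.carrier ∩ K).Nonempty ↔ ∀ s : Finset (ℕ × ℕ), K ⊆ ⋃ i ∈ s, ratBall i →
      (F.carrier ∩ ⋃ i ∈ s, ratBall i).Nonempty := by
  constructor
  · rintro ⟨x, hxF, hxK⟩ s hs
    exact ⟨x, hxF, hs hxK⟩
  · intro h
    by_contra hne
    obtain ⟨s, hs, hs'⟩ := exists_finset_subset_subset hK F.isClosed_carrier.isOpen_compl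
      (fun x hxK hxF => hne ⟨x, hxF, hxK⟩)
    obtain ⟨x, hxF, hx⟩ := h s hs
    exact hs' (Set.iUnion₂_mono (fun i _ => ratBall_subset i) hx) hxF

/-- A map into the space of closed sets is measurable if all hitting events of open sets are. -/
lemma measurable_of_hit_isOpen {Ω : Type*} [MeasurableSpace Ω] {f : Ω → ClosedSets}
    (h : ∀ G, IsOpen G → MeasurableSet {ω | ((f ω).carrier ∩ G).Nonempty}) : Measurable f := by
  refine measurable_of_hit_isCompact fun K hK => ?_
  simp only [hit_isCompact_iff hK, Set.ofPred_forall]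
  exact MeasurableSet.iInter fun s => MeasurableSet.iInter fun _ =>
    h _ (isOpen_biUnion fun i _ => isOpen_ratBall i)

/-- The translated set `v + F`, as a closed set. -/
def translate (v : ℝ≥0) (F : ClosedSets) : ClosedSets :=
  ofIsClosed (F.shift v) (by
    have hc : Topology.IsClosedEmbedding (fun r : ℝ≥0 => v + r) :=
      (isometry_iff_dist_eq.2 fun x y => by
        simp [NNReal.dist_eq]).isClosedEmbedding
    exact hc.isClosedMap _ F.isClosed_carrier)

@[simp] lemma carrier_translate (v : ℝ≥0) (F : ClosedSets) :
    (F.translate v).carrier = F.shift v := rfl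

/-- By continuity of addition, the pairs `(v, F)` for which `v + F` hits a given open set form an
open set. -/
lemma measurable_translate :
    Measurable (fun p : ℝ≥0 × ClosedSets => p.2.translate p.1) := by
  refine measurable_of_hit_isOpen fun G hG => IsOpen.measurableSet ?_
  rw [isOpen_iff_forall_mem_open]
  rintro ⟨v, F⟩ ⟨_, ⟨r, hr, rfl⟩, hG'⟩
  obtain ⟨I, J, hI, hJ, hvI, hrJ, hIJ⟩ :=
    isOpen_prod_iff.1 (hG.preimage (continuous_add (M := ℝ≥0))) v r hG'
  refine ⟨I ×ˢ {F : ClosedSets | (F.carrier ∩ J).Nonempty}, ?_, hI.prod (isOpen_hit hJ),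
    hvI, r, hr, hrJ⟩
  rintro ⟨w, F'⟩ ⟨hw, s, hs, hsJ⟩
  exact ⟨w + s, ⟨s, hs, rfl⟩, hIJ (Set.mk_mem_prod hw hsJ)⟩

/-- The set `(F - b) ∩ [0, ∞)`. -/
def restart (b : ℝ≥0) (F : ClosedSets) : ClosedSets :=
  ofIsClosed ((fun r => r + b) ⁻¹' F.carrier) (F.isClosed_carrier.preimage (by fun_prop))

@[simp] lemma mem_restart {b r : ℝ≥0} {F : ClosedSets} :
    r ∈ (F.restart b).carrier ↔ r + b ∈ F.carrier := Iff.rfl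

/-- Compact test sets are used because `K + b` is compact, while `G + b` need not be open when `0 ∈
G`. -/
lemma measurable_restart (b : ℝ≥0) : Measurable (restart b) := by
  refine measurable_of_hit_isCompact fun K hK => ?_
  convert measurableSet_hit_isCompact (hK.image (f := fun r : ℝ≥0 => r + b) (by fun_prop)) using 1
  ext F
  constructor
  · rintro ⟨r, hr, hrK⟩
    exact ⟨r + b, hr, r, hrK, rfl⟩
  · rintro ⟨_, hr, r, hrK, rfl⟩
    exact ⟨r, hr, hrK⟩

/-- The set `{r | a * r ∈ F}`, which is `a⁻¹ F` if `a > 0`. -/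
def contract (a : ℝ≥0) (F : ClosedSets) : ClosedSets :=
  ofIsClosed ((fun r => a * r) ⁻¹' F.carrier) (F.isClosed_carrier.preimage (by fun_prop))

@[simp] lemma mem_contract {a r : ℝ≥0} {F : ClosedSets} :
    r ∈ (F.contract a).carrier ↔ a * r ∈ F.carrier := Iff.rfl

lemma measurable_contract (a : ℝ≥0) : Measurable (contract a) := by
  refine measurable_of_hit_isCompact fun K hK => ?_
  convert measurableSet_hit_isCompact (hK.image (f := fun r : ℝ≥0 => a * r) (by fun_prop)) using 1
  ext F
  constructor
  · rintro ⟨r, hr, hrK⟩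
    exact ⟨a * r, hr, r, hrK, rfl⟩
  · rintro ⟨_, hr, r, hrK, rfl⟩
    exact ⟨r, hr, hrK⟩

/-- The closure of the range of a sequence is a measurable function of the sequence. -/
lemma measurable_ofClosure_range {ι : Type*} [Countable ι] :
    Measurable (fun w : ι → ℝ≥0 => ofClosure (Set.range w)) := by
  refine measurable_of_hit_isOpen fun G hG => ?_
  have : {w : ι → ℝ≥0 | ((ofClosure (Set.range w)).carrier ∩ G).Nonempty}
      = ⋃ i, {w | w i ∈ G} := by
    ext w
    simp only [carrier_ofClosure, Set.mem_ofPred_eq, Set.mem_iUnion]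
    rw [closure_inter_open_nonempty_iff hG]
    constructor
    · rintro ⟨_, ⟨i, rfl⟩, hi⟩
      exact ⟨i, hi⟩
    · rintro ⟨i, hi⟩
      exact ⟨w i, ⟨i, rfl⟩, hi⟩
  rw [this]
  exact MeasurableSet.iUnion fun i => measurable_pi_apply i hG.measurableSet

end ClosedSets

/-! ### The space of sup-measures -/

namespace SupMeasure

lemma onOpen_injective : Function.Injective onOpen := by
  rintro ⟨f, _⟩ ⟨g, _⟩ h
  cases h
  rfl

lemma mono (m : SupMeasure) {G G' : TopologicalSpace.Opens ℝ≥0} (h : G ≤ G') :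
    m.onOpen G ≤ m.onOpen G' := by
  have := m.map_sSup {G, G'}
  rw [sSup_pair, sup_eq_right.2 h, iSup_pair] at this
  rw [this]
  exact le_sup_left

lemma supDeriv_le (m : SupMeasure) {t : ℝ≥0} {G : TopologicalSpace.Opens ℝ≥0} (h : t ∈ G) :
    m.supDeriv t ≤ m.onOpen G := iInf₂_le G h

lemma ext_mono (m : SupMeasure) {A B : Set ℝ≥0} (h : A ⊆ B) : m.ext A ≤ m.ext B :=
  biSup_mono h

lemma ext_le_onOpen (m : SupMeasure) {A : Set ℝ≥0} {G : TopologicalSpace.Opens ℝ≥0}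
    (h : A ⊆ G) : m.ext A ≤ m.onOpen G :=
  iSup₂_le fun _ ht => m.supDeriv_le (h ht)

/-- The finite union of open balls of the countable family. -/
def ratOpen (s : Finset (ℕ × ℕ)) : TopologicalSpace.Opens ℝ≥0 :=
  ⟨⋃ i ∈ s, ratBall i, isOpen_biUnion fun i _ => isOpen_ratBall i⟩

lemma onOpen_ratOpen (m : SupMeasure) (s : Finset (ℕ × ℕ)) :
    m.onOpen (ratOpen s) = ⨆ i ∈ s, m.onOpen ⟨ratBall i, isOpen_ratBall i⟩ := by
  have : ratOpen s = sSup ((fun i => (⟨ratBall i, isOpen_ratBall i⟩ : TopologicalSpace.Opens ℝ≥0))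
      '' (s : Set (ℕ × ℕ))) := by
    ext x
    simp [ratOpen]
  rw [this, m.map_sSup, iSup_image]
  simp

/-- Each point of `K` has a neighbourhood of value below `x`, and by compactness finitely many
suffice, so the strict bound survives the maximum. The closed-ball bounds serve the countable base,
the bound on `ratOpen s` serves measurability. -/
lemma ext_lt_iff_exists_ratOpen (m : SupMeasure) {K : Set ℝ≥0} (hK : IsCompact K) {x : ℝ≥0∞} :
    m.ext K < x ↔ ∃ s : Finset (ℕ × ℕ), K ⊆ ⋃ i ∈ s, ratBall i ∧
      (∀ i ∈ s, m.ext (ratClosedBall i) < x) ∧ m.onOpen (ratOpen s) < x := by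
  constructor
  · intro h
    obtain ⟨s, hs, hs'⟩ := exists_finset_ratBall hK
      (p := fun i => m.ext (ratClosedBall i) < x ∧ m.onOpen ⟨ratBall i, isOpen_ratBall i⟩ < x)
      fun t ht => by
        have h1 : m.supDeriv t < x := (le_iSup₂ (f := fun t _ => m.supDeriv t) t ht).trans_lt h
        simp only [supDeriv, iInf_lt_iff] at h1
        obtain ⟨G, hG, hGx⟩ := h1
        obtain ⟨i, hi, hiG⟩ := exists_ratBall G.isOpen hG
        exact ⟨i, hi, (m.ext_le_onOpen hiG).trans_lt hGx,
          (m.mono (show _ ≤ G from (ratBall_subset i).trans hiG)).trans_lt hGx⟩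
    refine ⟨s, hs, fun i hi => (hs' i hi).1, ?_⟩
    rw [onOpen_ratOpen, ← Finset.sup_eq_iSup]
    exact (Finset.sup_lt_iff (bot_le.trans_lt h)).2 fun i hi => (hs' i hi).2
  · rintro ⟨s, hs, -, h⟩
    exact (m.ext_le_onOpen (G := ratOpen s) hs).trans_lt h

/-- Positivity of `x` matters for `s = ∅`, where the extension is `0` and the right side is vacuous.
-/
lemma ext_biUnion_lt_iff (m : SupMeasure) {s : Finset (ℕ × ℕ)} {x : ℝ≥0∞} (hx : 0 < x) :
    m.ext (⋃ i ∈ s, ratClosedBall i) < x ↔ ∀ i ∈ s, m.ext (ratClosedBall i) < x := by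
  have : m.ext (⋃ i ∈ s, ratClosedBall i) = s.sup fun i => m.ext (ratClosedBall i) := by
    rw [Finset.sup_eq_iSup]
    simp only [ext, Set.mem_iUnion, exists_prop, iSup_exists, iSup_and]
    rw [iSup_comm]
    refine iSup_congr fun i => ?_
    rw [iSup_comm]
  rw [this, Finset.sup_lt_iff hx]

lemma onOpen_eq_iSup_ratBall (m : SupMeasure) (G : TopologicalSpace.Opens ℝ≥0) :
    m.onOpen G = ⨆ i ∈ {i | ratClosedBall i ⊆ (G : Set ℝ≥0)},
      m.onOpen ⟨ratBall i, isOpen_ratBall i⟩ := by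
  have : G = sSup ((fun i => (⟨ratBall i, isOpen_ratBall i⟩ : TopologicalSpace.Opens ℝ≥0))
      '' {i | ratClosedBall i ⊆ (G : Set ℝ≥0)}) := by
    apply le_antisymm
    · intro t ht
      obtain ⟨i, hi, hiG⟩ := exists_ratBall G.isOpen ht
      exact TopologicalSpace.Opens.mem_sSup.2 ⟨_, ⟨i, hiG, rfl⟩, hi⟩
    · refine sSup_le ?_
      rintro _ ⟨i, hi, rfl⟩
      exact (ratBall_subset i).trans hi
  conv_lhs => rw [this, m.map_sSup]
  rw [iSup_image]

lemma isOpen_ext_lt {K : Set ℝ≥0} (hK : IsCompact K) (x : ℝ≥0) :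
    IsOpen {m : SupMeasure | m.ext K < x} :=
  TopologicalSpace.isOpen_generateFrom_of_mem (Or.inl ⟨K, x, hK, rfl⟩)

lemma isOpen_lt_onOpen (G : TopologicalSpace.Opens ℝ≥0) (x : ℝ≥0) :
    IsOpen {m : SupMeasure | x < m.onOpen G} :=
  TopologicalSpace.isOpen_generateFrom_of_mem (Or.inr ⟨G, x, rfl⟩)

instance : BorelSpace SupMeasure := ⟨rfl⟩

instance : SecondCountableTopology SupMeasure := by
  refine ⟨⟨Set.range (fun p : Finset (ℕ × ℕ) × ℚ =>
      {m : SupMeasure | m.ext (⋃ i ∈ p.1, ratClosedBall i) < (Real.toNNReal p.2 : ℝ≥0)}) ∪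
    Set.range (fun p : (ℕ × ℕ) × ℚ =>
      {m : SupMeasure | (Real.toNNReal p.2 : ℝ≥0) < m.onOpen ⟨ratBall p.1, isOpen_ratBall p.1⟩}),
    (Set.countable_range _).union (Set.countable_range _), le_antisymm ?_ ?_⟩⟩
  · refine le_generateFrom ?_
    rintro _ (⟨p, rfl⟩ | ⟨p, rfl⟩)
    · exact isOpen_ext_lt (isCompact_biUnion_ratClosedBall p.1) _
    · exact isOpen_lt_onOpen _ _
  · refine le_generateFrom ?_
    rintro _ (⟨K, x, hK, rfl⟩ | ⟨G, x, rfl⟩)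
    · have : {m : SupMeasure | m.ext K < x} =
          ⋃ p ∈ {p : Finset (ℕ × ℕ) × ℚ | K ⊆ ⋃ i ∈ p.1, ratBall i ∧ Real.toNNReal p.2 ≤ x},
            {m : SupMeasure | m.ext (⋃ i ∈ p.1, ratClosedBall i) < (Real.toNNReal p.2 : ℝ≥0)} := by
        ext m
        simp only [Set.mem_ofPred_eq, Set.mem_iUnion, exists_prop]
        constructor
        · intro h
          obtain ⟨q, -, hq, hq'⟩ := ENNReal.lt_iff_exists_rat_btwn.1 h
          obtain ⟨s, hs, hs', -⟩ := (m.ext_lt_iff_exists_ratOpen hK).1 hq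
          exact ⟨(s, q), ⟨hs, by exact_mod_cast hq'.le⟩,
            (m.ext_biUnion_lt_iff (bot_le.trans_lt hq)).2 hs'⟩
        · rintro ⟨⟨s, q⟩, ⟨hs, hq⟩, h⟩
          exact ((m.ext_mono (hs.trans (Set.iUnion₂_mono fun i _ => ratBall_subset i))).trans_lt
            h).trans_le (by exact_mod_cast hq)
      rw [this]
      exact @isOpen_biUnion _ _ (_) _ _ fun p _ =>
        TopologicalSpace.isOpen_generateFrom_of_mem (Or.inl ⟨p, rfl⟩)
    · have : {m : SupMeasure | x < m.onOpen G} =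
          ⋃ p ∈ {p : (ℕ × ℕ) × ℚ | ratClosedBall p.1 ⊆ (G : Set ℝ≥0) ∧ x ≤ Real.toNNReal p.2},
            {m : SupMeasure | (Real.toNNReal p.2 : ℝ≥0) <
              m.onOpen ⟨ratBall p.1, isOpen_ratBall p.1⟩} := by
        ext m
        simp only [Set.mem_ofPred_eq, Set.mem_iUnion, exists_prop]
        constructor
        · intro h
          rw [onOpen_eq_iSup_ratBall] at h
          simp only [lt_iSup_iff] at h
          obtain ⟨i, hi, h⟩ := h
          obtain ⟨q, -, hq, hq'⟩ := ENNReal.lt_iff_exists_rat_btwn.1 h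
          exact ⟨(i, q), ⟨hi, by exact_mod_cast hq.le⟩, hq'⟩
        · rintro ⟨⟨i, q⟩, ⟨hi, hq⟩, h⟩
          exact lt_of_le_of_lt (by exact_mod_cast hq)
            (h.trans_le (m.mono (show _ ≤ G from (ratBall_subset i).trans hi)))
      rw [this]
      exact @isOpen_biUnion _ _ (_) _ _ fun p _ =>
        TopologicalSpace.isOpen_generateFrom_of_mem (Or.inr ⟨p, rfl⟩)

/-- A map into the space of sup-measures is measurable if its evaluations on open sets are. -/
lemma measurable_of_onOpen {Ω : Type*} [MeasurableSpace Ω] {f : Ω → SupMeasure}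
    (h : ∀ G, Measurable fun ω => (f ω).onOpen G) : Measurable f := by
  rw [BorelSpace.measurable_eq (α := SupMeasure),
    borel_eq_generateFrom_of_subbasis (α := SupMeasure) rfl]
  refine measurable_generateFrom ?_
  rintro _ (⟨K, x, hK, rfl⟩ | ⟨G, x, rfl⟩)
  · have : f ⁻¹' {m : SupMeasure | m.ext K < x} =
        ⋃ s ∈ {s : Finset (ℕ × ℕ) | K ⊆ ⋃ i ∈ s, ratBall i},
          {ω | (f ω).onOpen (ratOpen s) < x} := by
      ext ω
      simp only [Set.mem_preimage, Set.mem_ofPred_eq, Set.mem_iUnion, exists_prop]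
      constructor
      · intro hω
        obtain ⟨s, hs, -, hs'⟩ := ((f ω).ext_lt_iff_exists_ratOpen hK).1 hω
        exact ⟨s, hs, hs'⟩
      · rintro ⟨s, hs, h⟩
        exact ((f ω).ext_le_onOpen (G := ratOpen s) hs).trans_lt h
    rw [this]
    exact MeasurableSet.biUnion (Set.to_countable _) fun s _ =>
      measurableSet_lt (h _) measurable_const
  · exact measurableSet_lt measurable_const (h _)

/-- Every measurable set of sup-measures is determined by the values on open sets. -/
lemma exists_measurableSet_preimage_onOpen {A : Set SupMeasure} (hA : MeasurableSet A) :
    ∃ B : Set (TopologicalSpace.Opens ℝ≥0 → ℝ≥0∞), MeasurableSet B ∧ onOpen ⁻¹' B = A := by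
  -- The identity, with the σ-algebra pulled back along `onOpen` on its source, has measurable
  -- evaluations; hence the Borel σ-algebra is contained in the pulled back one.
  have : Measurable[MeasurableSpace.comap onOpen inferInstance] (id : SupMeasure → SupMeasure) := by
    refine @measurable_of_onOpen _ (MeasurableSpace.comap onOpen inferInstance) _ fun G => ?_
    exact (measurable_pi_apply G).comp (comap_measurable onOpen)
  exact this hA

end SupMeasure

/-! ### Uniqueness of Laplace transforms -/

/-- The function `x ↦ exp (-x)` on `[0, ∞)`. -/
def expNegBCF : BoundedContinuousFunction ℝ≥0 ℝ :=
  BoundedContinuousFunction.ofNormedAddCommGroup (fun x : ℝ≥0 => Real.exp (-(x : ℝ)))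
    (by fun_prop) 1 (fun x => by
      rw [Real.norm_eq_abs, abs_of_pos (Real.exp_pos _), Real.exp_le_one_iff]
      simp)

@[simp] lemma expNegBCF_apply (x : ℝ≥0) : expNegBCF x = Real.exp (-(x : ℝ)) := rfl

/-- The Laplace transform of a measure on `[0, ∞)`. -/
def laplaceTransform (μ : Measure ℝ≥0) (θ : ℝ≥0) : ℝ≥0∞ :=
  ∫⁻ x, ENNReal.ofReal (Real.exp (-((θ : ℝ) * (x : ℝ)))) ∂μ

lemma measurable_laplaceKernel (θ : ℝ≥0) :
    Measurable fun x : ℝ≥0 => ENNReal.ofReal (Real.exp (-((θ : ℝ) * (x : ℝ)))) := by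
  fun_prop

/-- A finite measure on `[0, ∞)` is determined by its Laplace transform at the integers. -/
lemma ext_of_laplace_nat {μ ν : Measure ℝ≥0} [IsFiniteMeasure μ] [IsFiniteMeasure ν]
    (h : ∀ n : ℕ, laplaceTransform μ n = laplaceTransform ν n) : μ = ν := by
  -- Polynomials in `exp (-x)` form a point-separating algebra, and their integrals are linear
  -- combinations of Laplace transforms at the integers.
  let A : StarSubalgebra ℝ (BoundedContinuousFunction ℝ≥0 ℝ) :=
    { Algebra.adjoin ℝ {expNegBCF} with
      star_mem' := fun {a} ha => by
        have : star a = a := by ext x; simp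
        rw [this]; exact ha }
  have hpow (ρ : Measure ℝ≥0) [IsFiniteMeasure ρ] (n : ℕ) :
      ∫ x, Real.exp (-(x : ℝ)) ^ n ∂ρ = (laplaceTransform ρ n).toReal := by
    rw [laplaceTransform, integral_eq_lintegral_of_nonneg_ae (Filter.Eventually.of_forall fun x => by
      positivity) (Continuous.aestronglyMeasurable (by fun_prop))]
    congr 1
    refine lintegral_congr fun x => ?_
    rw [← Real.exp_nat_mul]
    congr 2
    simp
  refine ext_of_forall_mem_subalgebra_integral_eq_of_polish (𝕜 := ℝ) (A := A) ?_ ?_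
  · intro x y hxy
    refine ⟨expNegBCF, ⟨_, ⟨expNegBCF, Algebra.subset_adjoin rfl, rfl⟩, rfl⟩, ?_⟩
    simpa using hxy
  · intro g hg
    have hg : g ∈ Algebra.adjoin ℝ {expNegBCF} := hg
    rw [Algebra.adjoin_singleton_eq_range_aeval] at hg
    obtain ⟨p, rfl⟩ := hg
    have hval (x : ℝ≥0) : (Polynomial.aeval expNegBCF p : BoundedContinuousFunction ℝ≥0 ℝ) x
        = ∑ i ∈ p.support, p.coeff i * Real.exp (-(x : ℝ)) ^ i := by
      rw [Polynomial.aeval_eq_sum_range]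
      rw [Finset.sum_subset Polynomial.supp_subset_range_natDegree_succ]
      · simp
      · intro i _ hi
        simp [Polynomial.notMem_support_iff.1 hi]
    have hsum (ρ : Measure ℝ≥0) [IsFiniteMeasure ρ] :
        ∫ x, (Polynomial.aeval expNegBCF p : BoundedContinuousFunction ℝ≥0 ℝ) x ∂ρ
          = ∑ i ∈ p.support, p.coeff i * (laplaceTransform ρ i).toReal := by
      simp only [hval]
      rw [integral_finsetSum]
      · refine Finset.sum_congr rfl fun i _ => ?_
        rw [integral_const_mul, hpow]
      · intro i _
        exact ((expNegBCF ^ i).integrable ρ).const_mul _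
    change ∫ x, (Polynomial.aeval expNegBCF p : BoundedContinuousFunction ℝ≥0 ℝ) x ∂μ
      = ∫ x, (Polynomial.aeval expNegBCF p : BoundedContinuousFunction ℝ≥0 ℝ) x ∂ν
    rw [hsum, hsum]
    simp only [h]

/-- A measure on `[0, ∞)` with finite Laplace transform on `(0, ∞)` is determined by it. -/
lemma ext_of_laplace {μ ν : Measure ℝ≥0} (hμ : ∀ θ : ℝ≥0, 0 < θ → laplaceTransform μ θ ≠ ∞)
    (h : ∀ θ : ℝ≥0, 0 < θ → laplaceTransform μ θ = laplaceTransform ν θ) : μ = ν := by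
  -- The density `exp (-x)` makes both measures finite and moves their transforms by `1`; as it is
  -- positive and finite, it can be divided out at the end.
  let e : ℝ≥0 → ℝ≥0∞ := fun x => ENNReal.ofReal (Real.exp (-((1 : ℝ≥0) * (x : ℝ))))
  have he : Measurable e := measurable_laplaceKernel 1
  have hfin : ∀ ρ : Measure ℝ≥0, laplaceTransform ρ 1 ≠ ∞ → IsFiniteMeasure (ρ.withDensity e) :=
    fun ρ hρ => isFiniteMeasure_withDensity hρ
  have hlap (ρ : Measure ℝ≥0) (n : ℕ) : laplaceTransform (ρ.withDensity e) n = laplaceTransform ρ (n + 1) := by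
    rw [laplaceTransform, lintegral_withDensity_eq_lintegral_mul _ he (measurable_laplaceKernel _), laplaceTransform]
    refine lintegral_congr fun x => ?_
    simp only [Pi.mul_apply, e]
    rw [← ENNReal.ofReal_mul (Real.exp_pos _).le, ← Real.exp_add]
    congr 2
    push_cast
    ring
  have := hfin μ (hμ 1 one_pos)
  have := hfin ν (h 1 one_pos ▸ hμ 1 one_pos)
  have heq : μ.withDensity e = ν.withDensity e := ext_of_laplace_nat fun n => by
    rw [hlap, hlap, h _ (by positivity)]
  have hinv (ρ : Measure ℝ≥0) : (ρ.withDensity e).withDensity (fun x => (e x)⁻¹) = ρ :=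
    withDensity_inv_same he (Filter.Eventually.of_forall fun x => by
      simpa [e] using Real.exp_pos _) (Filter.Eventually.of_forall fun x => by simp [e])
  rw [← hinv μ, heq, hinv ν]

/-! ### Subordinators with regular paths -/

/-- A stable subordinator all of whose paths start at `0` and are nondecreasing, right-continuous
and unbounded. -/
structure IsRegularSubordinator {Ω : Type*} [MeasurableSpace Ω] (β c : ℝ) (S : ℝ≥0 → Ω → ℝ≥0)
    (P : Measure Ω) : Prop where
  measurable : ∀ t, Measurable (S t)
  zero : ∀ ω, S 0 ω = 0
  mono : ∀ ω, Monotone fun t => S t ω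
  rightCont : ∀ ω t, ContinuousWithinAt (fun s => S s ω) (Set.Ici t) t
  unbounded : ∀ ω x, ∃ t, x ≤ S t ω
  indep : HasIndepIncrements S P
  stationary : ∀ s t : ℝ≥0, IdentDistrib (fun ω => S (s + t) ω - S s ω) (S t) P P
  laplace_map : ∀ t θ : ℝ≥0,
    laplaceTransform (P.map (S t)) θ = ENNReal.ofReal (Real.exp (-(c * (t : ℝ) * (θ : ℝ) ^ β)))

lemma laplace_map_eq {Ω : Type*} [MeasurableSpace Ω] {P : Measure Ω} {X : Ω → ℝ≥0}
    (hX : Measurable X) (θ : ℝ≥0) :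
    laplaceTransform (P.map X) θ = ∫⁻ ω, ENNReal.ofReal (Real.exp (-((θ : ℝ) * (X ω : ℝ)))) ∂P := by
  rw [laplaceTransform, lintegral_map (measurable_laplaceKernel θ) hX]

lemma laplace_map_eq_ofReal {Ω : Type*} [MeasurableSpace Ω] {P : Measure Ω} [IsFiniteMeasure P]
    {X : Ω → ℝ≥0} (hX : Measurable X) (θ : ℝ≥0) :
    laplaceTransform (P.map X) θ = ENNReal.ofReal (∫ ω, Real.exp (-((θ : ℝ) * (X ω : ℝ))) ∂P) := by
  rw [laplace_map_eq hX, ofReal_integral_eq_lintegral_ofReal]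
  · refine Integrable.of_bound (C := 1) (Measurable.aestronglyMeasurable (by fun_prop))
      (Filter.Eventually.of_forall fun ω => ?_)
    rw [Real.norm_eq_abs, abs_of_pos (Real.exp_pos _), Real.exp_le_one_iff]
    simp only [Left.neg_nonpos_iff]
    positivity
  · exact Filter.Eventually.of_forall fun ω => (Real.exp_pos _).le

section

variable {Ω : Type*} [MeasurableSpace Ω] {P : Measure Ω}

/-- Exponential Markov inequality: `P (S n < M) ≤ exp M · E exp (-S n) = exp (M - c n)`, which tends
to `0` in `n`. -/
lemma ae_unbounded_of_laplace [IsProbabilityMeasure P] {c : ℝ} (hc : 0 < c) {S : ℕ → Ω → ℝ≥0}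
    (hS : ∀ n, Measurable (S n))
    (h : ∀ n, laplaceTransform (P.map (S n)) 1 = ENNReal.ofReal (Real.exp (-(c * n)))) :
    ∀ᵐ ω ∂P, ∀ x : ℝ≥0, ∃ n, x ≤ S n ω := by
  have key (M : ℕ) : ∀ᵐ ω ∂P, ∃ n, (M : ℝ≥0) ≤ S n ω := by
    rw [ae_iff]
    have hb (n : ℕ) : P {ω | ¬ ∃ n, (M : ℝ≥0) ≤ S n ω}
        ≤ ENNReal.ofReal (Real.exp M) * ENNReal.ofReal (Real.exp (-(c * n))) := by
      rw [← h n, laplace_map_eq (hS n), ← lintegral_const_mul _ (by fun_prop)]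
      have hm : MeasurableSet {ω | S n ω < M} := measurableSet_lt (hS n) measurable_const
      calc P {ω | ¬ ∃ n, (M : ℝ≥0) ≤ S n ω} ≤ P {ω | S n ω < M} :=
            measure_mono fun ω hω => by
              simp only [Set.mem_ofPred_eq, not_exists, not_le] at hω ⊢
              exact hω n
        _ = ∫⁻ ω, Set.indicator {ω | S n ω < M} 1 ω ∂P := (lintegral_indicator_one hm).symm
        _ ≤ _ := lintegral_mono fun ω => by
          by_cases hω : S n ω < M
          swap
          · rw [Set.indicator_of_notMem (show ω ∉ {ω | S n ω < M} from hω)]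
            exact bot_le
          rw [Set.indicator_of_mem (show ω ∈ {ω | S n ω < M} from hω)]
          rw [← ENNReal.ofReal_mul (Real.exp_pos _).le, ← Real.exp_add]
          rw [Pi.one_apply, ← ENNReal.ofReal_one]
          refine ENNReal.ofReal_le_ofReal (Real.one_le_exp ?_)
          have : (S n ω : ℝ) < M := by exact_mod_cast hω
          simp only [NNReal.coe_one, one_mul]
          linarith
    have hlim : Filter.Tendsto (fun n : ℕ => ENNReal.ofReal (Real.exp M) *
        ENNReal.ofReal (Real.exp (-(c * n)))) Filter.atTop (nhds 0) := by
      have h1 : Filter.Tendsto (fun n : ℕ => Real.exp (-(c * n))) Filter.atTop (nhds 0) :=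
        Real.tendsto_exp_neg_atTop_nhds_zero.comp
          (tendsto_natCast_atTop_atTop.const_mul_atTop hc)
      have h2 := ENNReal.Tendsto.const_mul (a := ENNReal.ofReal (Real.exp M))
        (ENNReal.tendsto_ofReal h1) (Or.inr ENNReal.ofReal_ne_top)
      simpa using h2
    exact le_antisymm (ge_of_tendsto' hlim hb) zero_le
  filter_upwards [ae_all_iff.2 key] with ω hω x
  obtain ⟨M, hM⟩ := exists_nat_ge x
  obtain ⟨n, hn⟩ := hω M
  exact ⟨n, hM.trans hn⟩

/-- A stable subordinator is indistinguishable from one with regular paths. -/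
lemma IsStableSubordinator.exists_regular [IsProbabilityMeasure P] {β : ℝ} {S : ℝ≥0 → Ω → ℝ≥0}
    (hS : IsStableSubordinator β S P) :
    ∃ c > 0, ∃ S' : ℝ≥0 → Ω → ℝ≥0, IsRegularSubordinator β c S' P ∧
      ∀ᵐ ω ∂P, ∀ t, S t ω = S' t ω := by
  obtain ⟨c, hc, hlap⟩ := hS.laplace
  have hlap' (t θ : ℝ≥0) : laplaceTransform (P.map (S t)) θ
      = ENNReal.ofReal (Real.exp (-(c * (t : ℝ) * (θ : ℝ) ^ β))) := by
    rw [laplace_map_eq_ofReal (hS.measurable t), hlap]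
  have hunb : ∀ᵐ ω ∂P, ∀ x : ℝ≥0, ∃ n : ℕ, x ≤ S n ω :=
    ae_unbounded_of_laplace hc (fun n => hS.measurable n) fun n => by
      rw [hlap']; simp
  obtain ⟨s, hs, hsm, hgood⟩ := ((hS.zero.and hS.path).and hunb).exists_measurable_mem
  classical
  -- On the exceptional null set the path is replaced by `t ↦ t`, which starts at `0` and is
  -- nondecreasing, continuous and unbounded.
  let S' : ℝ≥0 → Ω → ℝ≥0 := fun t => s.piecewise (S t) (fun _ => t)
  have hin {ω} (hω : ω ∈ s) (t) : S' t ω = S t ω := Set.piecewise_eq_of_mem _ _ _ hω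
  have hout {ω} (hω : ω ∉ s) (t) : S' t ω = t := Set.piecewise_eq_of_notMem _ _ _ hω
  have hae : ∀ᵐ ω ∂P, ∀ t, S t ω = S' t ω := by
    filter_upwards [hs] with ω hω t using (hin hω t).symm
  have haet (t) : S t =ᵐ[P] S' t := hae.mono fun ω h => h t
  have hmeas (t) : Measurable (S' t) := (hS.measurable t).piecewise hsm measurable_const
  refine ⟨c, hc, S', ⟨hmeas, fun ω => ?_, fun ω => ?_, fun ω t => ?_, fun ω x => ?_,
    fun n t ht => ?_, fun a t => ?_, fun t θ => ?_⟩, hae⟩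
  · by_cases hω : ω ∈ s
    · rw [hin hω]; exact (hgood ω hω).1.1
    · rw [hout hω]
  · by_cases hω : ω ∈ s
    · simp only [hin hω]; exact (hgood ω hω).1.2.1
    · simp only [hout hω]; exact monotone_id
  · by_cases hω : ω ∈ s
    · simp only [hin hω]; exact (hgood ω hω).1.2.2 t
    · simp only [hout hω]; exact continuousWithinAt_id
  · by_cases hω : ω ∈ s
    · obtain ⟨n, hn⟩ := (hgood ω hω).2 x
      exact ⟨n, by rwa [hin hω]⟩
    · exact ⟨x, by rw [hout hω]⟩
  · exact (hS.indep n t ht).congr fun i => (haet _).sub (haet _)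
  · have h := hS.stationary a t
    refine ⟨((hmeas _).sub (hmeas _)).aemeasurable, (hmeas t).aemeasurable, ?_⟩
    have h' := h.map_eq
    rw [Measure.map_congr (haet t)] at h'
    rw [← h']
    exact (Measure.map_congr ((haet (a + t)).sub (haet a))).symm
  · rw [← Measure.map_congr (haet t), hlap']

/-! ### Processes along the dyadic numbers -/

/-- The dyadic number `k / 2 ^ n`, for `p = (n, k)`. -/
def dyadic (p : ℕ × ℕ) : ℝ≥0 := (p.2 : ℝ≥0) / 2 ^ p.1

lemma dyadic_refine {n N : ℕ} (h : n ≤ N) (k : ℕ) :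
    dyadic (n, k) = dyadic (N, k * 2 ^ (N - n)) := by
  obtain ⟨d, rfl⟩ := Nat.exists_eq_add_of_le h
  simp only [dyadic, Nat.add_sub_cancel_left, Nat.cast_mul, Nat.cast_pow, Nat.cast_ofNat, pow_add]
  rw [mul_div_mul_right _ _ (by positivity)]

lemma dyadic_mono (n : ℕ) : Monotone fun k => dyadic (n, k) := fun k l h => by
  simp only [dyadic]
  gcongr

lemma dyadic_add (n k l : ℕ) : dyadic (n, k) + dyadic (n, l) = dyadic (n, k + l) := by
  simp only [dyadic, Nat.cast_add, add_div]

lemma dyadic_zero (n : ℕ) : dyadic (n, 0) = 0 := by simp [dyadic]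

/-- The increments of a process along the dyadic grid of level `N`. -/
def gridIncr {Ω : Type*} (X : ℝ≥0 → Ω → ℝ≥0) (N i : ℕ) (ω : Ω) : ℝ≥0 :=
  X (dyadic (N, i + 1)) ω - X (dyadic (N, i)) ω

/-- The sum telescopes; monotonicity guarantees that the truncated differences in `gridIncr` are
true differences. -/
lemma grid_add_sum {Ω : Type*} {X : ℝ≥0 → Ω → ℝ≥0} {ω : Ω} (hX : Monotone fun t => X t ω) (N k l : ℕ) :
    X (dyadic (N, k)) ω + ∑ i ∈ Finset.range l, gridIncr X N (k + i) ω
      = X (dyadic (N, k + l)) ω := by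
  induction l with
  | zero => simp
  | succ l ih =>
    rw [Finset.sum_range_succ, ← add_assoc, ih, gridIncr, ← add_assoc k l 1]
    exact add_tsub_cancel_of_le (hX (dyadic_mono N (Nat.le_succ _)))

lemma iIndepFun_gridIncr {X : ℝ≥0 → Ω → ℝ≥0} (hX : HasIndepIncrements X P)
    (N : ℕ) : iIndepFun (gridIncr X N) P :=
  hX.nat (t := fun i => dyadic (N, i)) (dyadic_mono N)

lemma measurable_gridIncr {X : ℝ≥0 → Ω → ℝ≥0} (hX : ∀ t, Measurable (X t)) (N i : ℕ) :
    Measurable (gridIncr X N i) := (hX _).sub (hX _)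

/-- The law along the dyadic numbers of a nondecreasing process with independent increments is
determined by the laws of the increments. -/
lemma map_dyadic_eq_of_increments [IsProbabilityMeasure P] {X Y : ℝ≥0 → Ω → ℝ≥0}
    (hX : ∀ t, Measurable (X t)) (hY : ∀ t, Measurable (Y t))
    (hX0 : ∀ ω, X 0 ω = 0) (hY0 : ∀ ω, Y 0 ω = 0)
    (hXm : ∀ ω, Monotone fun t => X t ω) (hYm : ∀ ω, Monotone fun t => Y t ω)
    (hXi : HasIndepIncrements X P) (hYi : HasIndepIncrements Y P)
    (h : ∀ N i, P.map (gridIncr X N i) = P.map (gridIncr Y N i)) :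
    P.map (fun ω p => X (dyadic p) ω) = P.map (fun ω p => Y (dyadic p) ω) := by
  rw [map_eq_iff_forall_finset_map_restrict_eq
    (X := fun p => X (dyadic p)) (Y := fun p => Y (dyadic p))
    (measurable_pi_lambda _ fun p => hX _).aemeasurable
    (measurable_pi_lambda _ fun p => hY _).aemeasurable]
  intro I
  -- All times in `I` lie on the grid of level `N`, so the values there are partial sums, through
  -- one map `g`, of independent increments whose laws agree for `X` and `Y`.
  let N := I.sup Prod.fst
  let g : (ℕ → ℝ≥0) → (I → ℝ≥0) := fun δ p =>
    ∑ i ∈ Finset.range (p.1.2 * 2 ^ (N - p.1.1)), δ i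
  have hg : Measurable g := by
    refine measurable_pi_lambda _ fun p => Finset.measurable_sum _ fun i _ => measurable_pi_apply i
  have hrep {Z : ℝ≥0 → Ω → ℝ≥0} (hZ0 : ∀ ω, Z 0 ω = 0) (hZm : ∀ ω, Monotone fun t => Z t ω) :
      (fun ω => I.restrict (fun p => Z (dyadic p) ω)) = g ∘ fun ω i => gridIncr Z N i ω := by
    ext ω p
    have hN : p.1.1 ≤ N := Finset.le_sup (f := Prod.fst) p.2
    have := grid_add_sum (hZm ω) N 0 (p.1.2 * 2 ^ (N - p.1.1))
    simp only [dyadic_zero, hZ0, zero_add] at this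
    simp only [Finset.restrict, Function.comp_apply, g]
    rw [this, ← dyadic_refine hN]
  rw [hrep hX0 hXm, hrep hY0 hYm, ← Measure.map_map hg (measurable_pi_lambda _ fun i =>
    measurable_gridIncr hX N i), ← Measure.map_map hg (measurable_pi_lambda _ fun i =>
    measurable_gridIncr hY N i)]
  rw [(iIndepFun_gridIncr hXi N).map_fun_eq_infinitePi_map (measurable_gridIncr hX N),
    (iIndepFun_gridIncr hYi N).map_fun_eq_infinitePi_map (measurable_gridIncr hY N)]
  simp only [h]

namespace IsRegularSubordinator

variable {β c : ℝ} {S : ℝ≥0 → Ω → ℝ≥0}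

lemma map_sub (hS : IsRegularSubordinator β c S P) {s t : ℝ≥0} (h : s ≤ t) :
    P.map (fun ω => S t ω - S s ω) = P.map (S (t - s)) := by
  have := (hS.stationary s (t - s)).map_eq
  rwa [add_tsub_cancel_of_le h] at this

lemma map_eq_of_laplace [IsProbabilityMeasure P] (hS : IsRegularSubordinator β c S P) {t : ℝ≥0} {X : Ω → ℝ≥0}
    (hX : Measurable X)
    (h : ∀ θ : ℝ≥0, laplaceTransform (P.map X) θ
      = ENNReal.ofReal (Real.exp (-(c * (t : ℝ) * (θ : ℝ) ^ β)))) : P.map X = P.map (S t) := by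
  have := Measure.isProbabilityMeasure_map (μ := P) hX.aemeasurable
  have := Measure.isProbabilityMeasure_map (μ := P) (hS.measurable t).aemeasurable
  exact ext_of_laplace_nat fun n => by rw [h, hS.laplace_map]

/-- The increments of a regular subordinator after a fixed time. -/
lemma map_future [IsProbabilityMeasure P] (hS : IsRegularSubordinator β c S P) (s : ℝ≥0) :
    P.map (fun ω p => S (s + dyadic p) ω - S s ω) = P.map (fun ω p => S (dyadic p) ω) := by
  have hsub (ω) {a b : ℝ≥0} (h : a ≤ b) :
      S (s + b) ω - S s ω - (S (s + a) ω - S s ω) = S (s + b) ω - S (s + a) ω :=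
    tsub_tsub_tsub_cancel_right (hS.mono ω le_self_add)
  refine map_dyadic_eq_of_increments (X := fun t ω => S (s + t) ω - S s ω) (Y := S)
    (fun t => (hS.measurable _).sub (hS.measurable _)) hS.measurable (fun ω => by simp) hS.zero
    (fun ω a b h => tsub_le_tsub_right (hS.mono ω (by gcongr)) _) hS.mono ?_ hS.indep ?_
  · intro n t ht
    have := hS.indep n (fun i => s + t i) (fun i j h => by simpa using ht h)
    convert this using 3 with i ω
    exact hsub ω (ht i.castSucc_lt_succ.le)
  · intro N i
    have h1 : gridIncr (fun t ω => S (s + t) ω - S s ω) N i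
        = fun ω => S (s + dyadic (N, i + 1)) ω - S (s + dyadic (N, i)) ω :=
      funext fun ω => hsub ω (dyadic_mono N (Nat.le_succ i))
    have h2 : gridIncr S N i = fun ω => S (dyadic (N, i + 1)) ω - S (dyadic (N, i)) ω := rfl
    rw [h1, h2, hS.map_sub (by gcongr; exact dyadic_mono N (Nat.le_succ i)),
      hS.map_sub (dyadic_mono N (Nat.le_succ i)), add_tsub_add_eq_tsub_left]

/-- Self-similarity of a stable subordinator. -/
lemma map_scaling [IsProbabilityMeasure P] (hS : IsRegularSubordinator β c S P) {a : ℝ≥0} (ha : 0 < a) :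
    P.map (fun ω p => a⁻¹ * S (a ^ β * dyadic p) ω) = P.map (fun ω p => S (dyadic p) ω) := by
  refine map_dyadic_eq_of_increments (X := fun t ω => a⁻¹ * S (a ^ β * t) ω) (Y := S)
    (fun t => (hS.measurable _).const_mul _) hS.measurable (fun ω => by simp [hS.zero]) hS.zero
    (fun ω s t h => mul_le_mul_right (hS.mono ω (by gcongr)) _) hS.mono ?_ hS.indep ?_
  · intro n t ht
    have := (hS.indep n (fun i => a ^ β * t i) (fun i j h => mul_le_mul_right (ht h) _)).comp
      (fun _ x => a⁻¹ * x) (fun _ => by fun_prop)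
    convert this using 3 with i ω
    simp [mul_tsub]
  · intro N i
    have hle : dyadic (N, i) ≤ dyadic (N, i + 1) := dyadic_mono N (Nat.le_succ i)
    have h1 : gridIncr (fun t ω => a⁻¹ * S (a ^ β * t) ω) N i
        = (fun x => a⁻¹ * x) ∘ fun ω => S (a ^ β * dyadic (N, i + 1)) ω
          - S (a ^ β * dyadic (N, i)) ω := by
      funext ω
      simp [gridIncr, mul_tsub]
    have h2 : gridIncr S N i = fun ω => S (dyadic (N, i + 1)) ω - S (dyadic (N, i)) ω := rfl
    rw [h1, h2, hS.map_sub hle, ← Measure.map_map (measurable_const_mul _)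
      (f := fun ω => S (a ^ β * dyadic (N, i + 1)) ω - S (a ^ β * dyadic (N, i)) ω)
      ((hS.measurable _).sub (hS.measurable _)), hS.map_sub (by gcongr),
      Measure.map_map (by fun_prop) (hS.measurable _), ← mul_tsub]
    refine hS.map_eq_of_laplace ((hS.measurable _).const_mul _) fun θ => ?_
    have := hS.laplace_map (a ^ β * (dyadic (N, i + 1) - dyadic (N, i))) (θ * a⁻¹)
    rw [laplace_map_eq (hS.measurable _)] at this
    rw [laplace_map_eq ((measurable_const_mul _).comp (hS.measurable _))]
    have ha' : (0 : ℝ) < a := ha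
    -- Slowing time by `a ^ β` cancels against `(θ / a) ^ β` in the Laplace exponent; this is where
    -- stability enters.
    have hexp : c * ((dyadic (N, i + 1) - dyadic (N, i) : ℝ≥0) : ℝ) * (θ : ℝ) ^ β
        = c * ((a ^ β * (dyadic (N, i + 1) - dyadic (N, i)) : ℝ≥0) : ℝ)
          * ((θ * a⁻¹ : ℝ≥0) : ℝ) ^ β := by
      simp only [NNReal.coe_mul, NNReal.coe_rpow, NNReal.coe_inv]
      rw [Real.mul_rpow θ.coe_nonneg (inv_nonneg.2 ha'.le), Real.inv_rpow ha'.le]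
      have : (a : ℝ) ^ β ≠ 0 := (Real.rpow_pos_of_pos ha' _).ne'
      field_simp
    rw [hexp, ← this]
    simp [mul_assoc]

end IsRegularSubordinator

end

/-! ### The strong Markov property at first passage times -/

/-- The index of the first point `k / 2 ^ n` which is at least `t`. -/
def dyadicIdx (n : ℕ) (t : ℝ≥0) : ℕ := ⌈2 ^ n * t⌉₊

lemma measurable_dyadicIdx (n : ℕ) : Measurable (dyadicIdx n) :=
  Nat.measurable_ceil.comp (measurable_const_mul _)

lemma dyadicIdx_le_iff {n k : ℕ} {t : ℝ≥0} : dyadicIdx n t ≤ k ↔ t ≤ dyadic (n, k) := by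
  rw [dyadicIdx, Nat.ceil_le, dyadic, le_div_iff₀ (by positivity), mul_comm]

lemma le_dyadic_dyadicIdx (n : ℕ) (t : ℝ≥0) : t ≤ dyadic (n, dyadicIdx n t) :=
  dyadicIdx_le_iff.1 le_rfl

/-- The approximation is from the right, with error at most `2 ^ (-n)`, so that right-continuity of
paths applies. -/
lemma tendsto_dyadic_dyadicIdx (t : ℝ≥0) :
    Filter.Tendsto (fun n => dyadic (n, dyadicIdx n t)) Filter.atTop (nhds t) := by
  have hub (n : ℕ) : dyadic (n, dyadicIdx n t) ≤ t + (1 / 2) ^ n := by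
    have h := (Nat.ceil_lt_add_one (show (0 : ℝ≥0) ≤ 2 ^ n * t by positivity)).le
    rw [dyadic, div_le_iff₀ (by positivity), dyadicIdx]
    refine h.trans (le_of_eq ?_)
    rw [add_mul, ← mul_pow]
    norm_num
    ring
  have hlim : Filter.Tendsto (fun n : ℕ => t + (1 / 2 : ℝ≥0) ^ n) Filter.atTop (nhds (t + 0)) :=
    tendsto_const_nhds.add (NNReal.tendsto_pow_atTop_nhds_zero_of_lt_one (by
      rw [← NNReal.coe_lt_coe]; norm_num))
  rw [add_zero] at hlim
  exact tendsto_of_tendsto_of_tendsto_of_le_of_le tendsto_const_nhds hlim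
    (fun n => le_dyadic_dyadicIdx n t) hub

lemma measurable_eval_nat {α Ω E : Type*} [MeasurableSpace α] [MeasurableSpace Ω]
    [MeasurableSpace E] {g : ℕ → Ω → E} (hg : ∀ k, Measurable (g k)) {κ : α → ℕ}
    (hκ : Measurable κ) {π : α → Ω} (hπ : Measurable π) : Measurable fun a => g (κ a) (π a) :=
  (measurable_from_prod_countable_left (f := fun q : Ω × ℕ => g q.2 q.1) hg).comp (hπ.prodMk hκ)

/-- The first passage time of the level `x`. -/
def passage {Ω : Type*} (S : ℝ≥0 → Ω → ℝ≥0) (x : ℝ≥0) (ω : Ω) : ℝ≥0 := sInf {t | x ≤ S t ω}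

namespace IsRegularSubordinator

variable {Ω : Type*} [MeasurableSpace Ω] {P : Measure Ω} {β c : ℝ} {S : ℝ≥0 → Ω → ℝ≥0}

lemma tendsto_of_ge (hS : IsRegularSubordinator β c S P) (ω : Ω) {t : ℝ≥0} {u : ℕ → ℝ≥0}
    (hu : Filter.Tendsto u Filter.atTop (nhds t)) (htu : ∀ n, t ≤ u n) :
    Filter.Tendsto (fun n => S (u n) ω) Filter.atTop (nhds (S t ω)) :=
  (hS.rightCont ω t).tendsto.comp
    (tendsto_nhdsWithin_iff.2 ⟨hu, Filter.Eventually.of_forall htu⟩)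

lemma tendsto_dyadicIdx (hS : IsRegularSubordinator β c S P) (ω : Ω) (t : ℝ≥0) :
    Filter.Tendsto (fun n => S (dyadic (n, dyadicIdx n t)) ω) Filter.atTop (nhds (S t ω)) :=
  hS.tendsto_of_ge ω (tendsto_dyadic_dyadicIdx t) fun n => le_dyadic_dyadicIdx n t

/-- Unboundedness makes the set of times nonempty, and right-continuity makes its infimum attained.
The event `passage ≤ t` is thus decided by `S t` alone. -/
lemma passage_le_iff (hS : IsRegularSubordinator β c S P) {x t : ℝ≥0} {ω : Ω} :
    passage S x ω ≤ t ↔ x ≤ S t ω := by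
  refine ⟨fun h => ?_, fun h => csInf_le' h⟩
  refine le_trans ?_ (hS.mono ω h)
  have hne : {t | x ≤ S t ω}.Nonempty := hS.unbounded ω x
  obtain ⟨u, -, hu, hu'⟩ := exists_seq_tendsto_sInf hne (OrderBot.bddBelow _)
  exact ge_of_tendsto' (hS.tendsto_of_ge ω hu fun n => csInf_le' (hu' n)) hu'

lemma le_at_passage (hS : IsRegularSubordinator β c S P) (x : ℝ≥0) (ω : Ω) :
    x ≤ S (passage S x ω) ω := hS.passage_le_iff.1 le_rfl

/-- Right-continuity exhibits the process as a limit of processes that are constant in time on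
dyadic intervals; it may therefore be evaluated at random times. -/
lemma measurable_uncurry (hS : IsRegularSubordinator β c S P) :
    Measurable fun q : ℝ≥0 × Ω => S q.1 q.2 := by
  have h (n : ℕ) : Measurable fun q : ℝ≥0 × Ω => S (dyadic (n, dyadicIdx n q.1)) q.2 := by
    exact measurable_eval_nat (g := fun k => S (dyadic (n, k))) (fun k => hS.measurable _)
      ((measurable_dyadicIdx n).comp measurable_fst) measurable_snd
  exact measurable_of_tendsto_metrizable h
    (tendsto_pi_nhds.2 fun q => hS.tendsto_dyadicIdx q.2 q.1)

lemma measurable_passage (hS : IsRegularSubordinator β c S P) :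
    Measurable fun q : ℝ≥0 × Ω => passage S q.1 q.2 := by
  refine measurable_of_Iic fun t => ?_
  have : (fun q : ℝ≥0 × Ω => passage S q.1 q.2) ⁻¹' Set.Iic t = {q | q.1 ≤ S t q.2} := by
    ext q
    exact hS.passage_le_iff
  rw [this]
  exact measurableSet_le measurable_fst ((hS.measurable t).comp measurable_snd)

lemma measurable_passage_const (hS : IsRegularSubordinator β c S P) (x : ℝ≥0) :
    Measurable fun ω => passage S x ω :=
  hS.measurable_passage.comp (measurable_const.prodMk measurable_id)

/-- The increments of a regular subordinator after a time of a dyadic grid are independent of the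
values on the grid up to that time. -/
lemma indepFun_past_future [IsProbabilityMeasure P] (hS : IsRegularSubordinator β c S P)
    (n k : ℕ) :
    IndepFun (fun ω (j : Fin (k + 1)) => S (dyadic (n, j)) ω)
      (fun ω p => S (dyadic (n, k) + dyadic p) ω - S (dyadic (n, k)) ω) P := by
  refine IndepFun.indepFun_process (measurable_pi_lambda _ fun j => hS.measurable _)
    (fun p => (hS.measurable _).sub (hS.measurable _)) fun I => ?_
  -- On a common grid of level `N`, the past is built from increments with index below `K` and the
  -- future from those with index at least `K`: disjoint blocks of an independent family.
  let N := max n (I.sup Prod.fst)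
  let K := k * 2 ^ (N - n)
  have hnN : n ≤ N := le_max_left _ _
  have hK : dyadic (n, k) = dyadic (N, K) := dyadic_refine hnN k
  have hm (i : ℕ) : Measurable (gridIncr S N i) := measurable_gridIncr hS.measurable N i
  have hind := indep_iSup_of_disjoint (fun i => (hm i).comap_le)
    (iIndepFun_gridIncr hS.indep N).iIndep
    (Set.disjoint_left.2 (fun i (hi : i ∈ Set.Iio K) (hi' : i ∈ Set.Ici K) =>
      (not_lt.2 (Set.mem_Ici.1 hi')) (Set.mem_Iio.1 hi)))
  rw [IndepFun_iff_Indep]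
  have hmem {T : Set ℕ} {i : ℕ} (hi : i ∈ T) :
      Measurable[⨆ i ∈ T, MeasurableSpace.comap (gridIncr S N i) inferInstance]
        (gridIncr S N i) :=
    (comap_measurable (gridIncr S N i)).mono
      (le_iSup₂ (f := fun i (_ : i ∈ T) => MeasurableSpace.comap (gridIncr S N i) inferInstance)
        i hi) le_rfl
  refine indep_of_indep_of_le hind (Measurable.comap_le ?_) (Measurable.comap_le ?_)
  · refine @measurable_pi_lambda _ _ _ (_) _ _ fun j => ?_
    have hj : (j : ℕ) * 2 ^ (N - n) ≤ K := Nat.mul_le_mul_right _ (Nat.lt_succ_iff.1 j.2)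
    have : (fun ω => S (dyadic (n, j)) ω)
        = fun ω => ∑ i ∈ Finset.range (j * 2 ^ (N - n)), gridIncr S N i ω := by
      funext ω
      have := grid_add_sum (hS.mono ω) N 0 (j * 2 ^ (N - n))
      simp only [dyadic_zero, hS.zero, zero_add] at this
      rw [this, dyadic_refine hnN]
    rw [this]
    refine @Finset.measurable_fun_sum _ _ _ _ _ _ (_) _ _ fun i hi => hmem ?_
    exact (Finset.mem_range.1 hi).trans_le hj
  · refine @measurable_pi_lambda _ _ _ (_) _ _ fun p => ?_
    have hpN : p.1.1 ≤ N := (Finset.le_sup (f := Prod.fst) p.2).trans (le_max_right _ _)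
    have : (fun ω => S (dyadic (n, k) + dyadic p.1) ω - S (dyadic (n, k)) ω)
        = fun ω => ∑ i ∈ Finset.range (p.1.2 * 2 ^ (N - p.1.1)), gridIncr S N (K + i) ω := by
      funext ω
      rw [hK, show dyadic p.1 = dyadic (N, p.1.2 * 2 ^ (N - p.1.1)) from dyadic_refine hpN p.1.2,
        dyadic_add, ← grid_add_sum (hS.mono ω) N K, add_tsub_cancel_left]
    rw [this]
    exact @Finset.measurable_fun_sum _ _ _ _ _ _ (_) _ _ fun i hi => hmem (Nat.le_add_right K i)

/-- The Markov property at the discretized first passage times. -/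
lemma map_discrete_passage [IsProbabilityMeasure P] (hS : IsRegularSubordinator β c S P)
    (x : ℝ≥0) (n : ℕ) :
    P.map (fun ω => (S (dyadic (n, dyadicIdx n (passage S x ω))) ω,
        fun p => S (dyadic (n, dyadicIdx n (passage S x ω)) + dyadic p) ω
          - S (dyadic (n, dyadicIdx n (passage S x ω))) ω))
      = (P.map fun ω => S (dyadic (n, dyadicIdx n (passage S x ω))) ω).prod
          (P.map fun ω p => S (dyadic p) ω) := by
  let κ : Ω → ℕ := fun ω => dyadicIdx n (passage S x ω)
  have hκ : Measurable κ := (measurable_dyadicIdx n).comp (hS.measurable_passage_const x)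
  have hT : Measurable fun ω => dyadic (n, κ ω) :=
    (measurable_from_top (f := fun k : ℕ => dyadic (n, k))).comp hκ
  have hSκ : Measurable fun ω => S (dyadic (n, κ ω)) ω :=
    hS.measurable_uncurry.comp (hT.prodMk measurable_id)
  have hfut : Measurable fun ω (p : ℕ × ℕ) => S (dyadic (n, κ ω) + dyadic p) ω
      - S (dyadic (n, κ ω)) ω :=
    measurable_pi_lambda _ fun p =>
      (hS.measurable_uncurry.comp ((hT.add_const _).prodMk measurable_id)).sub hSκ
  have hSd : Measurable fun ω (p : ℕ × ℕ) => S (dyadic p) ω :=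
    measurable_pi_lambda _ fun p => hS.measurable _
  have := Measure.isProbabilityMeasure_map (μ := P) hSκ.aemeasurable
  have := Measure.isProbabilityMeasure_map (μ := P) hSd.aemeasurable
  symm
  refine Measure.prod_eq fun A B hA hB => ?_
  rw [Measure.map_apply (hSκ.prodMk hfut) (hA.prod hB), Measure.map_apply hSκ hA]
  -- The discretized passage index is a stopping time: `κ = k` is decided by the grid values up to
  -- `k`. Splitting along `κ` reduces the claim to the Markov property at fixed times.
  have hκk (k : ℕ) : {ω | κ ω = k} = {ω | x ≤ S (dyadic (n, k)) ω ∧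
      ∀ j : Fin k, S (dyadic (n, j)) ω < x} := by
    ext ω
    simp only [Set.mem_ofPred_eq, κ]
    constructor
    · intro h
      refine ⟨hS.passage_le_iff.1 (dyadicIdx_le_iff.1 h.le), fun j => ?_⟩
      by_contra hj
      have := dyadicIdx_le_iff.2 (hS.passage_le_iff.2 (not_lt.1 hj))
      exact absurd j.2 (not_lt.2 (h ▸ this))
    · rintro ⟨h1, h2⟩
      refine le_antisymm (dyadicIdx_le_iff.2 (hS.passage_le_iff.2 h1)) (not_lt.1 fun hlt => ?_)
      exact absurd (hS.passage_le_iff.1 (dyadicIdx_le_iff.1 le_rfl)) (not_le.2 (h2 ⟨_, hlt⟩))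
  have hpart (D : ℕ → Set Ω) (hD : ∀ k, MeasurableSet (D k)) :
      P {ω | ω ∈ D (κ ω)} = ∑' k, P ({ω | κ ω = k} ∩ D k) := by
    rw [← measure_iUnion]
    · congr 1
      ext ω
      simp
    · intro i j hij
      exact Set.disjoint_left.2 fun ω h1 h2 => hij (h1.1.symm.trans h2.1)
    · exact fun k => (hκ (measurableSet_singleton k)).inter (hD k)
  have h1 : (fun ω => S (dyadic (n, κ ω)) ω) ⁻¹' A
      = {ω | ω ∈ (fun k => (fun ω => S (dyadic (n, k)) ω) ⁻¹' A) (κ ω)} := rfl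
  have h2 : (fun ω => (S (dyadic (n, κ ω)) ω, fun p => S (dyadic (n, κ ω) + dyadic p) ω
      - S (dyadic (n, κ ω)) ω)) ⁻¹' A ×ˢ B
      = {ω | ω ∈ (fun k => (fun ω => S (dyadic (n, k)) ω) ⁻¹' A ∩
        (fun ω p => S (dyadic (n, k) + dyadic p) ω - S (dyadic (n, k)) ω) ⁻¹' B) (κ ω)} := rfl
  have hmA (k : ℕ) : MeasurableSet ((fun ω => S (dyadic (n, k)) ω) ⁻¹' A) := hS.measurable _ hA
  have hmB (k : ℕ) : MeasurableSet ((fun ω p => S (dyadic (n, k) + dyadic p) ω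
      - S (dyadic (n, k)) ω) ⁻¹' B) :=
    (measurable_pi_lambda _ fun p => (hS.measurable _).sub (hS.measurable _)) hB
  rw [h2, h1, hpart _ hmA, hpart _ fun k => (hmA k).inter (hmB k), ← ENNReal.tsum_mul_right]
  refine tsum_congr fun k => ?_
  rw [← Set.inter_assoc, hκk]
  let C : Set (Fin (k + 1) → ℝ≥0) := {w | (x ≤ w (Fin.last k) ∧ ∀ j : Fin k, w j.castSucc < x) ∧
    w (Fin.last k) ∈ A}
  have hC : MeasurableSet C := by
    have h1 : MeasurableSet {w : Fin (k + 1) → ℝ≥0 | x ≤ w (Fin.last k)} :=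
      measurableSet_le measurable_const (measurable_pi_apply _)
    have h2 : MeasurableSet {w : Fin (k + 1) → ℝ≥0 | ∀ j : Fin k, w j.castSucc < x} := by
      rw [Set.ofPred_forall]
      exact MeasurableSet.iInter fun j => measurableSet_lt (measurable_pi_apply _) measurable_const
    exact (h1.inter h2).inter (measurable_pi_apply (Fin.last k) hA)
  have hCeq : {ω | x ≤ S (dyadic (n, k)) ω ∧ ∀ j : Fin k, S (dyadic (n, j)) ω < x} ∩
      (fun ω => S (dyadic (n, k)) ω) ⁻¹' A
        = (fun ω (j : Fin (k + 1)) => S (dyadic (n, j)) ω) ⁻¹' C := by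
    ext ω
    simp [C]
  rw [hCeq, (hS.indepFun_past_future n k).measure_inter_preimage_eq_mul _ _ hC hB,
    ← hS.map_future (dyadic (n, k)), Measure.map_apply (f := fun ω p => S (dyadic (n, k) + dyadic p) ω
      - S (dyadic (n, k)) ω) (measurable_pi_lambda _ fun p =>
      (hS.measurable _).sub (hS.measurable _)) hB]

/-- The strong Markov property at the first passage times. -/
lemma map_passage [IsProbabilityMeasure P] (hS : IsRegularSubordinator β c S P) (x : ℝ≥0) :
    P.map (fun ω => (S (passage S x ω) ω,
        fun p => S (passage S x ω + dyadic p) ω - S (passage S x ω) ω))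
      = (P.map fun ω => S (passage S x ω) ω).prod (P.map fun ω p => S (dyadic p) ω) := by
  have hmT {T : Ω → ℝ≥0} (hT : Measurable T) : Measurable fun ω => S (T ω) ω :=
    hS.measurable_uncurry.comp (hT.prodMk measurable_id)
  have hmF {T : Ω → ℝ≥0} (hT : Measurable T) :
      Measurable fun ω (p : ℕ × ℕ) => S (T ω + dyadic p) ω - S (T ω) ω :=
    measurable_pi_lambda _ fun p => (hmT (hT.add_const _)).sub (hmT hT)
  have hτ : Measurable fun ω => passage S x ω := hS.measurable_passage_const x
  have hτn (n : ℕ) : Measurable fun ω => dyadic (n, dyadicIdx n (passage S x ω)) :=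
    (measurable_from_top (f := fun k : ℕ => dyadic (n, k))).comp
      ((measurable_dyadicIdx n).comp hτ)
  have hSd : Measurable fun ω (p : ℕ × ℕ) => S (dyadic p) ω :=
    measurable_pi_lambda _ fun p => hS.measurable _
  have := Measure.isProbabilityMeasure_map (μ := P) (hmT hτ).aemeasurable
  have := Measure.isProbabilityMeasure_map (μ := P) hSd.aemeasurable
  have := Measure.isProbabilityMeasure_map (μ := P) ((hmT hτ).prodMk (hmF hτ)).aemeasurable
  have hlim (ω : Ω) (t : ℝ≥0) : Filter.Tendsto
      (fun n => S (dyadic (n, dyadicIdx n (passage S x ω)) + t) ω) Filter.atTop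
      (nhds (S (passage S x ω + t) ω)) :=
    hS.tendsto_of_ge ω ((tendsto_dyadic_dyadicIdx _).add_const t)
      fun n => by gcongr; exact le_dyadic_dyadicIdx n _
  have hlim0 (ω : Ω) : Filter.Tendsto
      (fun n => S (dyadic (n, dyadicIdx n (passage S x ω))) ω) Filter.atTop
      (nhds (S (passage S x ω) ω)) := by
    simpa using hlim ω 0
  -- The discretized identity is tested against bounded continuous `f`; the discrete times decrease
  -- to the passage time within `2 ^ (-n)`, and right-continuity with dominated convergence gives
  -- the limit on both sides.
  refine ext_of_forall_integral_eq_of_IsFiniteMeasure fun f => ?_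
  rw [integral_map ((hmT hτ).prodMk (hmF hτ)).aemeasurable
    f.continuous.measurable.aestronglyMeasurable]
  have hL : Filter.Tendsto (fun n => ∫ ω, f (S (dyadic (n, dyadicIdx n (passage S x ω))) ω,
      fun p => S (dyadic (n, dyadicIdx n (passage S x ω)) + dyadic p) ω
        - S (dyadic (n, dyadicIdx n (passage S x ω))) ω) ∂P) Filter.atTop
      (nhds (∫ ω, f (S (passage S x ω) ω,
        fun p => S (passage S x ω + dyadic p) ω - S (passage S x ω) ω) ∂P)) := by
    refine tendsto_integral_of_dominated_convergence (fun _ => ‖f‖)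
      (fun n => (f.continuous.measurable.comp
        ((hmT (hτn n)).prodMk (hmF (hτn n)))).aestronglyMeasurable)
      (integrable_const _) (fun n => Filter.Eventually.of_forall fun ω => f.norm_coe_le_norm _)
      (Filter.Eventually.of_forall fun ω => ?_)
    refine (f.continuous.tendsto _).comp ((hlim0 ω).prodMk_nhds (tendsto_pi_nhds.2 fun p => ?_))
    exact (hlim ω (dyadic p)).sub (hlim0 ω)
  have hR : Filter.Tendsto (fun n => ∫ z, f z ∂((P.map fun ω =>
      S (dyadic (n, dyadicIdx n (passage S x ω))) ω).prod (P.map fun ω p => S (dyadic p) ω)))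
      Filter.atTop (nhds (∫ z, f z ∂((P.map fun ω => S (passage S x ω) ω).prod
        (P.map fun ω p => S (dyadic p) ω)))) := by
    -- The product law is realised on `Ω × Ω`, so that its convergence also follows pointwise by
    -- domination.
    have hrep {T : Ω → ℝ≥0} (hT : Measurable T) :
        ∫ z, f z ∂((P.map fun ω => S (T ω) ω).prod (P.map fun ω p => S (dyadic p) ω))
          = ∫ q : Ω × Ω, f (S (T q.1) q.1, fun p => S (dyadic p) q.2) ∂(P.prod P) := by
      rw [Measure.map_prod_map _ _ (hmT hT) hSd, integral_map
        ((hmT hT).prodMap hSd).aemeasurable f.continuous.measurable.aestronglyMeasurable]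
      rfl
    rw [hrep hτ]
    simp only [hrep (hτn _)]
    refine tendsto_integral_of_dominated_convergence (fun _ => ‖f‖)
      (fun n => (f.continuous.measurable.comp (((hmT (hτn n)).comp measurable_fst).prodMk
        (hSd.comp measurable_snd))).aestronglyMeasurable)
      (integrable_const _) (fun n => Filter.Eventually.of_forall fun ω => f.norm_coe_le_norm _)
      (Filter.Eventually.of_forall fun q => ?_)
    exact (f.continuous.tendsto _).comp ((hlim0 q.1).prodMk_nhds tendsto_const_nhds)
  refine tendsto_nhds_unique hL (hR.congr fun n => ?_)
  rw [← hS.map_discrete_passage x n, integral_map ((hmT (hτn n)).prodMk (hmF (hτn n))).aemeasurable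
    f.continuous.measurable.aestronglyMeasurable]

end IsRegularSubordinator

/-! ### Lebesgue measure and power densities on `[0, ∞)` -/

lemma lintegral_lebesgueNNReal {f : ℝ≥0 → ℝ≥0∞} (hf : Measurable f) :
    ∫⁻ x, f x ∂lebesgueNNReal = ∫⁻ x in Set.Ioi (0 : ℝ), f x.toNNReal := by
  rw [lebesgueNNReal, lintegral_map hf measurable_real_toNNReal]
  exact setLIntegral_congr Ioi_ae_eq_Ici.symm

instance : SFinite lebesgueNNReal := by
  unfold lebesgueNNReal
  infer_instance

/-- Translation of Lebesgue measure on `[0, ∞)`. -/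
lemma lintegral_lebesgueNNReal_add {f : ℝ≥0 → ℝ≥0∞} (hf : Measurable f) (τ : ℝ≥0) :
    ∫⁻ t, f (τ + t) ∂lebesgueNNReal
      = ∫⁻ t, (Set.Ici τ).indicator f t ∂lebesgueNNReal := by
  rw [lintegral_lebesgueNNReal (f := fun t => f (τ + t)) (by fun_prop),
    lintegral_lebesgueNNReal (hf.indicator measurableSet_Ici)]
  have h1 : ∫⁻ x in Set.Ioi (0 : ℝ), (Set.Ici τ).indicator f x.toNNReal
      = ∫⁻ x in Set.Ioi (τ : ℝ), f x.toNNReal := by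
    rw [← setLIntegral_congr (Ioi_ae_eq_Ici (μ := volume) (a := (τ : ℝ))).symm,
      ← lintegral_indicator measurableSet_Ici, ← lintegral_indicator measurableSet_Ioi]
    refine lintegral_congr_ae ?_
    have h0 : ∀ᵐ x : ℝ, x ≠ 0 := by simp [ae_iff]
    filter_upwards [h0] with x hx0
    by_cases hx : (τ : ℝ) ≤ x
    · have hx' : (0 : ℝ) < x := lt_of_le_of_ne (τ.2.trans hx) (Ne.symm hx0)
      rw [Set.indicator_of_mem (show x ∈ Set.Ioi (0 : ℝ) from hx'),
        Set.indicator_of_mem (show x ∈ Set.Ici (τ : ℝ) from hx), Set.indicator_of_mem]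
      exact NNReal.le_toNNReal_of_coe_le hx
    · rw [Set.indicator_of_notMem (show x ∉ Set.Ici (τ : ℝ) from hx)]
      by_cases hx' : 0 < x
      · rw [Set.indicator_of_mem (show x ∈ Set.Ioi (0 : ℝ) from hx'), Set.indicator_of_notMem]
        intro h
        exact hx ((Real.le_toNNReal_iff_coe_le hx'.le).1 h)
      · rw [Set.indicator_of_notMem (show x ∉ Set.Ioi (0 : ℝ) from hx')]
  rw [h1, ← (measurePreserving_add_left volume (τ : ℝ)).setLIntegral_comp_preimage
    (s := Set.Ioi (τ : ℝ)) (f := fun x => f x.toNNReal) measurableSet_Ioi (by fun_prop)]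
  have : (fun x : ℝ => (τ : ℝ) + x) ⁻¹' Set.Ioi (τ : ℝ) = Set.Ioi 0 := by
    ext x; simp
  rw [this]
  refine setLIntegral_congr_fun measurableSet_Ioi fun x hx => ?_
  have hx : (0 : ℝ) < x := hx
  rw [Real.toNNReal_add τ.coe_nonneg hx.le, Real.toNNReal_coe]

/-- Scaling of Lebesgue measure on `[0, ∞)`. -/
lemma lintegral_lebesgueNNReal_mul {f : ℝ≥0 → ℝ≥0∞} (hf : Measurable f) {a : ℝ≥0} (ha : 0 < a) :
    ∫⁻ t, f (a * t) ∂lebesgueNNReal = (a⁻¹ : ℝ≥0) * ∫⁻ t, f t ∂lebesgueNNReal := by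
  have ha' : (0 : ℝ) < a := ha
  rw [lintegral_lebesgueNNReal (f := fun t => f (a * t)) (by fun_prop),
    lintegral_lebesgueNNReal hf]
  have h1 : ∫⁻ x in Set.Ioi (0 : ℝ), f (a * x.toNNReal)
      = ∫⁻ x, (Set.Ioi (0 : ℝ)).indicator (fun y => f y.toNNReal) ((a : ℝ) * x) := by
    rw [← lintegral_indicator measurableSet_Ioi]
    refine lintegral_congr fun x => ?_
    by_cases hx : 0 < x
    · rw [Set.indicator_of_mem (show x ∈ Set.Ioi (0 : ℝ) from hx),
        Set.indicator_of_mem (show (a : ℝ) * x ∈ Set.Ioi (0 : ℝ) from mul_pos ha' hx),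
        Real.toNNReal_mul a.coe_nonneg, Real.toNNReal_coe]
    · rw [Set.indicator_of_notMem (show x ∉ Set.Ioi (0 : ℝ) from hx), Set.indicator_of_notMem]
      simpa [ha'] using hx
  have hm : Measurable ((Set.Ioi (0 : ℝ)).indicator fun y => f y.toNNReal) :=
    (hf.comp measurable_real_toNNReal).indicator measurableSet_Ioi
  rw [h1, ← lintegral_map hm (measurable_const_mul _), Real.map_volume_mul_left ha'.ne',
    lintegral_smul_measure, lintegral_indicator measurableSet_Ioi, smul_eq_mul]
  congr 1
  rw [abs_of_pos (inv_pos.2 ha'), ← NNReal.coe_inv, ENNReal.ofReal_coe_nnreal]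

/-- The measure with density `K x ^ r` on `[0, ∞)`. -/
def powerMeasure (K r : ℝ) : Measure ℝ≥0 :=
  lebesgueNNReal.withDensity fun x => ENNReal.ofReal (K * (x : ℝ) ^ r)

instance (K r : ℝ) : SFinite (powerMeasure K r) := by
  unfold powerMeasure
  infer_instance

lemma measurable_powerDensity (K r : ℝ) :
    Measurable fun x : ℝ≥0 => ENNReal.ofReal (K * (x : ℝ) ^ r) := by fun_prop

lemma lintegral_powerMeasure (K r : ℝ) {f : ℝ≥0 → ℝ≥0∞} (hf : Measurable f) :
    ∫⁻ x, f x ∂powerMeasure K r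
      = ∫⁻ x, ENNReal.ofReal (K * (x : ℝ) ^ r) * f x ∂lebesgueNNReal := by
  rw [powerMeasure, lintegral_withDensity_eq_lintegral_mul _ (measurable_powerDensity K r) hf]
  rfl

/-- Scaling of a measure with a power density. -/
lemma map_mul_powerMeasure (K r : ℝ) {a : ℝ≥0} (ha : 0 < a) :
    (powerMeasure K r).map (fun x => a * x) = (a ^ (-(r + 1)) : ℝ≥0) • powerMeasure K r := by
  refine Measure.ext_of_lintegral _ fun f hf => ?_
  have ha' : (0 : ℝ) < a := ha
  rw [lintegral_map hf (by fun_prop), lintegral_powerMeasure K r (by fun_prop),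
    lintegral_smul_measure, lintegral_powerMeasure K r hf]
  have h1 := lintegral_lebesgueNNReal_mul
    (f := fun x => ENNReal.ofReal (K * ((a⁻¹ * x : ℝ≥0) : ℝ) ^ r) * f x) (by fun_prop) ha
  simp only [inv_mul_cancel_left₀ ha.ne'] at h1
  rw [h1, ENNReal.smul_def, smul_eq_mul, ← lintegral_const_mul _ (by fun_prop),
    ← lintegral_const_mul _ (by fun_prop)]
  refine lintegral_congr fun x => ?_
  rw [← mul_assoc, ← mul_assoc]
  congr 1
  rw [← ENNReal.ofReal_coe_nnreal, ← ENNReal.ofReal_coe_nnreal, ← ENNReal.ofReal_mul (by positivity),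
    ← ENNReal.ofReal_mul (by positivity)]
  congr 1
  simp only [NNReal.coe_mul, NNReal.coe_inv, NNReal.coe_rpow]
  rw [Real.mul_rpow (inv_nonneg.2 ha'.le) x.coe_nonneg, Real.inv_rpow ha'.le, neg_add,
    Real.rpow_add ha', Real.rpow_neg ha'.le, Real.rpow_neg ha'.le, Real.rpow_one]
  ring

/-- Gamma integral. For `K = 1 - β`, `r = -β` it gives the transform `(1 - β) Γ(1 - β) θ ^ (β - 1)`
of the delay measure. -/
lemma laplace_powerMeasure {K r : ℝ} (hK : 0 ≤ K) (hr : -1 < r) {θ : ℝ≥0} (hθ : 0 < θ) :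
    laplaceTransform (powerMeasure K r) θ
      = ENNReal.ofReal (K * ((1 / (θ : ℝ)) ^ (r + 1) * Real.Gamma (r + 1))) := by
  have hθ' : (0 : ℝ) < θ := hθ
  have hintegral := Real.integral_rpow_mul_exp_neg_mul_Ioi (a := r + 1) (r := θ) (by linarith) hθ'
  have hi : IntegrableOn (fun x : ℝ => x ^ r * Real.exp (-(θ * x))) (Set.Ioi 0) := by
    have := integrableOn_rpow_mul_exp_neg_mul_rpow (s := r) (p := 1) (b := θ) hr one_pos hθ'
    simpa using this
  simp only [add_sub_cancel_right] at hintegral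
  rw [laplaceTransform, lintegral_powerMeasure K r (measurable_laplaceKernel θ),
    lintegral_lebesgueNNReal (by fun_prop), ← hintegral, ← integral_const_mul,
    ofReal_integral_eq_lintegral_ofReal (hi.const_mul K)]
  · refine setLIntegral_congr_fun measurableSet_Ioi fun x hx => ?_
    have hx : (0 : ℝ) < x := hx
    rw [Real.coe_toNNReal _ hx.le, ← ENNReal.ofReal_mul (by positivity), mul_assoc]
  · refine (ae_restrict_mem measurableSet_Ioi).mono fun x hx => ?_
    have hx : (0 : ℝ) < x := hx
    simp only [Pi.zero_apply]
    positivity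

lemma powerMeasure_one_zero : powerMeasure 1 0 = lebesgueNNReal := by
  simp [powerMeasure]

lemma laplace_lebesgueNNReal {θ : ℝ≥0} (hθ : 0 < θ) :
    laplaceTransform lebesgueNNReal θ = ENNReal.ofReal (1 / (θ : ℝ)) := by
  rw [← powerMeasure_one_zero, laplace_powerMeasure zero_le_one (by norm_num) hθ]
  simp

/-- The indicator of `[0, 1]` is at most `e · exp (-x)`, whose integral is a finite Laplace
transform. -/
lemma powerMeasure_Iic_one_ne_top {K r : ℝ} (hK : 0 ≤ K) (hr : -1 < r) :
    powerMeasure K r (Set.Iic 1) ≠ ∞ := by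
  have h1 : powerMeasure K r (Set.Iic 1)
      ≤ ENNReal.ofReal (Real.exp 1) * laplaceTransform (powerMeasure K r) 1 := by
    rw [laplaceTransform, ← lintegral_const_mul _ (measurable_laplaceKernel 1),
      ← lintegral_indicator_one measurableSet_Iic]
    refine lintegral_mono fun x => ?_
    by_cases hx : x ≤ 1
    · rw [Set.indicator_of_mem (show x ∈ Set.Iic 1 from hx), ← ENNReal.ofReal_mul (by positivity),
        ← Real.exp_add, Pi.one_apply, ← ENNReal.ofReal_one]
      refine ENNReal.ofReal_le_ofReal (Real.one_le_exp ?_)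
      have : (x : ℝ) ≤ 1 := hx
      simp only [NNReal.coe_one, one_mul]
      linarith
    · rw [Set.indicator_of_notMem (show x ∉ Set.Iic 1 from hx)]
      exact bot_le
  refine ne_top_of_le_ne_top (ENNReal.mul_ne_top ENNReal.ofReal_ne_top ?_) h1
  rw [laplace_powerMeasure hK hr one_pos]
  exact ENNReal.ofReal_ne_top

lemma powerMeasure_Iic {K r : ℝ} {x : ℝ≥0} (hx : 0 < x) :
    powerMeasure K r (Set.Iic x) = (x ^ (r + 1) : ℝ≥0) * powerMeasure K r (Set.Iic 1) := by
  have h := congrArg (fun μ => μ (Set.Iic 1)) (map_mul_powerMeasure K r (a := x⁻¹) (by positivity))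
  rw [Measure.map_apply (by fun_prop) measurableSet_Iic, Measure.smul_apply] at h
  have h2 : (fun y : ℝ≥0 => x⁻¹ * y) ⁻¹' Set.Iic 1 = Set.Iic x := by
    ext y
    simp only [Set.mem_preimage, Set.mem_Iic]
    rw [inv_mul_le_iff₀ hx, mul_one]
  rw [h2] at h
  rw [h, ENNReal.smul_def, smul_eq_mul, NNReal.rpow_neg, NNReal.inv_rpow, inv_inv]

lemma powerMeasure_Ioi_ne_top {K r : ℝ} (hr : r < -1) {x : ℝ≥0} (hx : 0 < x) :
    powerMeasure K r (Set.Ioi x) ≠ ∞ := by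
  have hx' : (0 : ℝ) < x := hx
  rw [← lintegral_indicator_one measurableSet_Ioi,
    lintegral_powerMeasure K r (measurable_one.indicator measurableSet_Ioi),
    lintegral_lebesgueNNReal (f := fun y => ENNReal.ofReal (K * (y : ℝ) ^ r) *
      (Set.Ioi x).indicator 1 y) ((measurable_powerDensity K r).mul
      (measurable_one.indicator measurableSet_Ioi))]
  have h1 : IntegrableOn (fun y : ℝ => K * y ^ r) (Set.Ioi (x : ℝ)) :=
    (integrableOn_Ioi_rpow_of_lt hr hx').const_mul K
  refine ne_top_of_le_ne_top h1.lintegral_lt_top.ne ?_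
  rw [← lintegral_indicator measurableSet_Ioi, ← lintegral_indicator measurableSet_Ioi]
  refine lintegral_mono fun y => ?_
  by_cases hy : (x : ℝ) < y
  · have hy0 : 0 < y := hx'.trans hy
    rw [Set.indicator_of_mem (show y ∈ Set.Ioi (0 : ℝ) from hy0),
      Set.indicator_of_mem (show y ∈ Set.Ioi (x : ℝ) from hy), Set.indicator_of_mem,
      Real.coe_toNNReal _ hy0.le, Pi.one_apply, mul_one]
    exact NNReal.coe_lt_coe.1 (by rwa [Real.coe_toNNReal _ hy0.le])
  · rw [Set.indicator_of_notMem (show y ∉ Set.Ioi (x : ℝ) from hy)]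
    by_cases hy0 : 0 < y
    · rw [Set.indicator_of_mem (show y ∈ Set.Ioi (0 : ℝ) from hy0), Set.indicator_of_notMem,
        mul_zero]
      intro h
      have h : x < y.toNNReal := h
      rw [← NNReal.coe_lt_coe, Real.coe_toNNReal _ hy0.le] at h
      exact hy h
    · rw [Set.indicator_of_notMem (show y ∉ Set.Ioi (0 : ℝ) from hy0)]

/-! ### The stationary overshoot -/

/-- The potential `∫ exp (-θ w_t) dt` of a path given along the dyadic numbers. -/
def dyadicPotential (θ : ℝ≥0) (w : ℕ × ℕ → ℝ≥0) : ℝ≥0∞ :=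
  ∫⁻ t, Filter.liminf (fun n => ENNReal.ofReal
    (Real.exp (-((θ : ℝ) * (w (n, dyadicIdx n t) : ℝ))))) Filter.atTop ∂lebesgueNNReal

lemma measurable_dyadicPotential (θ : ℝ≥0) : Measurable (dyadicPotential θ) := by
  refine Measurable.lintegral_prod_right' (f := fun q : (ℕ × ℕ → ℝ≥0) × ℝ≥0 =>
    Filter.liminf (fun n => ENNReal.ofReal
      (Real.exp (-((θ : ℝ) * (q.1 (n, dyadicIdx n q.2) : ℝ))))) Filter.atTop) ?_
  refine Measurable.liminf fun n => (measurable_laplaceKernel θ).comp ?_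
  exact measurable_eval_nat (g := fun k (w : ℕ × ℕ → ℝ≥0) => w (n, k))
    (fun k => measurable_pi_apply _) ((measurable_dyadicIdx n).comp measurable_snd) measurable_fst

/-- Along a right-continuous path the `liminf` is a limit. It is used in the definition so that the
potential is a measurable function of an arbitrary sequence, as needed to apply the strong Markov
property along the dyadic numbers. -/
lemma dyadicPotential_eq (θ : ℝ≥0) {f : ℝ≥0 → ℝ≥0}
    (hf : ∀ t, Filter.Tendsto (fun n => f (dyadic (n, dyadicIdx n t))) Filter.atTop (nhds (f t))) :
    dyadicPotential θ (fun p => f (dyadic p))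
      = ∫⁻ t, ENNReal.ofReal (Real.exp (-((θ : ℝ) * (f t : ℝ)))) ∂lebesgueNNReal := by
  refine lintegral_congr fun t => Filter.Tendsto.liminf_eq ?_
  have hc : Continuous fun x : ℝ≥0 => ENNReal.ofReal (Real.exp (-((θ : ℝ) * (x : ℝ)))) := by
    exact ENNReal.continuous_ofReal.comp (by fun_prop)
  exact (hc.tendsto _).comp (hf t)

lemma lintegral_prod_prod {A B C : Type*} [MeasurableSpace A] [MeasurableSpace B]
    [MeasurableSpace C] {μ : Measure A} {ν : Measure B} {ρ : Measure C} [SFinite ν] [SFinite ρ]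
    [SFinite μ] {h : (A × B) × C → ℝ≥0∞} (hh : Measurable h) :
    ∫⁻ q, h q ∂((μ.prod ν).prod ρ) = ∫⁻ a, ∫⁻ b, ∫⁻ c, h ((a, b), c) ∂ρ ∂ν ∂μ := by
  rw [lintegral_prod _ hh.aemeasurable,
    lintegral_prod _ (Measurable.lintegral_prod_right' hh).aemeasurable]

/-- The overshoot over the level `b` of the process `v + S`. -/
def overshoot {Ω : Type*} (S : ℝ≥0 → Ω → ℝ≥0) (b : ℝ≥0) (q : ℝ≥0 × Ω) : ℝ≥0 :=
  q.1 + S (passage S (b - q.1) q.2) q.2 - b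

namespace IsRegularSubordinator

variable {Ω : Type*} [MeasurableSpace Ω] {P : Measure Ω} {β c : ℝ} {S : ℝ≥0 → Ω → ℝ≥0}

/-- Shows that the last subtraction in `overshoot` is never truncated. If `b < v`, then the level `b
- v` is `0`, the passage time is `0` and the overshoot is `v - b`. -/
lemma le_add_passage (hS : IsRegularSubordinator β c S P) (b v : ℝ≥0) (ω : Ω) :
    b ≤ v + S (passage S (b - v) ω) ω := tsub_le_iff_left.1 (hS.le_at_passage _ _)

lemma measurable_overshoot (hS : IsRegularSubordinator β c S P) (b : ℝ≥0) :
    Measurable (overshoot S b) := by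
  have h1 : Measurable fun q : ℝ≥0 × Ω => passage S (b - q.1) q.2 :=
    hS.measurable_passage.comp ((measurable_fst.const_sub b).prodMk measurable_snd)
  have h2 : Measurable fun q : ℝ≥0 × Ω => S (passage S (b - q.1) q.2) q.2 :=
    hS.measurable_uncurry.comp (h1.prodMk measurable_snd)
  exact (measurable_fst.add h2).sub_const b

lemma measurable_dyadic_path (hS : IsRegularSubordinator β c S P) :
    Measurable fun ω (p : ℕ × ℕ) => S (dyadic p) ω :=
  measurable_pi_lambda _ fun _ => hS.measurable _

/-- Integrated form of `map_passage`: the path after passage may be replaced by that of an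
independent `ω'`. -/
lemma lintegral_passage [IsProbabilityMeasure P] (hS : IsRegularSubordinator β c S P) (x : ℝ≥0)
    {f : ℝ≥0 × (ℕ × ℕ → ℝ≥0) → ℝ≥0∞} (hf : Measurable f) :
    ∫⁻ ω, f (S (passage S x ω) ω,
        fun p => S (passage S x ω + dyadic p) ω - S (passage S x ω) ω) ∂P
      = ∫⁻ ω, ∫⁻ ω', f (S (passage S x ω) ω, fun p => S (dyadic p) ω') ∂P ∂P := by
  have hmT {T : Ω → ℝ≥0} (hT : Measurable T) : Measurable fun ω => S (T ω) ω :=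
    hS.measurable_uncurry.comp (hT.prodMk measurable_id)
  have hτ := hS.measurable_passage_const x
  have hF : Measurable fun ω (p : ℕ × ℕ) => S (passage S x ω + dyadic p) ω - S (passage S x ω) ω :=
    measurable_pi_lambda _ fun p => (hmT (hτ.add_const _)).sub (hmT hτ)
  have h1 := lintegral_map (μ := P) hf ((hmT hτ).prodMk hF)
  rw [← h1, hS.map_passage x, lintegral_prod _ hf.aemeasurable,
    lintegral_map hf.lintegral_prod_right' (hmT hτ)]
  refine lintegral_congr fun ω => ?_
  exact lintegral_map (hf.comp measurable_prodMk_left) hS.measurable_dyadic_path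

lemma lintegral_laplaceKernel (hS : IsRegularSubordinator β c S P) (t θ : ℝ≥0) :
    ∫⁻ ω, ENNReal.ofReal (Real.exp (-((θ : ℝ) * (S t ω : ℝ)))) ∂P
      = ENNReal.ofReal (Real.exp (-(c * (t : ℝ) * (θ : ℝ) ^ β))) := by
  rw [← laplace_map_eq (hS.measurable t), hS.laplace_map]

lemma measurable_laplaceKernel_uncurry (hS : IsRegularSubordinator β c S P) (θ : ℝ≥0) :
    Measurable fun q : ℝ≥0 × Ω => ENNReal.ofReal (Real.exp (-((θ : ℝ) * (S q.1 q.2 : ℝ)))) :=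
  (measurable_laplaceKernel θ).comp hS.measurable_uncurry

/-- The Laplace transform of the potential measure. -/
lemma lintegral_lintegral_laplaceKernel [IsProbabilityMeasure P]
    (hS : IsRegularSubordinator β c S P) (hc : 0 < c) {θ : ℝ≥0} (hθ : 0 < θ) :
    ∫⁻ ω, ∫⁻ t, ENNReal.ofReal (Real.exp (-((θ : ℝ) * (S t ω : ℝ)))) ∂lebesgueNNReal ∂P
      = ENNReal.ofReal (1 / (c * (θ : ℝ) ^ β)) := by
  have hθ' : (0 : ℝ) < θ := hθ
  rw [lintegral_lintegral_swap (f := fun ω t => ENNReal.ofReal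
    (Real.exp (-((θ : ℝ) * (S t ω : ℝ))))) ((hS.measurable_laplaceKernel_uncurry θ).comp
    measurable_swap).aemeasurable]
  simp only [hS.lintegral_laplaceKernel]
  have hpos : 0 < c * (θ : ℝ) ^ β := by positivity
  have := laplace_lebesgueNNReal (θ := (c * (θ : ℝ) ^ β).toNNReal) (by simpa using hpos)
  rw [Real.coe_toNNReal _ hpos.le] at this
  rw [← this, laplaceTransform]
  refine lintegral_congr fun t => ?_
  rw [Real.coe_toNNReal _ hpos.le]
  congr 3
  ring

/-- Convolving the delay measure with the potential measure yields a multiple of Lebesgue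
measure. -/
lemma map_delay_add [IsProbabilityMeasure P] (hS : IsRegularSubordinator β c S P) (hc : 0 < c)
    (hβ1 : β < 1) :
    (((powerMeasure (1 - β) (-β)).prod P).prod lebesgueNNReal).map
        (fun q : (ℝ≥0 × Ω) × ℝ≥0 => q.1.1 + S q.2 q.1.2)
      = ENNReal.ofReal ((1 - β) * Real.Gamma (1 - β) / c) • lebesgueNNReal := by
  have hm : Measurable fun q : (ℝ≥0 × Ω) × ℝ≥0 => q.1.1 + S q.2 q.1.2 :=
    (measurable_fst.comp measurable_fst).add (hS.measurable_uncurry.comp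
      (measurable_snd.prodMk (measurable_snd.comp measurable_fst)))
  -- The transform of the convolution is the product `(1 - β) Γ(1 - β) θ ^ (β - 1) · 1 / (c θ ^ β)`,
  -- a constant times `1 / θ`.
  have hlap {θ : ℝ≥0} (hθ : 0 < θ) : laplaceTransform
      ((((powerMeasure (1 - β) (-β)).prod P).prod lebesgueNNReal).map
        (fun q : (ℝ≥0 × Ω) × ℝ≥0 => q.1.1 + S q.2 q.1.2)) θ
      = laplaceTransform (ENNReal.ofReal ((1 - β) * Real.Gamma (1 - β) / c) • lebesgueNNReal) θ := by
    have hθ' : (0 : ℝ) < θ := hθ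
    have hexp (v s : ℝ≥0) : ENNReal.ofReal (Real.exp (-((θ : ℝ) * ((v + s : ℝ≥0) : ℝ))))
        = ENNReal.ofReal (Real.exp (-((θ : ℝ) * (v : ℝ)))) *
          ENNReal.ofReal (Real.exp (-((θ : ℝ) * (s : ℝ)))) := by
      rw [← ENNReal.ofReal_mul (Real.exp_pos _).le, ← Real.exp_add]
      congr 2
      push_cast
      ring
    have hk : Measurable fun q : (ℝ≥0 × Ω) × ℝ≥0 =>
        ENNReal.ofReal (Real.exp (-((θ : ℝ) * ((q.1.1 + S q.2 q.1.2 : ℝ≥0) : ℝ)))) :=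
      (measurable_laplaceKernel θ).comp hm
    rw [laplaceTransform, lintegral_map (measurable_laplaceKernel θ) hm, lintegral_prod_prod hk]
    simp only [hexp]
    have hin (v : ℝ≥0) : ∫⁻ ω, ∫⁻ t, ENNReal.ofReal (Real.exp (-((θ : ℝ) * (v : ℝ)))) *
          ENNReal.ofReal (Real.exp (-((θ : ℝ) * (S t ω : ℝ)))) ∂lebesgueNNReal ∂P
        = ENNReal.ofReal (Real.exp (-((θ : ℝ) * (v : ℝ)))) *
          ENNReal.ofReal (1 / (c * (θ : ℝ) ^ β)) := by
      rw [← hS.lintegral_lintegral_laplaceKernel hc hθ, ← lintegral_const_mul]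
      · refine lintegral_congr fun ω => lintegral_const_mul _ ?_
        exact (hS.measurable_laplaceKernel_uncurry θ).comp measurable_prodMk_right
      · exact Measurable.lintegral_prod_right'
          ((hS.measurable_laplaceKernel_uncurry θ).comp measurable_swap)
    simp only [hin]
    rw [lintegral_mul_const _ (measurable_laplaceKernel θ), ← laplaceTransform,
      laplace_powerMeasure (by linarith) (by linarith) hθ, laplaceTransform,
      lintegral_smul_measure, ← laplaceTransform, laplace_lebesgueNNReal hθ, smul_eq_mul,
      ← ENNReal.ofReal_mul (mul_nonneg (by linarith) (mul_nonneg (by positivity)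
        (Real.Gamma_pos_of_pos (by linarith)).le)),
      ← ENNReal.ofReal_mul (div_nonneg (mul_nonneg (by linarith)
        (Real.Gamma_pos_of_pos (by linarith)).le) hc.le)]
    congr 1
    rw [show -β + 1 = 1 - β by ring, one_div (θ : ℝ), Real.inv_rpow hθ'.le, Real.rpow_sub hθ',
      Real.rpow_one]
    have : (θ : ℝ) ^ β ≠ 0 := (Real.rpow_pos_of_pos hθ' _).ne'
    field_simp
  refine ext_of_laplace (fun θ hθ => ?_) (fun θ hθ => hlap hθ)
  rw [hlap hθ, laplaceTransform, lintegral_smul_measure, ← laplaceTransform,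
    laplace_lebesgueNNReal hθ, smul_eq_mul]
  exact ENNReal.mul_ne_top ENNReal.ofReal_ne_top ENNReal.ofReal_ne_top

/-- The delay measure is invariant for the overshoot. -/
lemma map_overshoot [IsProbabilityMeasure P] (hS : IsRegularSubordinator β c S P) (hc : 0 < c)
    (hβ1 : β < 1) (b : ℝ≥0) :
    ((powerMeasure (1 - β) (-β)).prod P).map (overshoot S b) = powerMeasure (1 - β) (-β) := by
  have hm : Measurable fun q : (ℝ≥0 × Ω) × ℝ≥0 => q.1.1 + S q.2 q.1.2 :=
    (measurable_fst.comp measurable_fst).add (hS.measurable_uncurry.comp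
      (measurable_snd.prodMk (measurable_snd.comp measurable_fst)))
  -- The integral of `exp (-θ (y - b)) 1{y ≥ b}` against the law of `v + S_t` is computed twice:
  -- once from the multiple of Lebesgue measure, once by splitting each path at its passage over
  -- `b`.
  have key {θ : ℝ≥0} (hθ : 0 < θ) :
      laplaceTransform (((powerMeasure (1 - β) (-β)).prod P).map (overshoot S b)) θ
        * ENNReal.ofReal (1 / (c * (θ : ℝ) ^ β))
      = ENNReal.ofReal ((1 - β) * Real.Gamma (1 - β) / c) * ENNReal.ofReal (1 / (θ : ℝ)) := by
    let g : ℝ≥0 → ℝ≥0∞ := fun y => ENNReal.ofReal (Real.exp (-((θ : ℝ) * ((y - b : ℝ≥0) : ℝ))))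
    have hg : Measurable g := (measurable_laplaceKernel θ).comp (measurable_id.sub_const b)
    have hgi : Measurable ((Set.Ici b).indicator g) := hg.indicator measurableSet_Ici
    have hR : ∫⁻ y, (Set.Ici b).indicator g y ∂((((powerMeasure (1 - β) (-β)).prod P).prod
        lebesgueNNReal).map (fun q : (ℝ≥0 × Ω) × ℝ≥0 => q.1.1 + S q.2 q.1.2))
        = ENNReal.ofReal ((1 - β) * Real.Gamma (1 - β) / c) * ENNReal.ofReal (1 / (θ : ℝ)) := by
      rw [hS.map_delay_add hc hβ1, lintegral_smul_measure, ← lintegral_lebesgueNNReal_add hg b,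
        ← laplace_lebesgueNNReal hθ, laplaceTransform, smul_eq_mul]
      simp only [g, add_tsub_cancel_left]
    have hk : Measurable fun q : (ℝ≥0 × Ω) × ℝ≥0 =>
        (Set.Ici b).indicator g (q.1.1 + S q.2 q.1.2) := hgi.comp hm
    have hk' : Measurable fun q : ℝ≥0 × Ω =>
        ENNReal.ofReal (Real.exp (-((θ : ℝ) * (overshoot S b q : ℝ)))) :=
      (measurable_laplaceKernel θ).comp (hS.measurable_overshoot b)
    rw [← hR, lintegral_map hgi hm, lintegral_prod_prod hk,
      laplace_map_eq (hS.measurable_overshoot b), lintegral_prod _ hk'.aemeasurable,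
      ← lintegral_mul_const _ (Measurable.lintegral_prod_right' hk')]
    refine lintegral_congr fun v => ?_
    let f : ℝ≥0 × (ℕ × ℕ → ℝ≥0) → ℝ≥0∞ := fun z =>
      ENNReal.ofReal (Real.exp (-((θ : ℝ) * ((v + z.1 - b : ℝ≥0) : ℝ)))) * dyadicPotential θ z.2
    have hf : Measurable f :=
      ((measurable_laplaceKernel θ).comp ((measurable_fst.const_add v).sub_const b)).mul
        ((measurable_dyadicPotential θ).comp measurable_snd)
    have hsm := hS.lintegral_passage (b - v) hf
    have hpot : ∫⁻ ω, dyadicPotential θ (fun p => S (dyadic p) ω) ∂P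
        = ENNReal.ofReal (1 / (c * (θ : ℝ) ^ β)) := by
      rw [← hS.lintegral_lintegral_laplaceKernel hc hθ]
      exact lintegral_congr fun ω => dyadicPotential_eq θ (f := fun t => S t ω)
        (hS.tendsto_dyadicIdx ω)
    have h1 : ∫⁻ ω, ∫⁻ ω', f (S (passage S (b - v) ω) ω, fun p => S (dyadic p) ω') ∂P ∂P
        = (∫⁻ ω, ENNReal.ofReal (Real.exp (-((θ : ℝ) * (overshoot S b (v, ω) : ℝ)))) ∂P)
          * ENNReal.ofReal (1 / (c * (θ : ℝ) ^ β)) := by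
      have hkv : Measurable fun ω =>
          ENNReal.ofReal (Real.exp (-((θ : ℝ) * (overshoot S b (v, ω) : ℝ)))) :=
        hk'.comp measurable_prodMk_left
      rw [← lintegral_mul_const _ hkv, ← hpot]
      have hkd : Measurable fun ω => dyadicPotential θ (fun p => S (dyadic p) ω) :=
        (measurable_dyadicPotential θ).comp hS.measurable_dyadic_path
      refine lintegral_congr fun ω => ?_
      rw [← lintegral_const_mul _ hkd]
      rfl
    rw [← h1, ← hsm]
    refine lintegral_congr fun ω => ?_
    set τ := passage S (b - v) ω with hτ
    have hb : b ≤ v + S τ ω := hS.le_add_passage b v ω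
    have hpath : dyadicPotential θ (fun p => S (τ + dyadic p) ω - S τ ω)
        = ∫⁻ t, ENNReal.ofReal (Real.exp (-((θ : ℝ) * ((S (τ + t) ω - S τ ω : ℝ≥0) : ℝ))))
          ∂lebesgueNNReal :=
      dyadicPotential_eq θ (f := fun t => S (τ + t) ω - S τ ω) fun t =>
        (hS.tendsto_of_ge ω ((tendsto_dyadic_dyadicIdx t).const_add τ)
          fun n => by gcongr; exact le_dyadic_dyadicIdx n t).sub_const _
    simp only [f]
    have hmω : Measurable fun t => S t ω := hS.measurable_uncurry.comp measurable_prodMk_right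
    rw [hpath, ← lintegral_const_mul]
    · have h2 := lintegral_lebesgueNNReal_add (f := fun t => g (v + S t ω))
        (hg.comp (hmω.const_add v)) τ
      -- The path is at or above `b` exactly from the passage time on, so a cut-off in space is a
      -- cut-off in time.
      have h3 : ∀ t, (Set.Ici τ).indicator (fun t => g (v + S t ω)) t
          = (Set.Ici b).indicator g (v + S t ω) := by
        intro t
        have hiff : t ∈ Set.Ici τ ↔ v + S t ω ∈ Set.Ici b := by
          rw [Set.mem_Ici, Set.mem_Ici, hτ, hS.passage_le_iff, tsub_le_iff_left]
        by_cases ht : t ∈ Set.Ici τ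
        · rw [Set.indicator_of_mem ht, Set.indicator_of_mem (hiff.1 ht)]
        · rw [Set.indicator_of_notMem ht, Set.indicator_of_notMem (fun h => ht (hiff.2 h))]
      simp only [h3] at h2
      refine Eq.trans ?_ h2
      refine lintegral_congr fun t => ?_
      have hle : S τ ω ≤ S (τ + t) ω := hS.mono ω le_self_add
      simp only [g]
      rw [← ENNReal.ofReal_mul (Real.exp_pos _).le, ← Real.exp_add]
      congr 2
      rw [NNReal.coe_sub hb, NNReal.coe_sub hle,
        NNReal.coe_sub (hb.trans (add_le_add le_rfl hle))]
      push_cast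
      ring
    · exact (measurable_laplaceKernel θ).comp ((hmω.comp (measurable_const_add τ)).sub_const _)
  have hlap {θ : ℝ≥0} (hθ : 0 < θ) :
      laplaceTransform (((powerMeasure (1 - β) (-β)).prod P).map (overshoot S b)) θ
      = laplaceTransform (powerMeasure (1 - β) (-β)) θ := by
    have hθ' : (0 : ℝ) < θ := hθ
    have hpos : 0 < 1 / (c * (θ : ℝ) ^ β) := by positivity
    -- The transform of the potential measure is positive and finite, so it can be cancelled.
    refine (ENNReal.mul_left_inj (c := ENNReal.ofReal (1 / (c * (θ : ℝ) ^ β)))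
      (by simpa using hpos) ENNReal.ofReal_ne_top).1 ?_
    rw [key hθ, laplace_powerMeasure (by linarith) (by linarith) hθ,
      ← ENNReal.ofReal_mul (mul_nonneg (by linarith) (mul_nonneg (by positivity)
        (Real.Gamma_pos_of_pos (by linarith)).le)),
      ← ENNReal.ofReal_mul (div_nonneg (mul_nonneg (by linarith)
        (Real.Gamma_pos_of_pos (by linarith)).le) hc.le)]
    congr 1
    rw [show -β + 1 = 1 - β by ring, one_div (θ : ℝ), Real.inv_rpow hθ'.le, Real.rpow_sub hθ',
      Real.rpow_one]
    have : (θ : ℝ) ^ β ≠ 0 := (Real.rpow_pos_of_pos hθ' _).ne'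
    field_simp
  refine ext_of_laplace (fun θ hθ => ?_) (fun θ hθ => hlap hθ)
  rw [hlap hθ, laplace_powerMeasure (by linarith) (by linarith) hθ]
  exact ENNReal.ofReal_ne_top

end IsRegularSubordinator

/-! ### The stationary law of shifted stable regenerative sets -/

/-- Every value is a limit of values at dyadic times; the closed range thus depends on countably
many coordinates only. -/
lemma closure_range_dyadic {f : ℝ≥0 → ℝ≥0}
    (hf : ∀ t, Filter.Tendsto (fun n => f (dyadic (n, dyadicIdx n t))) Filter.atTop (nhds (f t))) :
    closure (Set.range fun p => f (dyadic p)) = closure (Set.range f) := by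
  refine Set.Subset.antisymm (closure_mono ?_) (closure_minimal ?_ isClosed_closure)
  · rintro _ ⟨p, rfl⟩
    exact ⟨_, rfl⟩
  · rintro _ ⟨t, rfl⟩
    exact mem_closure_of_tendsto (hf t) (Filter.Eventually.of_forall fun n => ⟨_, rfl⟩)

lemma tendsto_powerMeasure_Iic {K r : ℝ} (hK : 0 ≤ K) (hr : -1 < r) {x : ℕ → ℝ≥0}
    (hx : ∀ n, 0 < x n) (hlim : Filter.Tendsto x Filter.atTop (nhds 0)) :
    Filter.Tendsto (fun n => powerMeasure K r (Set.Iic (x n))) Filter.atTop (nhds 0) := by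
  have h1 : Filter.Tendsto (fun n => ((x n ^ (r + 1) : ℝ≥0) : ℝ≥0∞)) Filter.atTop (nhds 0) := by
    have := ((NNReal.continuous_rpow_const (y := r + 1) (by linarith)).tendsto 0).comp hlim
    rw [NNReal.zero_rpow (by linarith)] at this
    exact ENNReal.tendsto_coe.2 this
  have h2 := ENNReal.Tendsto.mul_const h1 (b := powerMeasure K r (Set.Iic 1))
    (Or.inr (powerMeasure_Iic_one_ne_top hK hr))
  rw [zero_mul] at h2
  exact h2.congr fun n => (powerMeasure_Iic (hx n)).symm

lemma tendsto_nnreal_const_div (a : ℝ≥0) :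
    Filter.Tendsto (fun n : ℕ => a / ((n : ℝ≥0) + 1)) Filter.atTop (nhds 0) := by
  have h : Filter.Tendsto (fun n : ℕ => (a : ℝ) * (1 / ((n : ℝ) + 1))) Filter.atTop
      (nhds ((a : ℝ) * 0)) := tendsto_one_div_add_atTop_nhds_zero_nat.const_mul _
  rw [mul_zero] at h
  rw [← NNReal.tendsto_coe]
  refine h.congr fun n => ?_
  push_cast
  ring

namespace ClosedSets

lemma mem_shift_iff {v x : ℝ≥0} {F : ClosedSets} :
    x ∈ F.shift v ↔ ∃ r ∈ F.carrier, v + r = x := Iff.rfl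

lemma shift_ofClosure (v : ℝ≥0) (A : Set ℝ≥0) :
    (ofClosure A).shift v = closure ((fun r => v + r) '' A) := by
  have hc : Topology.IsClosedEmbedding (fun r : ℝ≥0 => v + r) :=
    (isometry_iff_dist_eq.2 fun x y => by simp [NNReal.dist_eq]).isClosedEmbedding
  exact (hc.closure_image_eq A).symm

lemma contract_translate {a : ℝ≥0} (ha : 0 < a) (v : ℝ≥0) (F : ClosedSets) :
    (F.translate v).contract a = (F.contract a).translate (a⁻¹ * v) := by
  apply carrier_injective
  ext r
  simp only [mem_contract, carrier_translate, mem_shift_iff]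
  constructor
  · rintro ⟨s, hs, h⟩
    refine ⟨a⁻¹ * s, by rwa [mul_inv_cancel_left₀ ha.ne'], ?_⟩
    rw [← mul_add, h, inv_mul_cancel_left₀ ha.ne']
  · rintro ⟨s, hs, rfl⟩
    exact ⟨a * s, hs, by rw [mul_add, mul_inv_cancel_left₀ ha.ne']⟩

lemma contract_ofClosure {a : ℝ≥0} (ha : 0 < a) (A : Set ℝ≥0) :
    (ofClosure A).contract a = ofClosure ((fun r => a⁻¹ * r) '' A) := by
  apply carrier_injective
  let e : ℝ≥0 ≃ₜ ℝ≥0 := Homeomorph.mulLeft₀ a ha.ne'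
  have h1 : ((ofClosure A).contract a).carrier = e ⁻¹' closure A := rfl
  have h2 : (fun r => a⁻¹ * r) '' A = e ⁻¹' A := by
    ext r
    constructor
    · rintro ⟨s, hs, rfl⟩
      simpa [e, mul_inv_cancel_left₀ ha.ne'] using hs
    · intro h
      exact ⟨a * r, h, inv_mul_cancel_left₀ ha.ne' r⟩
  rw [h1, e.preimage_closure, carrier_ofClosure, h2]

lemma hit_restart_iff {x : ℝ≥0} {A : Set ℝ≥0} {F : ClosedSets} :
    ((F.restart x).carrier ∩ A).Nonempty ↔ (F.carrier ∩ (fun r => r + x) '' A).Nonempty := by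
  constructor
  · rintro ⟨r, hr, hrA⟩
    exact ⟨r + x, hr, r, hrA, rfl⟩
  · rintro ⟨_, hr, r, hrA, rfl⟩
    exact ⟨r, hr, hrA⟩

end ClosedSets

/-- The law of `v + R`, where `v` has density `(1 - β) v ^ (-β)` and `R` has law `Q`. -/
def shiftedLaw (β : ℝ) (Q : Measure ClosedSets) : Measure ClosedSets :=
  ((powerMeasure (1 - β) (-β)).prod Q).map fun p => p.2.translate p.1

instance (β : ℝ) (Q : Measure ClosedSets) [SFinite Q] : SFinite (shiftedLaw β Q) := by
  unfold shiftedLaw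
  infer_instance

/-- A translated closed set hits `[0, x]` only if the translation is at most `x`. -/
lemma shiftedLaw_hit_Iic_le (β : ℝ) (Q : Measure ClosedSets) [IsProbabilityMeasure Q]
    (x : ℝ≥0) : shiftedLaw β Q {F | (F.carrier ∩ Set.Iic x).Nonempty}
      ≤ powerMeasure (1 - β) (-β) (Set.Iic x) := by
  have hK : IsCompact (Set.Iic x) := by
    rw [← Set.Icc_bot]; exact isCompact_Icc
  rw [shiftedLaw, Measure.map_apply ClosedSets.measurable_translate
    (ClosedSets.measurableSet_hit_isCompact hK)]
  calc _ ≤ ((powerMeasure (1 - β) (-β)).prod Q) (Set.Iic x ×ˢ Set.univ) := by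
        refine measure_mono ?_
        rintro ⟨v, F⟩ ⟨_, ⟨r, hr, rfl⟩, hx⟩
        exact ⟨Set.mem_Iic.2 (le_self_add.trans (Set.mem_Iic.1 hx)), trivial⟩
    _ = _ := by rw [Measure.prod_prod, measure_univ, mul_one]

namespace IsRegularSubordinator

variable {Ω : Type*} [MeasurableSpace Ω] {P : Measure Ω} {β c : ℝ} {S : ℝ≥0 → Ω → ℝ≥0}

lemma closedRange_eq (hS : IsRegularSubordinator β c S P) (ω : Ω) :
    closedRange S ω = ClosedSets.ofClosure (Set.range fun p => S (dyadic p) ω) := by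
  apply ClosedSets.carrier_injective
  simp only [closedRange, ClosedSets.carrier_ofClosure]
  exact (closure_range_dyadic (f := fun t => S t ω) (hS.tendsto_dyadicIdx ω)).symm

lemma measurable_closedRange (hS : IsRegularSubordinator β c S P) :
    Measurable (closedRange S) := by
  have : closedRange S = (fun w => ClosedSets.ofClosure (Set.range w)) ∘
      fun ω p => S (dyadic p) ω := funext hS.closedRange_eq
  rw [this]
  exact ClosedSets.measurable_ofClosure_range.comp hS.measurable_dyadic_path

lemma isProbabilityMeasure_map_closedRange [IsProbabilityMeasure P]
    (hS : IsRegularSubordinator β c S P) : IsProbabilityMeasure (P.map (closedRange S)) :=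
  Measure.isProbabilityMeasure_map hS.measurable_closedRange.aemeasurable

/-- A stable regenerative set is self-similar. -/
lemma map_contract_closedRange [IsProbabilityMeasure P] (hS : IsRegularSubordinator β c S P)
    {a : ℝ≥0} (ha : 0 < a) :
    (P.map (closedRange S)).map (ClosedSets.contract a) = P.map (closedRange S) := by
  have hY : Measurable fun ω (p : ℕ × ℕ) => a⁻¹ * S (a ^ β * dyadic p) ω :=
    measurable_pi_lambda _ fun p => (hS.measurable _).const_mul _
  have h1 : closedRange S = (fun w => ClosedSets.ofClosure (Set.range w)) ∘
      fun ω p => S (dyadic p) ω := funext hS.closedRange_eq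
  have h2 : ClosedSets.contract a ∘ closedRange S
      = (fun w => ClosedSets.ofClosure (Set.range w)) ∘
        fun ω (p : ℕ × ℕ) => a⁻¹ * S (a ^ β * dyadic p) ω := by
    funext ω
    have hpos : 0 < a ^ β := NNReal.rpow_pos ha
    simp only [Function.comp_apply, closedRange]
    rw [ClosedSets.contract_ofClosure ha]
    apply ClosedSets.carrier_injective
    simp only [ClosedSets.carrier_ofClosure]
    rw [closure_range_dyadic (f := fun t => a⁻¹ * S (a ^ β * t) ω) fun t =>
      (hS.tendsto_of_ge ω ((tendsto_dyadic_dyadicIdx t).const_mul (a ^ β))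
        fun n => by gcongr; exact le_dyadic_dyadicIdx n t).const_mul _]
    -- The deterministic time change `t ↦ a ^ β t` is a bijection of `[0, ∞)` and does not affect
    -- the range.
    congr 1
    ext r
    constructor
    · rintro ⟨_, ⟨t, rfl⟩, rfl⟩
      exact ⟨(a ^ β)⁻¹ * t, by simp only [mul_inv_cancel_left₀ hpos.ne']⟩
    · rintro ⟨t, rfl⟩
      exact ⟨_, ⟨a ^ β * t, rfl⟩, rfl⟩
  rw [Measure.map_map (ClosedSets.measurable_contract a) hS.measurable_closedRange, h2,
    ← Measure.map_map ClosedSets.measurable_ofClosure_range hY, hS.map_scaling ha,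
    Measure.map_map ClosedSets.measurable_ofClosure_range hS.measurable_dyadic_path, ← h1]

/-- Since `a⁻¹ (v + R) = a⁻¹ v + a⁻¹ R` and `a⁻¹ R` has the law of `R`, the factor comes from the
delay measure alone. -/
lemma map_contract_shiftedLaw [IsProbabilityMeasure P] (hS : IsRegularSubordinator β c S P)
    {a : ℝ≥0} (ha : 0 < a) :
    (shiftedLaw β (P.map (closedRange S))).map (ClosedSets.contract a)
      = (a ^ (1 - β) : ℝ≥0) • shiftedLaw β (P.map (closedRange S)) := by
  have := hS.isProbabilityMeasure_map_closedRange
  have h1 : ClosedSets.contract a ∘ (fun p : ℝ≥0 × ClosedSets => p.2.translate p.1)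
      = (fun p : ℝ≥0 × ClosedSets => p.2.translate p.1) ∘
        Prod.map (fun v => a⁻¹ * v) (ClosedSets.contract a) := by
    funext p
    exact ClosedSets.contract_translate ha p.1 p.2
  rw [shiftedLaw, Measure.map_map (ClosedSets.measurable_contract a)
    ClosedSets.measurable_translate, h1, ← Measure.map_map ClosedSets.measurable_translate
    ((measurable_const_mul _).prodMap (ClosedSets.measurable_contract a)),
    ← Measure.map_prod_map _ _ (measurable_const_mul _) (ClosedSets.measurable_contract a),
    hS.map_contract_closedRange ha, map_mul_powerMeasure _ _ (inv_pos.2 ha),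
    Measure.prod_smul_left, Measure.map_smul]
  congr 1
  rw [show -(-β + 1) = -(1 - β) by ring, NNReal.inv_rpow, NNReal.rpow_neg, inv_inv]

/-- A fixed point is almost never covered by a shifted stable regenerative set. -/
lemma ae_notMem_shift [IsProbabilityMeasure P] (hS : IsRegularSubordinator β c S P) (hc : 0 < c)
    (hβ1 : β < 1) (b : ℝ≥0) :
    ∀ᵐ q ∂(powerMeasure (1 - β) (-β)).prod P, b ∉ (closedRange S q.2).shift q.1 := by
  rw [ae_iff]
  have hb (n : ℕ) : ((powerMeasure (1 - β) (-β)).prod P)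
      {q | ¬ b ∉ (closedRange S q.2).shift q.1}
      ≤ powerMeasure (1 - β) (-β) (Set.Iic (2 / ((n : ℝ≥0) + 1))) := by
    -- If `b` is covered, the shifted path has a value within `ε` of `b`, so its overshoot over `b -
    -- ε` is at most `2 ε`. By invariance the measure of this is that of `[0, 2 ε]` under the delay
    -- measure.
    set ε : ℝ≥0 := 1 / ((n : ℝ≥0) + 1) with hε
    have hε0 : 0 < ε := by positivity
    conv_rhs => rw [← hS.map_overshoot hc hβ1 (b - ε)]
    rw [Measure.map_apply (hS.measurable_overshoot _) measurableSet_Iic]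
    refine measure_mono (μ := (powerMeasure (1 - β) (-β)).prod P) ?_
    rintro ⟨v, ω⟩ hq
    simp only [Set.mem_ofPred_eq, not_not, closedRange] at hq
    rw [ClosedSets.shift_ofClosure] at hq
    obtain ⟨_, ⟨_, ⟨t, rfl⟩, rfl⟩, ht⟩ := Metric.mem_closure_iff.1 hq ε hε0
    rw [NNReal.dist_eq, abs_lt] at ht
    push_cast at ht
    have h1 : b - ε ≤ v + S t ω := by
      rw [tsub_le_iff_right, ← NNReal.coe_le_coe]
      push_cast
      linarith [ht.2]
    have h2 : passage S (b - ε - v) ω ≤ t := by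
      rw [hS.passage_le_iff, tsub_le_iff_left]
      exact h1
    have h3 : S (passage S (b - ε - v) ω) ω ≤ S t ω := hS.mono ω h2
    simp only [Set.mem_preimage, overshoot, Set.mem_Iic]
    rw [tsub_le_iff_left]
    have h4 : b ≤ b - ε + ε := le_tsub_add
    rw [← NNReal.coe_le_coe] at h3 h4 ⊢
    have h5 : (2 / ((n : ℝ≥0) + 1) : ℝ≥0) = ε + ε := by rw [hε]; ring
    rw [h5]
    push_cast at h3 h4 ⊢
    linarith [ht.1]
  exact le_antisymm (ge_of_tendsto' (tendsto_powerMeasure_Iic (by linarith) (by linarith)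
    (fun n => by positivity) (tendsto_nnreal_const_div 2)) hb) zero_le

/-- The part of a shifted path after its first passage over `b`. -/
lemma restart_translate_closedRange (hS : IsRegularSubordinator β c S P) {b v : ℝ≥0} {ω : Ω}
    (h : b ∉ (closedRange S ω).shift v) :
    ((closedRange S ω).translate v).restart b
      = (ClosedSets.ofClosure (Set.range fun p => S (passage S (b - v) ω + dyadic p) ω
          - S (passage S (b - v) ω) ω)).translate (overshoot S b (v, ω)) := by
  set τ := passage S (b - v) ω with hτ
  have hbτ : b ≤ v + S τ ω := hS.le_add_passage b v ω
  have hright : ClosedSets.ofClosure (Set.range fun p => S (τ + dyadic p) ω - S τ ω)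
      = ClosedSets.ofClosure (Set.range fun t => S (τ + t) ω - S τ ω) := by
    apply ClosedSets.carrier_injective
    simp only [ClosedSets.carrier_ofClosure]
    exact closure_range_dyadic (f := fun t => S (τ + t) ω - S τ ω) fun t =>
        (hS.tendsto_of_ge ω ((tendsto_dyadic_dyadicIdx t).const_add τ)
          fun n => by gcongr; exact le_dyadic_dyadicIdx n t).sub_const _
  have hmono (t : ℝ≥0) : S τ ω ≤ S (τ + t) ω := hS.mono ω le_self_add
  have hsum (t : ℝ≥0) : overshoot S b (v, ω) + (S (τ + t) ω - S τ ω) + b = v + S (τ + t) ω := by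
    have h1 : overshoot S b (v, ω) = v + S τ ω - b := rfl
    rw [h1, add_right_comm, tsub_add_cancel_of_le hbτ, add_assoc, add_tsub_cancel_of_le (hmono t)]
  apply ClosedSets.carrier_injective
  rw [hright]
  ext r
  simp only [ClosedSets.mem_restart, ClosedSets.carrier_translate, closedRange] at h ⊢
  rw [ClosedSets.shift_ofClosure] at h ⊢
  rw [ClosedSets.shift_ofClosure]
  constructor
  · intro hr
    rw [Metric.mem_closure_iff] at hr ⊢
    intro ε hε
    -- Here it matters that `b` is not covered: a path value below `b` which is `δ`-close to `r + b`
    -- would be `δ`-close to `b`. So points beyond `b` are only approximated by values after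
    -- passage.
    obtain ⟨δ, hδ, hδb⟩ := Metric.isOpen_iff.1 (isClosed_closure.isOpen_compl) b h
    obtain ⟨_, ⟨_, ⟨t, rfl⟩, rfl⟩, ht⟩ := hr (min ε δ) (lt_min hε hδ)
    have htτ : τ ≤ t := by
      by_contra hlt
      have h1 : v + S t ω < b := by
        rw [hτ, hS.passage_le_iff, tsub_le_iff_left, not_le] at hlt
        exact hlt
      refine hδb (a := v + S t ω) ?_ (subset_closure ⟨_, ⟨t, rfl⟩, rfl⟩)
      rw [Metric.mem_ball, NNReal.dist_eq, abs_lt]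
      rw [NNReal.dist_eq, abs_lt] at ht
      rw [← NNReal.coe_lt_coe] at h1
      have h2 := ht.2.trans_le (min_le_right _ _)
      push_cast at h1 h2 ⊢
      constructor <;> linarith [r.coe_nonneg]
    obtain ⟨s, rfl⟩ := le_iff_exists_add.1 htτ
    refine ⟨_, ⟨_, ⟨s, rfl⟩, rfl⟩, ?_⟩
    refine lt_of_eq_of_lt ?_ (ht.trans_le (min_le_left _ _))
    beta_reduce
    rw [← hsum s, NNReal.dist_eq, NNReal.dist_eq]
    push_cast
    ring_nf
  · intro hr
    rw [Metric.mem_closure_iff] at hr ⊢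
    intro ε hε
    obtain ⟨_, ⟨_, ⟨s, rfl⟩, rfl⟩, hs⟩ := hr ε hε
    refine ⟨_, ⟨_, ⟨τ + s, rfl⟩, rfl⟩, lt_of_eq_of_lt ?_ hs⟩
    beta_reduce
    rw [← hsum s, NNReal.dist_eq, NNReal.dist_eq]
    push_cast
    ring_nf

lemma lintegral_shiftedLaw [IsProbabilityMeasure P] (hS : IsRegularSubordinator β c S P)
    {h : ClosedSets → ℝ≥0∞} (hh : Measurable h) :
    ∫⁻ F, h F ∂shiftedLaw β (P.map (closedRange S))
      = ∫⁻ v, ∫⁻ ω, h ((closedRange S ω).translate v) ∂P ∂powerMeasure (1 - β) (-β) := by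
  have := hS.isProbabilityMeasure_map_closedRange
  have hm : Measurable fun p : ℝ≥0 × ClosedSets => h (p.2.translate p.1) :=
    hh.comp ClosedSets.measurable_translate
  rw [shiftedLaw, lintegral_map hh ClosedSets.measurable_translate,
    lintegral_prod _ hm.aemeasurable]
  refine lintegral_congr fun v => ?_
  exact lintegral_map (f := fun F : ClosedSets => h (F.translate v))
    (hm.comp measurable_prodMk_left) hS.measurable_closedRange

/-- Stationarity of the law of shifted stable regenerative sets. -/
lemma map_restart_shiftedLaw [IsProbabilityMeasure P] (hS : IsRegularSubordinator β c S P)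
    (hc : 0 < c) (hβ1 : β < 1) (b : ℝ≥0) :
    (shiftedLaw β (P.map (closedRange S))).map (ClosedSets.restart b)
      = shiftedLaw β (P.map (closedRange S)) := by
  refine Measure.ext_of_lintegral _ fun h hh => ?_
  rw [lintegral_map hh (ClosedSets.measurable_restart b),
    hS.lintegral_shiftedLaw (h := fun F => h (F.restart b))
      (hh.comp (ClosedSets.measurable_restart b)),
    hS.lintegral_shiftedLaw hh]
  let g : ℝ≥0 → ℝ≥0∞ := fun y => ∫⁻ ω, h ((closedRange S ω).translate y) ∂P
  have hg : Measurable g := by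
    have hm : Measurable fun q : ℝ≥0 × Ω => h ((closedRange S q.2).translate q.1) :=
      (hh.comp ClosedSets.measurable_translate).comp
        (measurable_fst.prodMk (hS.measurable_closedRange.comp measurable_snd))
    exact hm.lintegral_prod_right'
  -- By invariance the delay on the right side may be replaced by the overshoot over `b`; then the
  -- two sides agree for almost every fixed `v`, by the strong Markov property.
  have hR : ∫⁻ v, g v ∂powerMeasure (1 - β) (-β)
      = ∫⁻ v, ∫⁻ ω, g (overshoot S b (v, ω)) ∂P ∂powerMeasure (1 - β) (-β) := by
    conv_lhs => rw [← hS.map_overshoot hc hβ1 b]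
    rw [lintegral_map hg (hS.measurable_overshoot b)]
    exact lintegral_prod _ (hg.comp (hS.measurable_overshoot b)).aemeasurable
  change _ = ∫⁻ v, g v ∂powerMeasure (1 - β) (-β)
  rw [hR]
  refine lintegral_congr_ae ?_
  filter_upwards [Measure.ae_ae_of_ae_prod (hS.ae_notMem_shift hc hβ1 b)] with v hv
  let f : ℝ≥0 × (ℕ × ℕ → ℝ≥0) → ℝ≥0∞ := fun z =>
    h ((ClosedSets.ofClosure (Set.range z.2)).translate (v + z.1 - b))
  have hf : Measurable f :=
    (hh.comp ClosedSets.measurable_translate).comp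
      (((measurable_fst.const_add v).sub_const b).prodMk
        (ClosedSets.measurable_ofClosure_range.comp measurable_snd))
  have hsm := hS.lintegral_passage (b - v) hf
  calc ∫⁻ ω, h (((closedRange S ω).translate v).restart b) ∂P
      = ∫⁻ ω, f (S (passage S (b - v) ω) ω, fun p => S (passage S (b - v) ω + dyadic p) ω
          - S (passage S (b - v) ω) ω) ∂P := by
        refine lintegral_congr_ae ?_
        filter_upwards [hv] with ω hω
        rw [hS.restart_translate_closedRange hω]
        rfl
    _ = _ := by
        rw [hsm]
        refine lintegral_congr fun ω => lintegral_congr fun ω' => ?_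
        rw [hS.closedRange_eq ω']
        rfl

/-- The stationary hitting bound for intervals. -/
lemma shiftedLaw_hit_Icc_le [IsProbabilityMeasure P] (hS : IsRegularSubordinator β c S P)
    (hc : 0 < c) (hβ1 : β < 1) (x ε : ℝ≥0) :
    shiftedLaw β (P.map (closedRange S)) {F | (F.carrier ∩ Set.Icc x (x + ε)).Nonempty}
      ≤ powerMeasure (1 - β) (-β) (Set.Iic ε) := by
  have := hS.isProbabilityMeasure_map_closedRange
  have hK : IsCompact (Set.Iic ε) := by
    rw [← Set.Icc_bot]; exact isCompact_Icc
  refine le_trans (le_of_eq ?_) (shiftedLaw_hit_Iic_le β (P.map (closedRange S)) ε)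
  -- Restarting at `x` moves the interval to `[0, ε]`, which is hit only if the delay is at most
  -- `ε`.
  conv_rhs => rw [← hS.map_restart_shiftedLaw hc hβ1 x]
  rw [Measure.map_apply (ClosedSets.measurable_restart x)
    (ClosedSets.measurableSet_hit_isCompact hK)]
  congr 1
  ext F
  simp only [Set.mem_preimage, Set.mem_ofPred_eq, ClosedSets.hit_restart_iff]
  have : (fun r => r + x) '' Set.Iic ε = Set.Icc x (x + ε) := by
    ext y
    constructor
    · rintro ⟨r, hr, rfl⟩
      exact ⟨le_add_self, by rw [add_comm x]; exact add_le_add (Set.mem_Iic.1 hr) le_rfl⟩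
    · rintro ⟨h1, h2⟩
      exact ⟨y - x, tsub_le_iff_left.2 h2, tsub_add_cancel_of_le h1⟩
  rw [this]

end IsRegularSubordinator

/-! ### Poisson point processes -/

section PointMeasure

variable {Ω E : Type*} [MeasurableSpace E]

/-- The counting measure of the points `X 0 ω, X 1 ω, …`. -/
def pointMeasure (X : ℕ → Ω → E) (ω : Ω) : Measure E :=
  Measure.sum fun j => Measure.dirac (X j ω)

lemma pointMeasure_apply (X : ℕ → Ω → E) (ω : Ω) {A : Set E} (hA : MeasurableSet A) :
    pointMeasure X ω A = (pointCount X A ω : ℝ≥0∞) := by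
  rw [pointMeasure, Measure.sum_apply _ hA, pointCount, ← ENNReal.tsum_set_one,
    tsum_subtype _ (fun _ => (1 : ℝ≥0∞))]
  refine tsum_congr fun j => ?_
  rw [Measure.dirac_apply' _ hA]
  rfl

lemma lintegral_pointMeasure (X : ℕ → Ω → E) (ω : Ω) {f : E → ℝ≥0∞} (hf : Measurable f) :
    ∫⁻ x, f x ∂(pointMeasure X ω) = ∑' j, f (X j ω) := by
  rw [pointMeasure, lintegral_sum_measure]
  exact tsum_congr fun j => lintegral_dirac' _ hf

variable [MeasurableSpace Ω]

lemma measurable_pointMeasure {X : ℕ → Ω → E} (hX : ∀ j, Measurable (X j)) :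
    Measurable (pointMeasure X) := by
  refine Measure.measurable_of_measurable_coe _ fun A hA => ?_
  simp only [pointMeasure, Measure.sum_apply _ hA, Measure.dirac_apply' _ hA]
  exact Measurable.tsum fun j => (measurable_one.indicator hA).comp (hX j)

lemma measurable_toENNReal : Measurable ((↑) : ℕ∞ → ℝ≥0∞) := measurable_from_top

lemma measurable_pointCount {X : ℕ → Ω → E} (hX : ∀ j, Measurable (X j)) {A : Set E}
    (hA : MeasurableSet A) : Measurable (pointCount X A) := by
  refine ENat.measurable_iff.2 fun n => ?_
  have h : Measurable fun ω => pointMeasure X ω A :=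
    (Measure.measurable_coe hA).comp (measurable_pointMeasure hX)
  convert h (measurableSet_singleton (n : ℝ≥0∞)) using 1
  ext ω
  simp only [Set.mem_preimage, Set.mem_singleton_iff, pointMeasure_apply X ω hA]
  norm_cast

end PointMeasure

/-- As `(m + k)! ≥ m!`, the mass at `m + k` is at most `r ^ k` times the mass at `m`. The order `r ^
k` is all that the overlap estimate needs. -/
lemma poissonMeasure_le_pow (r : ℝ≥0) (k : ℕ) :
    poissonMeasure r {n | k ≤ n} ≤ (r : ℝ≥0∞) ^ k := by
  have hU : {n : ℕ | k ≤ n} = ⋃ m : ℕ, {m + k} := by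
    ext n
    simp only [Set.mem_ofPred_eq, Set.mem_iUnion, Set.mem_singleton_iff]
    exact ⟨fun h => ⟨n - k, by omega⟩, by rintro ⟨m, rfl⟩; omega⟩
  have hsum : ∑' m, poissonMeasure r {m} = 1 := by
    simp only [poissonMeasure_singleton]
    rw [← ENNReal.ofReal_tsum_of_nonneg (fun n => by positivity)
      (hasSum_one_poissonMeasure r).summable, (hasSum_one_poissonMeasure r).tsum_eq,
      ENNReal.ofReal_one]
  calc poissonMeasure r {n | k ≤ n} ≤ ∑' m, poissonMeasure r {m + k} := by
        rw [hU]
        exact measure_iUnion_le _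
    _ ≤ ∑' m, (r : ℝ≥0∞) ^ k * poissonMeasure r {m} := by
        refine ENNReal.tsum_le_tsum fun m => ?_
        rw [poissonMeasure_singleton, poissonMeasure_singleton, ← ENNReal.ofReal_coe_nnreal,
          ← ENNReal.ofReal_pow r.coe_nonneg, ← ENNReal.ofReal_mul (by positivity)]
        refine ENNReal.ofReal_le_ofReal ?_
        have hm : ((m.factorial : ℕ) : ℝ) ≤ ((m + k).factorial : ℕ) := by
          exact_mod_cast Nat.factorial_le (Nat.le_add_right m k)
        calc Real.exp (-r) * (r : ℝ) ^ (m + k) / ((m + k).factorial : ℕ)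
            ≤ Real.exp (-r) * (r : ℝ) ^ (m + k) / (m.factorial : ℕ) := by
              gcongr
          _ = (r : ℝ) ^ k * (Real.exp (-r) * (r : ℝ) ^ m / (m.factorial : ℕ)) := by
              rw [pow_add]; ring
    _ = (r : ℝ≥0∞) ^ k := by rw [ENNReal.tsum_mul_left, hsum, mul_one]

namespace IsPoissonEnumeration

variable {Ω E : Type*} [MeasurableSpace Ω] [MeasurableSpace E] {X Y : ℕ → Ω → E} {ν : Measure E}
  {P : Measure Ω}

/-- The images of the points of a Poisson process form a Poisson process. -/
lemma map {E' : Type*} [MeasurableSpace E'] (hX : IsPoissonEnumeration X ν P) {T : E → E'}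
    (hT : Measurable T) : IsPoissonEnumeration (fun j ω => T (X j ω)) (ν.map T) P where
  measurable j := hT.comp (hX.measurable j)
  law A hA hfin := by
    rw [Measure.map_apply hT hA] at hfin ⊢
    exact hX.law _ (hT hA) hfin
  indep n A hA hd :=
    hX.indep n (fun i => T ⁻¹' A i) (fun i => hT (hA i)) fun i j hij => (hd i j hij).preimage T

/-- A bound for the probability that a Poisson process has at least `k` points in a set. -/
lemma measure_le_pointCount_le (hX : IsPoissonEnumeration X ν P) {A : Set E}
    (hA : MeasurableSet A) (hfin : ν A ≠ ∞) (k : ℕ) :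
    P {ω | (k : ℕ∞) ≤ pointCount X A ω} ≤ ν A ^ k := by
  have h1 : P {ω | (k : ℕ∞) ≤ pointCount X A ω} = P.map (pointCount X A) {c | (k : ℕ∞) ≤ c} := by
    rw [Measure.map_apply (measurable_pointCount hX.measurable hA) (MeasurableSet.of_discrete)]
    rfl
  rw [h1, hX.law A hA hfin, Measure.map_apply Measurable.of_discrete MeasurableSet.of_discrete]
  calc poissonMeasure (ν A).toNNReal ((fun n : ℕ => (n : ℕ∞)) ⁻¹' {c | (k : ℕ∞) ≤ c})
      = poissonMeasure (ν A).toNNReal {n | k ≤ n} := by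
        congr 1
        ext n
        simp
    _ ≤ ((ν A).toNNReal : ℝ≥0∞) ^ k := poissonMeasure_le_pow _ k
    _ = ν A ^ k := by rw [ENNReal.coe_toNNReal hfin]

lemma ae_pointCount_ne_top (hX : IsPoissonEnumeration X ν P) {A : Set E}
    (hA : MeasurableSet A) (hfin : ν A ≠ ∞) : ∀ᵐ ω ∂P, pointCount X A ω ≠ ⊤ := by
  have h : ∀ᵐ c ∂(P.map (pointCount X A)), c ≠ ⊤ := by
    rw [hX.law A hA hfin, ae_map_iff Measurable.of_discrete.aemeasurable MeasurableSet.of_discrete]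
    exact Filter.Eventually.of_forall fun n => ENat.natCast_ne_top n
  exact (ae_map_iff (measurable_pointCount hX.measurable hA).aemeasurable
    MeasurableSet.of_discrete).1 h

/-- The joint law of the numbers of points in disjoint sets is a product of Poisson laws. -/
lemma map_pointCount_disjoint (hX : IsPoissonEnumeration X ν P) {ι : Type*} [Fintype ι]
    {C : ι → Set E} (hC : ∀ i, MeasurableSet (C i)) (hd : ∀ i j, i ≠ j → Disjoint (C i) (C j))
    (hfin : ∀ i, ν (C i) ≠ ∞) :
    P.map (fun ω i => pointCount X (C i) ω) = Measure.pi fun i =>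
      (poissonMeasure (ν (C i)).toNNReal).map (fun n : ℕ => (n : ℕ∞)) := by
  have hind : iIndepFun (fun i => pointCount X (C i)) P := by
    have h := (hX.indep _ (fun i => C ((Fintype.equivFin ι).symm i)) (fun i => hC _)
      fun i j hij => hd _ _ ((Fintype.equivFin ι).symm.injective.ne hij)).precomp
      (Fintype.equivFin ι).injective
    simpa using h
  rw [hind.map_fun_eq_pi_map fun i => (measurable_pointCount hX.measurable (hC i)).aemeasurable]
  congr 1
  funext i
  exact hX.law _ (hC i) (hfin i)

/-- The joint law of the numbers of points in finitely many sets depends only on the mean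
measure. -/
lemma map_pointMeasure_apply_eq (hX : IsPoissonEnumeration X ν P)
    (hY : IsPoissonEnumeration Y ν P) {ι : Type*} [Fintype ι] {B : ι → Set E}
    (hB : ∀ i, MeasurableSet (B i)) (hfin : ∀ i, ν (B i) ≠ ∞) :
    P.map (fun ω i => pointMeasure X ω (B i)) = P.map (fun ω i => pointMeasure Y ω (B i)) := by
  classical
  -- Atoms of the family `B`: they are disjoint, so their counts are independent Poisson variables,
  -- and every `B i` is a finite union of them. The atom of points outside all `B i` is discarded,
  -- since its mean may be infinite.
  let C : Finset ι → Set E := fun σ => {x | σ.Nonempty ∧ ∀ i, x ∈ B i ↔ i ∈ σ}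
  have hC : ∀ σ, MeasurableSet (C σ) := fun σ => by
    have hCσ : C σ = {_x | σ.Nonempty} ∩ ⋂ i, {x | x ∈ B i ↔ i ∈ σ} := by
      ext x
      simp [C]
    rw [hCσ]
    refine (MeasurableSet.const _).inter (MeasurableSet.iInter fun i => ?_)
    by_cases hi : i ∈ σ
    · simp only [hi, iff_true]
      exact hB i
    · simp only [hi, iff_false]
      exact (hB i).compl
  have hd : ∀ σ τ, σ ≠ τ → Disjoint (C σ) (C τ) := fun σ τ h => by
    refine Set.disjoint_left.2 fun x hx hx' => h ?_
    ext i
    rw [← hx.2 i, hx'.2 i]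
  have hCfin : ∀ σ, ν (C σ) ≠ ∞ := fun σ => by
    rcases σ.eq_empty_or_nonempty with rfl | ⟨i, hi⟩
    · have : C ∅ = ∅ := by
        ext x
        simp [C]
      simp [this]
    · exact ne_top_of_le_ne_top (hfin i) (measure_mono fun x hx => (hx.2 i).2 hi)
  have hBC : ∀ i, B i = ⋃ σ ∈ (Finset.univ : Finset (Finset ι)).filter (fun σ => i ∈ σ), C σ := by
    intro i
    ext x
    simp only [Finset.mem_filter, Finset.mem_univ, true_and, Set.mem_iUnion, exists_prop]
    constructor
    · intro hx
      refine ⟨Finset.univ.filter fun j => x ∈ B j, by simpa using hx, ⟨i, by simpa using hx⟩,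
        fun j => by simp⟩
    · rintro ⟨σ, hi, hx⟩
      exact (hx.2 i).2 hi
  let g : (Finset ι → ℕ∞) → ι → ℝ≥0∞ := fun c i =>
    ∑ σ ∈ (Finset.univ : Finset (Finset ι)).filter (fun σ => i ∈ σ), (c σ : ℝ≥0∞)
  have hg : Measurable g := measurable_pi_lambda _ fun i =>
    Finset.measurable_fun_sum _ fun σ _ => measurable_toENNReal.comp (measurable_pi_apply σ)
  have key : ∀ {Z : ℕ → Ω → E}, IsPoissonEnumeration Z ν P →
      P.map (fun ω i => pointMeasure Z ω (B i)) = (Measure.pi fun σ =>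
        (poissonMeasure (ν (C σ)).toNNReal).map (fun n : ℕ => (n : ℕ∞))).map g := by
    intro Z hZ
    rw [← hZ.map_pointCount_disjoint hC hd hCfin, Measure.map_map hg
      (measurable_pi_lambda _ fun σ => measurable_pointCount hZ.measurable (hC σ))]
    congr 1
    funext ω i
    conv_lhs => rw [hBC i]
    rw [measure_biUnion_finset (fun σ _ τ _ h => hd σ τ h) (fun σ _ => hC σ)]
    exact Finset.sum_congr rfl fun σ _ => pointMeasure_apply Z ω (hC σ)
  rw [key hX, key hY]

/-- The joint law of the restrictions of a Poisson process to sets of finite mean measure depends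
only on the mean measure. -/
lemma map_restrict_pointMeasure_eq [IsFiniteMeasure P] (hX : IsPoissonEnumeration X ν P)
    (hY : IsPoissonEnumeration Y ν P) {κ : Type*} {W : κ → Set E}
    (hW : ∀ k, MeasurableSet (W k)) (hfin : ∀ k, ν (W k) ≠ ∞) :
    P.map (fun ω k => (pointMeasure X ω).restrict (W k))
      = P.map (fun ω k => (pointMeasure Y ω).restrict (W k)) := by
  -- The σ-algebra on families of measures is generated by evaluations, so the law is determined by
  -- finitely many counts at a time.
  let ι := κ × {A : Set E // MeasurableSet A}
  let e : (κ → Measure E) → ι → ℝ≥0∞ := fun M i => M i.1 i.2.1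
  have hmeas : ∀ {Z : ℕ → Ω → E}, IsPoissonEnumeration Z ν P →
      Measurable fun ω k => (pointMeasure Z ω).restrict (W k) := fun {Z} hZ =>
    measurable_pi_lambda _ fun k => Measure.measurable_of_measurable_coe _ fun A hA => by
      simp only [Measure.restrict_apply hA]
      exact (Measure.measurable_coe (hA.inter (hW k))).comp (measurable_pointMeasure hZ.measurable)
  have he : (inferInstance : MeasurableSpace (κ → Measure E)) =
      MeasurableSpace.comap e inferInstance := by
    apply le_antisymm
    · refine iSup_le fun k => ?_
      rw [← measurable_iff_comap_le]
      refine @Measure.measurable_of_measurable_coe _ _ _ (MeasurableSpace.comap e inferInstance) _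
        fun A hA => ?_
      exact (measurable_pi_apply ((k, ⟨A, hA⟩) : ι)).comp (comap_measurable e)
    · rw [← measurable_iff_comap_le]
      exact measurable_pi_lambda _ fun i =>
        (Measure.measurable_coe i.2.2).comp (measurable_pi_apply i.1)
  have hem : Measurable e := measurable_iff_comap_le.2 he.ge
  have hlaw : P.map (fun ω i => e (fun k => (pointMeasure X ω).restrict (W k)) i)
      = P.map (fun ω i => e (fun k => (pointMeasure Y ω).restrict (W k)) i) := by
    refine (map_eq_iff_forall_finset_map_restrict_eq (hem.comp (hmeas hX)).aemeasurable
      (hem.comp (hmeas hY)).aemeasurable).2 fun I => ?_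
    have h := hX.map_pointMeasure_apply_eq hY (ι := I) (B := fun i => i.1.2.1 ∩ W i.1.1)
      (fun i => i.1.2.2.inter (hW _))
      (fun i => ne_top_of_le_ne_top (hfin _) (measure_mono Set.inter_subset_right))
    convert h using 2 <;>
    · funext ω i
      exact Measure.restrict_apply i.1.2.2
  ext D hD
  obtain ⟨B, hB, rfl⟩ : ∃ B, MeasurableSet B ∧ e ⁻¹' B = D := by
    exact he.le D hD
  have h := congrArg (fun μ => μ B) hlaw
  rw [Measure.map_apply (hmeas hX) (hem hB), Measure.map_apply (hmeas hY) (hem hB)]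
  exact (Measure.map_apply (hem.comp (hmeas hX)) hB).symm.trans
    (h.trans (Measure.map_apply (hem.comp (hmeas hY)) hB))

end IsPoissonEnumeration

/-! ### The sup-measure of a sequence of weighted closed sets -/

/-- The total weight of the sets which contain `t`. -/
def coverFun (z : ℕ → ℝ≥0 × ClosedSets) (t : ℝ≥0) : ℝ≥0∞ :=
  ∑' j, (z j).2.carrier.indicator (fun _ => ((z j).1 : ℝ≥0∞)) t

/-- The sup-measure with density `coverFun z`. -/
def coverSup (z : ℕ → ℝ≥0 × ClosedSets) : SupMeasure := SupMeasure.supIntegral (coverFun z)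

lemma coverSup_onOpen (z : ℕ → ℝ≥0 × ClosedSets) (G : TopologicalSpace.Opens ℝ≥0) :
    (coverSup z).onOpen G = ⨆ t ∈ G, coverFun z t := rfl

lemma sum_indicator_le_coverFun (z : ℕ → ℝ≥0 × ClosedSets) (J : Finset ℕ) (t : ℝ≥0) :
    ∑ j ∈ J, (z j).2.carrier.indicator (fun _ => ((z j).1 : ℝ≥0∞)) t ≤ coverFun z t :=
  ENNReal.sum_le_tsum J

/-- A sum in `ℝ≥0∞` is the supremum of its finite partial sums, from which vanishing terms can be
dropped. Positive weights are kept because finitely many of them exceed a common `1 / (n + 1)`. -/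
lemma lt_coverFun_iff (z : ℕ → ℝ≥0 × ClosedSets) (t : ℝ≥0) (a : ℝ≥0∞) :
    a < coverFun z t ↔ ∃ J : Finset ℕ, (∀ j ∈ J, t ∈ (z j).2.carrier ∧ 0 < (z j).1) ∧
      a < ∑ j ∈ J, ((z j).1 : ℝ≥0∞) := by
  classical
  constructor
  · intro h
    rw [coverFun, ENNReal.tsum_eq_iSup_sum, lt_iSup_iff] at h
    obtain ⟨J, hJ⟩ := h
    refine ⟨J.filter fun j => t ∈ (z j).2.carrier ∧ 0 < (z j).1, by simp, ?_⟩
    rw [Finset.sum_filter]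
    convert hJ using 1
    refine Finset.sum_congr rfl fun j _ => ?_
    by_cases h1 : t ∈ (z j).2.carrier
    · by_cases h2 : 0 < (z j).1
      · simp [h1, h2]
      · simp [h1, not_lt.1 h2 |>.antisymm bot_le]
    · simp [h1]
  · rintro ⟨J, hJ, h⟩
    refine h.trans_le ((Finset.sum_le_sum fun j hj => ?_).trans (sum_indicator_le_coverFun z J t))
    rw [Set.indicator_of_mem (hJ j hj).1]

/-- The `i`-th interval of length `1 / (n + 1)`. -/
def cell (n i : ℕ) : Set ℝ≥0 := Set.Icc ((i : ℝ≥0) / (n + 1)) (((i : ℝ≥0) + 1) / (n + 1))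

lemma isCompact_cell (n i : ℕ) : IsCompact (cell n i) := isCompact_Icc

/-- The bound on `i` limits the number of cells needed to cover `[0, T]`. -/
lemma exists_mem_cell (n : ℕ) (t : ℝ≥0) : ∃ i : ℕ, t ∈ cell n i ∧ (i : ℝ≥0) ≤ t * (n + 1) := by
  have h := Nat.floor_le (bot_le : (0 : ℝ≥0) ≤ t * (n + 1))
  refine ⟨⌊t * (n + 1)⌋₊, ⟨?_, ?_⟩, h⟩
  · rw [div_le_iff₀ (by positivity)]
    exact h
  · rw [le_div_iff₀ (by positivity)]
    exact (Nat.lt_floor_add_one _).le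

lemma dist_le_of_mem_cell {n i : ℕ} {s t : ℝ≥0} (hs : s ∈ cell n i) (ht : t ∈ cell n i) :
    dist s t ≤ 1 / ((n : ℝ) + 1) := by
  have h1 : ((i : ℝ) + 1) / (n + 1) = (i : ℝ) / (n + 1) + 1 / (n + 1) := add_div _ _ _
  have hs1 : (i : ℝ) / (n + 1) ≤ s := by exact_mod_cast hs.1
  have hs2 : (s : ℝ) ≤ ((i : ℝ) + 1) / (n + 1) := by exact_mod_cast hs.2
  have ht1 : (i : ℝ) / (n + 1) ≤ t := by exact_mod_cast ht.1
  have ht2 : (t : ℝ) ≤ ((i : ℝ) + 1) / (n + 1) := by exact_mod_cast ht.2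
  rw [NNReal.dist_eq, abs_le]
  constructor <;> linarith

/-- Finitely many closed sets have a common point in a compact set, if for arbitrarily small cells
they all meet the same cell. -/
lemma exists_mem_of_frequently_cell {ι : Type*} {K : Set ℝ≥0} (hK : IsCompact K)
    {F : ι → Set ℝ≥0} (hF : ∀ j, IsClosed (F j)) {J : Set ι} (hJ : J.Nonempty)
    (h : ∃ᶠ n in Filter.atTop, ∃ i, ∀ j ∈ J, (F j ∩ (K ∩ cell n i)).Nonempty) :
    ∃ t ∈ K, ∀ j ∈ J, t ∈ F j := by
  -- Points of one set in the chosen cells accumulate at some `t ∈ K`; points of the other sets in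
  -- the same cells have the same limit, because the cell lengths tend to `0`.
  obtain ⟨φ, hφ, h⟩ := Filter.extraction_of_frequently_atTop h
  choose i hi using h
  obtain ⟨j₀, hj₀⟩ := hJ
  choose x hx using fun n => hi n j₀ hj₀
  obtain ⟨t, htK, ψ, hψ, ht⟩ := hK.tendsto_subseq fun n => (hx n).2.1
  refine ⟨t, htK, fun j hj => ?_⟩
  choose y hy using fun n => hi n j hj
  refine (hF j).mem_of_tendsto (b := Filter.atTop) (f := fun n => y (ψ n)) ?_
    (Filter.Eventually.of_forall fun n => (hy (ψ n)).1)
  refine ht.congr_dist (squeeze_zero (fun _ => dist_nonneg)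
    (fun n => dist_le_of_mem_cell (hx (ψ n)).2.2 (hy (ψ n)).2.2) ?_)
  exact (tendsto_one_div_add_atTop_nhds_zero_nat (𝕜 := ℝ)).comp (hφ.comp hψ).tendsto_atTop

lemma exists_mem_iff_forall_cell {ι : Type*} {K : Set ℝ≥0} (hK : IsCompact K)
    {F : ι → Set ℝ≥0} (hF : ∀ j, IsClosed (F j)) {J : Set ι} (hJ : J.Nonempty) :
    (∃ t ∈ K, ∀ j ∈ J, t ∈ F j) ↔ ∀ n, ∃ i, ∀ j ∈ J, (F j ∩ (K ∩ cell n i)).Nonempty := by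
  constructor
  · rintro ⟨t, htK, ht⟩ n
    obtain ⟨i, hi, -⟩ := exists_mem_cell n t
    exact ⟨i, fun j hj => ⟨t, ht j hj, htK, hi⟩⟩
  · exact fun h => exists_mem_of_frequently_cell hK hF hJ (Filter.Frequently.of_forall h)

/-- The uncountable union over `t` is exchanged, on each of countably many compact balls, for a
countable condition on cells. This needs `J` to be finite and nonempty. -/
lemma measurableSet_exists_mem {Ω : Type*} [MeasurableSpace Ω] {F : ℕ → Ω → ClosedSets}
    (hF : ∀ j, Measurable (F j)) {J : Finset ℕ} (hJ : J.Nonempty) {G : Set ℝ≥0} (hG : IsOpen G) :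
    MeasurableSet {ω | ∃ t ∈ G, ∀ j ∈ J, t ∈ (F j ω).carrier} := by
  have h1 : {ω | ∃ t ∈ G, ∀ j ∈ J, t ∈ (F j ω).carrier}
      = ⋃ m ∈ {m | ratClosedBall m ⊆ G},
        {ω | ∃ t ∈ ratClosedBall m, ∀ j ∈ J, t ∈ (F j ω).carrier} := by
    ext ω
    conv_lhs => rw [← iUnion_ratClosedBall_eq hG]
    simp only [Set.mem_ofPred_eq, Set.mem_iUnion, exists_prop]
    tauto
  rw [h1]
  refine MeasurableSet.biUnion (Set.to_countable _) fun m _ => ?_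
  have h2 : {ω | ∃ t ∈ ratClosedBall m, ∀ j ∈ J, t ∈ (F j ω).carrier}
      = ⋂ n, ⋃ i, ⋂ j ∈ J, F j ⁻¹' {A | (A.carrier ∩ (ratClosedBall m ∩ cell n i)).Nonempty} := by
    ext ω
    have := exists_mem_iff_forall_cell (isCompact_ratClosedBall m)
      (F := fun j => (F j ω).carrier) (fun j => (F j ω).isClosed_carrier) (J := (J : Set ℕ)) hJ
    simpa using this
  rw [h2]
  exact MeasurableSet.iInter fun n => MeasurableSet.iUnion fun i => J.measurableSet_biInter
    fun j _ => hF j (ClosedSets.measurableSet_hit_isCompact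
      ((isCompact_ratClosedBall m).inter (isCompact_cell n i)))

/-- A value above `a` is witnessed by a finite `J` whose sets have a common point and whose weights
sum to more than `a`; the second condition no longer involves `t`. -/
lemma measurable_coverSup {Ω : Type*} [MeasurableSpace Ω] {Z : ℕ → Ω → ℝ≥0 × ClosedSets}
    (hZ : ∀ j, Measurable (Z j)) : Measurable fun ω => coverSup fun j => Z j ω := by
  refine SupMeasure.measurable_of_onOpen fun G => measurable_of_Ioi fun a => ?_
  have : (fun ω => (coverSup fun j => Z j ω).onOpen G) ⁻¹' Set.Ioi a
      = ⋃ J ∈ {J : Finset ℕ | J.Nonempty}, {ω | ∃ t ∈ (G : Set ℝ≥0), ∀ j ∈ J,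
        t ∈ (Z j ω).2.carrier} ∩ {ω | a < ∑ j ∈ J, ((Z j ω).1 : ℝ≥0∞)} := by
    ext ω
    simp only [Set.mem_preimage, Set.mem_Ioi, coverSup_onOpen, lt_iSup_iff, lt_coverFun_iff,
      Set.mem_iUnion, Set.mem_inter_iff, Set.mem_ofPred_eq, exists_prop]
    constructor
    · rintro ⟨t, ht, J, hJ, h⟩
      refine ⟨J, ?_, ⟨t, ht, fun j hj => (hJ j hj).1⟩, h⟩
      rcases J.eq_empty_or_nonempty with rfl | hne
      · simp at h
      · exact hne
    · rintro ⟨J, -, ⟨t, ht, hJ⟩, h⟩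
      refine ⟨t, ht, (lt_coverFun_iff _ t a).1 (h.trans_le ?_)⟩
      refine (Finset.sum_le_sum fun j hj => ?_).trans (sum_indicator_le_coverFun _ J t)
      rw [Set.indicator_of_mem (hJ j hj)]
  rw [this]
  refine MeasurableSet.biUnion (Set.to_countable _) fun J hJ => ?_
  refine (measurableSet_exists_mem (fun j => measurable_snd.comp (hZ j)) hJ G.isOpen).inter ?_
  exact measurableSet_lt measurable_const (Finset.measurable_fun_sum _ fun j _ =>
    (measurable_fst.comp (hZ j)).coe_nnreal_ennreal)

/-! ### The law of the sup-measure of a Poisson process -/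

/-- The function `(u, F) ↦ u 1{F ∩ K ≠ ∅}`. -/
def hitWeight (K : Set ℝ≥0) (x : ℝ≥0 × ClosedSets) : ℝ≥0∞ :=
  {y : ℝ≥0 × ClosedSets | (y.2.carrier ∩ K).Nonempty}.indicator (fun y => (y.1 : ℝ≥0∞)) x

lemma measurable_hitWeight {K : Set ℝ≥0} (hK : IsCompact K) : Measurable (hitWeight K) :=
  measurable_fst.coe_nnreal_ennreal.indicator
    (measurable_snd (ClosedSets.measurableSet_hit_isCompact hK))

/-- The supremum over the compact set `K` of the total weight, as a functional of the counting
measure of the weighted sets. -/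
def cellSup (K : Set ℝ≥0) (M : Measure (ℝ≥0 × ClosedSets)) : ℝ≥0∞ :=
  ⨅ n, ⨆ i, ∫⁻ x, hitWeight (K ∩ cell n i) x ∂M

lemma measurable_cellSup {K : Set ℝ≥0} (hK : IsCompact K) : Measurable (cellSup K) :=
  Measurable.iInf fun n => Measurable.iSup fun i =>
    Measure.measurable_lintegral (measurable_hitWeight (hK.inter (isCompact_cell n i)))

lemma lintegral_restrict_pointMeasure {Ω E : Type*} [MeasurableSpace E] (X : ℕ → Ω → E) (ω : Ω)
    {W : Set E} (hW : MeasurableSet W) {f : E → ℝ≥0∞} (hf : Measurable f) {J : Finset ℕ}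
    (hJ : ∀ j, j ∈ J ↔ X j ω ∈ W) :
    ∫⁻ x in W, f x ∂(pointMeasure X ω) = ∑ j ∈ J, f (X j ω) := by
  rw [← lintegral_indicator hW, lintegral_pointMeasure X ω (hf.indicator hW),
    tsum_eq_sum (s := J) fun j hj => Set.indicator_of_notMem (fun h => hj ((hJ j).2 h)) _]
  exact Finset.sum_congr rfl fun j hj => Set.indicator_of_mem ((hJ j).1 hj) _

/-- Shows that the supremum of a finite overlap sum over `K` is a function of the counting measure,
not of the enumeration. Two sets may hit one cell without meeting, and the infimum over `n` removes
this excess. -/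
lemma cellSup_restrict_pointMeasure {Ω : Type*} (X : ℕ → Ω → ℝ≥0 × ClosedSets) (ω : Ω)
    {W : Set (ℝ≥0 × ClosedSets)} (hW : MeasurableSet W) {K : Set ℝ≥0} (hK : IsCompact K)
    {J : Finset ℕ} (hJ : ∀ j, j ∈ J ↔ X j ω ∈ W) :
    cellSup K ((pointMeasure X ω).restrict W)
      = ⨆ t ∈ K, ∑ j ∈ J, (X j ω).2.carrier.indicator (fun _ => ((X j ω).1 : ℝ≥0∞)) t := by
  classical
  have hintegral : ∀ n i, ∫⁻ x in W, hitWeight (K ∩ cell n i) x ∂(pointMeasure X ω)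
      = ∑ j ∈ J, hitWeight (K ∩ cell n i) (X j ω) := fun n i =>
    lintegral_restrict_pointMeasure X ω hW (measurable_hitWeight (hK.inter (isCompact_cell n i))) hJ
  simp only [cellSup, hintegral]
  apply le_antisymm
  · refine le_of_forall_lt fun c hc => ?_
    have h1 : ∀ n, ∃ i, c < ∑ j ∈ J, hitWeight (K ∩ cell n i) (X j ω) := fun n =>
      lt_iSup_iff.1 (hc.trans_le (iInf_le _ n))
    choose i hi using h1
    -- Pigeonhole: `J` has finitely many subsets, so some `I` is the set of indices hitting the
    -- chosen cell for infinitely many `n`. The sets indexed by `I` then have a common point.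
    have h2 : ∃ I ∈ J.powerset, ∃ᶠ n in Filter.atTop,
        (J.filter fun j => ((X j ω).2.carrier ∩ (K ∩ cell n (i n))).Nonempty) = I := by
      by_contra hcon
      push Not at hcon
      have := ((Filter.eventually_all_finset J.powerset).2 hcon).exists
      obtain ⟨n, hn⟩ := this
      exact hn _ (Finset.mem_powerset.2 (Finset.filter_subset _ _)) rfl
    obtain ⟨I, -, hI⟩ := h2
    have hsum : c < ∑ j ∈ I, ((X j ω).1 : ℝ≥0∞) := by
      obtain ⟨n, rfl⟩ := hI.exists
      rw [Finset.sum_filter]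
      convert hi n using 1
      simp only [hitWeight, Set.indicator_apply, Set.mem_ofPred_eq]
    have hIJ : I ⊆ J := by
      obtain ⟨n, rfl⟩ := hI.exists
      exact Finset.filter_subset _ _
    have hne : (I : Set ℕ).Nonempty := by
      rcases I.eq_empty_or_nonempty with rfl | hne
      · simp at hsum
      · exact hne
    obtain ⟨t, htK, ht⟩ := exists_mem_of_frequently_cell hK
      (F := fun j => (X j ω).2.carrier) (fun j => (X j ω).2.isClosed_carrier) hne
      (hI.mono fun n hn => ⟨i n, fun j hj => by
        rw [← hn] at hj
        exact (Finset.mem_filter.1 hj).2⟩)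
    refine hsum.trans_le (le_trans ?_ (le_iSup₂ (f := fun t (_ : t ∈ K) =>
      ∑ j ∈ J, (X j ω).2.carrier.indicator (fun _ => ((X j ω).1 : ℝ≥0∞)) t) t htK))
    refine le_trans (Finset.sum_le_sum fun j hj => ?_) (Finset.sum_le_sum_of_subset hIJ)
    rw [Set.indicator_of_mem (ht j hj)]
  · refine le_iInf fun n => iSup₂_le fun t htK => ?_
    obtain ⟨i, hi, -⟩ := exists_mem_cell n t
    refine le_iSup_of_le i (Finset.sum_le_sum fun j _ => ?_)
    by_cases ht : t ∈ (X j ω).2.carrier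
    · rw [Set.indicator_of_mem ht, hitWeight, Set.indicator_of_mem]
      exact ⟨t, ht, htK, hi⟩
    · simp [ht]

/-- The weighted sets with weight larger than `1 / (p.1 + 1)` which hit `ratClosedBall p.2`. -/
def heavyHit (p : ℕ × ℕ × ℕ) : Set (ℝ≥0 × ClosedSets) :=
  Set.Ioi (1 / ((p.1 : ℝ≥0) + 1)) ×ˢ {F | (F.carrier ∩ ratClosedBall p.2).Nonempty}

lemma measurableSet_heavyHit (p : ℕ × ℕ × ℕ) : MeasurableSet (heavyHit p) :=
  measurableSet_Ioi.prod (ClosedSets.measurableSet_hit_isCompact (isCompact_ratClosedBall p.2))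

/-- A finite witness at `t` involves only weights above some `1 / (n + 1)` and sets meeting a ball
around `t`. So finite restrictions of the point configuration exhaust the value. -/
lemma coverSup_onOpen_eq {Ω : Type*} (X : ℕ → Ω → ℝ≥0 × ClosedSets) (ω : Ω)
    (hfin : ∀ p, pointCount X (heavyHit p) ω ≠ ⊤) (G : TopologicalSpace.Opens ℝ≥0) :
    (coverSup fun j => X j ω).onOpen G = ⨆ p ∈ {p : ℕ × ℕ × ℕ | ratClosedBall p.2 ⊆ (G : Set ℝ≥0)},
      cellSup (ratClosedBall p.2) ((pointMeasure X ω).restrict (heavyHit p)) := by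
  have hfin' : ∀ p, {j | X j ω ∈ heavyHit p}.Finite := fun p =>
    Set.encard_ne_top_iff.1 (hfin p)
  have hcell : ∀ p, cellSup (ratClosedBall p.2) ((pointMeasure X ω).restrict (heavyHit p))
      = ⨆ t ∈ ratClosedBall p.2, ∑ j ∈ (hfin' p).toFinset,
        (X j ω).2.carrier.indicator (fun _ => ((X j ω).1 : ℝ≥0∞)) t := fun p =>
    cellSup_restrict_pointMeasure X ω (measurableSet_heavyHit p) (isCompact_ratClosedBall p.2)
      fun j => by simp
  simp only [hcell, coverSup_onOpen]
  apply le_antisymm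
  · refine iSup₂_le fun t ht => le_of_forall_lt fun a ha => ?_
    obtain ⟨J, hJ, hJa⟩ := (lt_coverFun_iff _ t a).1 ha
    obtain ⟨m, hm, hmG⟩ := exists_ratBall G.isOpen ht
    obtain ⟨n, hn⟩ : ∃ n : ℕ, ∀ j ∈ J, 1 / ((n : ℝ≥0) + 1) < (X j ω).1 := by
      have : ∀ᶠ n : ℕ in Filter.atTop, ∀ j ∈ J, 1 / ((n : ℝ≥0) + 1) < (X j ω).1 :=
        (Filter.eventually_all_finset J).2 fun j hj =>
          (tendsto_nnreal_const_div 1).eventually (gt_mem_nhds (hJ j hj).2)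
      exact this.exists
    have hJ' : J ⊆ (hfin' (n, m)).toFinset := fun j hj => by
      simp only [Set.Finite.mem_toFinset]
      exact ⟨hn j hj, t, (hJ j hj).1, ratBall_subset m hm⟩
    refine hJa.trans_le (le_trans ?_ (le_iSup₂_of_le (n, m) hmG
      (le_iSup₂_of_le t (ratBall_subset m hm) (Finset.sum_le_sum_of_subset hJ'))))
    refine Finset.sum_le_sum fun j hj => ?_
    rw [Set.indicator_of_mem (hJ j hj).1]
  · refine iSup₂_le fun p hp => iSup₂_le fun t ht => ?_
    exact (sum_indicator_le_coverFun _ _ t).trans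
      (le_iSup₂ (f := fun t (_ : t ∈ G) => coverFun (fun j => X j ω) t) t (hp ht))

/-- The law of the sup-measure of a Poisson process depends only on the mean measure. -/
lemma IsPoissonEnumeration.map_coverSup_eq {Ω : Type*} [MeasurableSpace Ω] {P : Measure Ω}
    [IsFiniteMeasure P] {X Y : ℕ → Ω → ℝ≥0 × ClosedSets} {ν : Measure (ℝ≥0 × ClosedSets)}
    (hX : IsPoissonEnumeration X ν P) (hY : IsPoissonEnumeration Y ν P)
    (hfin : ∀ p, ν (heavyHit p) ≠ ∞) :
    P.map (fun ω => coverSup fun j => X j ω) = P.map (fun ω => coverSup fun j => Y j ω) := by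
  -- `Ψ` recovers the sup-measure from the restricted counting measures, almost surely and by the
  -- same formula for `X` and `Y`.
  let Ψ : (ℕ × ℕ × ℕ → Measure (ℝ≥0 × ClosedSets)) → TopologicalSpace.Opens ℝ≥0 → ℝ≥0∞ :=
    fun M G => ⨆ p ∈ {p : ℕ × ℕ × ℕ | ratClosedBall p.2 ⊆ (G : Set ℝ≥0)},
      cellSup (ratClosedBall p.2) (M p)
  have hΨ : Measurable Ψ := measurable_pi_lambda _ fun G =>
    Measurable.biSup _ (Set.to_countable _) fun p _ =>
      (measurable_cellSup (isCompact_ratClosedBall p.2)).comp (measurable_pi_apply p)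
  have hmeas : ∀ {Z : ℕ → Ω → ℝ≥0 × ClosedSets}, IsPoissonEnumeration Z ν P →
      Measurable fun ω p => (pointMeasure Z ω).restrict (heavyHit p) := fun {Z} hZ =>
    measurable_pi_lambda _ fun p => Measure.measurable_of_measurable_coe _ fun A hA => by
      simp only [Measure.restrict_apply hA]
      exact (Measure.measurable_coe (hA.inter (measurableSet_heavyHit p))).comp
        (measurable_pointMeasure hZ.measurable)
  ext D hD
  obtain ⟨B, hB, rfl⟩ := SupMeasure.exists_measurableSet_preimage_onOpen hD
  have key : ∀ {Z : ℕ → Ω → ℝ≥0 × ClosedSets}, IsPoissonEnumeration Z ν P →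
      P.map (fun ω => coverSup fun j => Z j ω) (SupMeasure.onOpen ⁻¹' B)
        = P.map (fun ω p => (pointMeasure Z ω).restrict (heavyHit p)) (Ψ ⁻¹' B) := by
    intro Z hZ
    rw [Measure.map_apply (measurable_coverSup hZ.measurable) hD,
      Measure.map_apply (hmeas hZ) (hΨ hB)]
    refine measure_congr ?_
    filter_upwards [ae_all_iff.2 fun p =>
      hZ.ae_pointCount_ne_top (measurableSet_heavyHit p) (hfin p)] with ω hω
    have : (coverSup fun j => Z j ω).onOpen
        = Ψ fun p => (pointMeasure Z ω).restrict (heavyHit p) :=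
      funext fun G => coverSup_onOpen_eq Z ω hω G
    refine propext ?_
    change (coverSup fun j => Z j ω).onOpen ∈ B ↔
      Ψ (fun p => (pointMeasure Z ω).restrict (heavyHit p)) ∈ B
    rw [this]
  rw [key hX, key hY, hX.map_restrict_pointMeasure_eq hY measurableSet_heavyHit hfin]

/-! ### Overlaps of the weighted sets -/

lemma cell_eq (n i : ℕ) :
    cell n i = Set.Icc ((i : ℝ≥0) / (n + 1)) ((i : ℝ≥0) / (n + 1) + 1 / ((n : ℝ≥0) + 1)) := by
  rw [cell, add_div]

lemma measurableSet_Ioi_prod_hit {K : Set ℝ≥0} (hK : IsCompact K) (δ : ℝ≥0) :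
    MeasurableSet (Set.Ioi δ ×ˢ {F : ClosedSets | (F.carrier ∩ K).Nonempty}) :=
  measurableSet_Ioi.prod (ClosedSets.measurableSet_hit_isCompact hK)

/-- The law `μ` of a closed set is such that an interval of length `ε` is hit with measure of order
at most `ε ^ (1 - β)`. -/
def HasHittingBound (β : ℝ) (μ : Measure ClosedSets) : Prop :=
  ∀ x ε : ℝ≥0, μ {F | (F.carrier ∩ Set.Icc x (x + ε)).Nonempty}
    ≤ powerMeasure (1 - β) (-β) (Set.Iic ε)

/-- The mean measure of the weighted closed sets. -/
def markedLaw (α : ℝ) (μ : Measure ClosedSets) : Measure (ℝ≥0 × ClosedSets) :=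
  (powerMeasure α (-(1 + α))).prod μ

section MarkedLaw

variable {α β : ℝ} {μ : Measure ClosedSets} [SFinite μ]

lemma markedLaw_hit_le (hμ : HasHittingBound β μ) (δ x ε : ℝ≥0) :
    markedLaw α μ (Set.Ioi δ ×ˢ {F | (F.carrier ∩ Set.Icc x (x + ε)).Nonempty})
      ≤ powerMeasure α (-(1 + α)) (Set.Ioi δ) * powerMeasure (1 - β) (-β) (Set.Iic ε) := by
  rw [markedLaw, Measure.prod_prod]
  gcongr
  exact hμ x ε

lemma markedLaw_hit_ne_top (hμ : HasHittingBound β μ) (hα : 0 < α) (hβ1 : β < 1) {δ : ℝ≥0}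
    (hδ : 0 < δ) (x ε : ℝ≥0) :
    markedLaw α μ (Set.Ioi δ ×ˢ {F | (F.carrier ∩ Set.Icc x (x + ε)).Nonempty}) ≠ ∞ := by
  refine ne_top_of_le_ne_top (ENNReal.mul_ne_top (powerMeasure_Ioi_ne_top (by linarith) hδ) ?_)
    (markedLaw_hit_le hμ δ x ε)
  -- The interval is enlarged because the scaling formula requires a positive length and `ε` may be
  -- `0`.
  refine ne_top_of_le_ne_top ?_ (measure_mono (Set.Iic_subset_Iic.2 (le_add_of_nonneg_right
    (zero_le_one' ℝ≥0) : ε ≤ ε + 1)))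
  rw [powerMeasure_Iic (by positivity)]
  exact ENNReal.mul_ne_top ENNReal.coe_ne_top
    (powerMeasure_Iic_one_ne_top (by linarith) (by linarith))

lemma markedLaw_heavyHit_ne_top (hμ : HasHittingBound β μ) (hα : 0 < α) (hβ1 : β < 1)
    (p : ℕ × ℕ × ℕ) : markedLaw α μ (heavyHit p) ≠ ∞ := by
  obtain ⟨T, hT⟩ := (isCompact_ratClosedBall p.2).bddAbove
  refine ne_top_of_le_ne_top (markedLaw_hit_ne_top hμ hα hβ1
    (δ := 1 / ((p.1 : ℝ≥0) + 1)) (by positivity) 0 T)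
    (measure_mono (Set.prod_mono le_rfl fun F hF => hF.mono (Set.inter_subset_inter_right _ ?_)))
  exact fun t ht => ⟨bot_le, by simpa using hT ht⟩

variable {Ω : Type*} [MeasurableSpace Ω] {P : Measure Ω} {X : ℕ → Ω → ℝ≥0 × ClosedSets}

/-- If `k (1 - β) > 1`, then almost surely no point lies in `k` or more of the heavy sets. -/
lemma ae_encard_lt (hX : IsPoissonEnumeration X (markedLaw α μ) P) (hμ : HasHittingBound β μ)
    (hα : 0 < α) (hβ1 : β < 1) {k : ℕ} (hk : 1 < (1 - β) * k) {δ : ℝ≥0} (hδ : 0 < δ) (T : ℕ) :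
    ∀ᵐ ω ∂P, ∀ t ≤ (T : ℝ≥0),
      Set.encard {j | δ < (X j ω).1 ∧ t ∈ (X j ω).2.carrier} < (k : ℕ∞) := by
  set c : ℝ≥0∞ := powerMeasure α (-(1 + α)) (Set.Ioi δ) * powerMeasure (1 - β) (-β) (Set.Iic 1)
    with hc
  have hcfin : c ≠ ∞ := ENNReal.mul_ne_top (powerMeasure_Ioi_ne_top (by linarith) hδ)
    (powerMeasure_Iic_one_ne_top (by linarith) (by linarith))
  -- About `T (n + 1)` cells of length `x = 1 / (n + 1)` cover `[0, T]`, and each is hit by `k`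
  -- heavy sets with probability at most `(c x ^ (1 - β)) ^ k`. The total is of order `x ^ ((1 - β)
  -- k - 1)`, which vanishes by the choice of `k`.
  have hlim : Filter.Tendsto (fun n : ℕ => (((T : ℝ≥0∞) + 1) * c ^ k) *
      ((1 / ((n : ℝ≥0) + 1)) ^ ((1 - β) * k - 1) : ℝ≥0)) Filter.atTop (nhds 0) := by
    have h0 : Filter.Tendsto (fun n : ℕ => (1 / ((n : ℝ≥0) + 1)) ^ ((1 - β) * k - 1))
        Filter.atTop (nhds 0) := by
      have h := ((NNReal.continuous_rpow_const (y := (1 - β) * k - 1) (by linarith)).tendsto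
        0).comp (tendsto_nnreal_const_div 1)
      rwa [NNReal.zero_rpow (by linarith)] at h
    have h1 := ENNReal.Tendsto.const_mul (ENNReal.tendsto_coe.2 h0)
      (Or.inr (ENNReal.mul_ne_top (by finiteness) (ENNReal.pow_ne_top hcfin)) :
        ((0 : ℝ≥0) : ℝ≥0∞) ≠ 0 ∨ ((T : ℝ≥0∞) + 1) * c ^ k ≠ ∞)
    simpa using h1
  rw [ae_iff]
  refine le_antisymm (ge_of_tendsto' hlim fun n => ?_) bot_le
  have hxpos : 0 < 1 / ((n : ℝ≥0) + 1) := by positivity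
  set x : ℝ≥0 := 1 / ((n : ℝ≥0) + 1) with hx
  have hsub : {ω | ¬ ∀ t ≤ (T : ℝ≥0),
      Set.encard {j | δ < (X j ω).1 ∧ t ∈ (X j ω).2.carrier} < (k : ℕ∞)}
      ⊆ ⋃ i ∈ Finset.range (T * (n + 1) + 1), {ω | (k : ℕ∞) ≤ pointCount X
        (Set.Ioi δ ×ˢ {F | (F.carrier ∩ cell n i).Nonempty}) ω} := by
    intro ω hω
    simp only [Set.mem_ofPred_eq, not_forall, not_lt] at hω
    obtain ⟨t, htT, ht⟩ := hω
    obtain ⟨i, hi, hit⟩ := exists_mem_cell n t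
    have hiT : i ≤ T * (n + 1) := by
      have : (i : ℝ≥0) ≤ T * (n + 1) := hit.trans (by gcongr)
      exact_mod_cast this
    refine Set.mem_biUnion (x := i) (by simpa using Nat.lt_succ_of_le hiT) (ht.trans ?_)
    exact Set.encard_le_encard fun j hj => ⟨hj.1, t, hj.2, hi⟩
  have hcell : ∀ i, P {ω | (k : ℕ∞) ≤ pointCount X
      (Set.Ioi δ ×ˢ {F | (F.carrier ∩ cell n i).Nonempty}) ω} ≤ (c * (x ^ (1 - β) : ℝ≥0)) ^ k := by
    intro i
    have hν : markedLaw α μ (Set.Ioi δ ×ˢ {F | (F.carrier ∩ cell n i).Nonempty})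
        ≤ c * (x ^ (1 - β) : ℝ≥0) := by
      rw [cell_eq]
      refine (markedLaw_hit_le hμ δ _ _).trans (le_of_eq ?_)
      rw [powerMeasure_Iic hxpos, hc, neg_add_eq_sub]
      ring
    exact (hX.measure_le_pointCount_le (measurableSet_Ioi_prod_hit (isCompact_cell n i) δ)
      (ne_top_of_le_ne_top (ENNReal.mul_ne_top hcfin ENNReal.coe_ne_top) hν) k).trans
      (pow_le_pow_left' hν k)
  have hT : (((T * (n + 1) + 1 : ℕ) : ℝ≥0) : ℝ≥0∞) ≤ (((T + 1) * (n + 1) : ℝ≥0) : ℝ≥0∞) := by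
    rw [ENNReal.coe_le_coe]
    push_cast
    rw [add_mul, one_mul]
    gcongr
    exact le_add_of_nonneg_left bot_le
  have hpow : ((n : ℝ≥0) + 1) * (x ^ (1 - β)) ^ k = x ^ ((1 - β) * k - 1) := by
    rw [NNReal.rpow_sub_one hxpos.ne', NNReal.rpow_mul, NNReal.rpow_natCast, hx]
    field_simp
  calc P {ω | ¬ ∀ t ≤ (T : ℝ≥0),
          Set.encard {j | δ < (X j ω).1 ∧ t ∈ (X j ω).2.carrier} < (k : ℕ∞)}
      ≤ ∑ i ∈ Finset.range (T * (n + 1) + 1), P {ω | (k : ℕ∞) ≤ pointCount X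
        (Set.Ioi δ ×ˢ {F | (F.carrier ∩ cell n i).Nonempty}) ω} :=
        (measure_mono hsub).trans (measure_biUnion_finset_le _ _)
    _ ≤ ∑ i ∈ Finset.range (T * (n + 1) + 1), (c * (x ^ (1 - β) : ℝ≥0)) ^ k :=
        Finset.sum_le_sum fun i _ => hcell i
    _ = (((T * (n + 1) + 1 : ℕ) : ℝ≥0) : ℝ≥0∞) * (c * (x ^ (1 - β) : ℝ≥0)) ^ k := by
        simp
    _ ≤ (((T + 1) * (n + 1) : ℝ≥0) : ℝ≥0∞) * (c * (x ^ (1 - β) : ℝ≥0)) ^ k := by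
        gcongr
    _ = (((T : ℝ≥0∞) + 1) * c ^ k) * (((n : ℝ≥0) + 1) * (x ^ (1 - β)) ^ k : ℝ≥0) := by
        push_cast
        ring
    _ = _ := by rw [hpow]

/-- Almost surely, for all `t` there are less than `k` sets of positive weight which
contain `t`. -/
lemma ae_card_lt (hX : IsPoissonEnumeration X (markedLaw α μ) P) (hμ : HasHittingBound β μ)
    (hα : 0 < α) (hβ1 : β < 1) {k : ℕ} (hk : 1 < (1 - β) * k) :
    ∀ᵐ ω ∂P, ∀ t, ∀ J : Finset ℕ, (∀ j ∈ J, t ∈ (X j ω).2.carrier ∧ 0 < (X j ω).1) →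
      J.card < k := by
  filter_upwards [ae_all_iff.2 fun p : ℕ × ℕ => ae_encard_lt hX hμ hα hβ1 hk
    (δ := 1 / ((p.1 : ℝ≥0) + 1)) (by positivity) p.2] with ω hω t J hJ
  obtain ⟨T, hT⟩ := exists_nat_ge t
  have hev : ∀ᶠ n : ℕ in Filter.atTop, ∀ j ∈ J, 1 / ((n : ℝ≥0) + 1) < (X j ω).1 :=
    (Filter.eventually_all_finset J).2 fun j hj =>
      (tendsto_nnreal_const_div 1).eventually (gt_mem_nhds (hJ j hj).2)
  obtain ⟨n, hn⟩ := hev.exists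
  have h := hω (n, T) t hT
  have h' : (J.card : ℕ∞) < k := by
    rw [← Set.encard_coe_eq_coe_finsetCard]
    refine lt_of_le_of_lt (Set.encard_le_encard ?_) h
    exact fun j hj => ⟨hn j hj, (hJ j hj).1⟩
  exact_mod_cast h'

/-- Almost surely, no heavy set hits a small neighbourhood of a given point. -/
lemma ae_exists_ball (hX : IsPoissonEnumeration X (markedLaw α μ) P) (hμ : HasHittingBound β μ)
    (hα : 0 < α) (hβ1 : β < 1) {δ : ℝ≥0} (hδ : 0 < δ) (b : ℝ≥0) :
    ∀ᵐ ω ∂P, ∃ G : TopologicalSpace.Opens ℝ≥0, b ∈ G ∧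
      ∀ t ∈ G, ∀ j, t ∈ (X j ω).2.carrier → (X j ω).1 ≤ δ := by
  have hL := powerMeasure_Ioi_ne_top (K := α) (r := -(1 + α)) (by linarith) hδ
  have hlim : Filter.Tendsto (fun n : ℕ => powerMeasure α (-(1 + α)) (Set.Ioi δ) *
      powerMeasure (1 - β) (-β) (Set.Iic (2 / ((n : ℝ≥0) + 1)))) Filter.atTop (nhds 0) := by
    have h := ENNReal.Tendsto.const_mul (tendsto_powerMeasure_Iic (K := 1 - β) (r := -β)
      (by linarith) (by linarith) (x := fun n : ℕ => 2 / ((n : ℝ≥0) + 1))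
      (fun n => by positivity) (tendsto_nnreal_const_div 2)) (Or.inr hL)
    simpa using h
  rw [ae_iff]
  refine le_antisymm (ge_of_tendsto' hlim fun n => ?_) bot_le
  -- The ball of radius `ε` around `b` lies in an interval of length `2 ε` starting at `b - ε`, also
  -- when this difference is truncated to `0`.
  set ε : ℝ≥0 := 1 / ((n : ℝ≥0) + 1) with hε
  have hεpos : 0 < ε := by positivity
  have h2 : 2 / ((n : ℝ≥0) + 1) = 2 * ε := by rw [hε]; ring
  rw [h2]
  refine le_trans (measure_mono (t := {ω | ((1 : ℕ) : ℕ∞) ≤ pointCount X (Set.Ioi δ ×ˢ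
    {F | (F.carrier ∩ Set.Icc (b - ε) (b - ε + 2 * ε)).Nonempty}) ω}) ?_) ?_
  · intro ω hω
    simp only [Set.mem_ofPred_eq, Nat.cast_one, Set.one_le_encard_iff_nonempty, pointCount]
    by_contra hcon
    refine hω ⟨⟨Metric.ball b ε, Metric.isOpen_ball⟩, Metric.mem_ball_self (by exact_mod_cast hεpos),
      fun t ht j hj => ?_⟩
    by_contra hlt
    refine hcon ⟨j, not_le.1 hlt, t, hj, ?_⟩
    have ht' : dist t b < ε := ht
    rw [NNReal.dist_eq, abs_lt] at ht'
    constructor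
    · rw [tsub_le_iff_right, ← NNReal.coe_le_coe]
      push_cast
      linarith
    · have hb : b ≤ b - ε + ε := le_tsub_add
      rw [← NNReal.coe_le_coe] at hb ⊢
      push_cast at hb ⊢
      linarith
  · refine (hX.measure_le_pointCount_le (measurableSet_Ioi_prod_hit isCompact_Icc δ)
      (markedLaw_hit_ne_top hμ hα hβ1 hδ _ _) 1).trans ?_
    rw [pow_one]
    exact markedLaw_hit_le hμ δ _ _

/-- At a given point the sup-derivative vanishes almost surely. -/
lemma ae_supDeriv_eq_zero (hX : IsPoissonEnumeration X (markedLaw α μ) P)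
    (hμ : HasHittingBound β μ) (hα : 0 < α) (hβ1 : β < 1) (b : ℝ≥0) :
    ∀ᵐ ω ∂P, (coverSup fun j => X j ω).supDeriv b = 0 := by
  obtain ⟨k, hk⟩ : ∃ k : ℕ, 1 < (1 - β) * k := by
    obtain ⟨k, hk⟩ := exists_nat_gt (1 / (1 - β))
    exact ⟨k, by rwa [div_lt_iff₀' (by linarith)] at hk⟩
  filter_upwards [ae_card_lt hX hμ hα hβ1 hk, ae_all_iff.2 fun n : ℕ =>
    ae_exists_ball hX hμ hα hβ1 (δ := 1 / ((n : ℝ≥0) + 1)) (by positivity) b] with ω hcard hball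
  -- Near `b` fewer than `k` sets of positive weight overlap at any point, and each has weight at
  -- most `1 / (n + 1)`.
  have hlim : Filter.Tendsto (fun n : ℕ => (k : ℝ≥0∞) * ((1 / ((n : ℝ≥0) + 1) : ℝ≥0) : ℝ≥0∞))
      Filter.atTop (nhds 0) := by
    have h := ENNReal.Tendsto.const_mul (ENNReal.tendsto_coe.2 (tendsto_nnreal_const_div 1))
      (Or.inr (ENNReal.natCast_ne_top k) : ((0 : ℝ≥0) : ℝ≥0∞) ≠ 0 ∨ (k : ℝ≥0∞) ≠ ∞)
    simpa using h
  refine le_antisymm (ge_of_tendsto' hlim fun n => ?_) bot_le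
  obtain ⟨G, hbG, hG⟩ := hball n
  refine (SupMeasure.supDeriv_le _ hbG).trans ?_
  rw [coverSup_onOpen]
  refine iSup₂_le fun t ht => le_of_forall_lt fun a ha => ?_
  obtain ⟨J, hJ, hJa⟩ := (lt_coverFun_iff _ t a).1 ha
  refine hJa.trans_le ((Finset.sum_le_card_nsmul J _ _ fun j hj =>
    ENNReal.coe_le_coe.2 (hG t ht j (hJ j hj).1)).trans ?_)
  rw [nsmul_eq_mul]
  gcongr
  exact (hcard t J hJ).le

end MarkedLaw

/-! ### Shifts and dilations of the sup-measure -/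

lemma coverFun_le_supDeriv (z : ℕ → ℝ≥0 × ClosedSets) (t : ℝ≥0) :
    coverFun z t ≤ (coverSup z).supDeriv t :=
  le_iInf₂ fun G ht => le_iSup₂ (f := fun t (_ : t ∈ G) => coverFun z t) t ht

/-- The hypothesis is needed only at `t = 0`, where every neighbourhood of `b` reaches to the left
of `b` (if `b > 0`). At `t > 0` the neighbourhood can be taken inside `(b, ∞)`. -/
lemma coverSup_shift {z : ℕ → ℝ≥0 × ClosedSets} {b : ℝ≥0} (hb : (coverSup z).supDeriv b = 0) :
    (coverSup z).shift b = coverSup fun j => ((z j).1, (z j).2.restart b) := by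
  apply SupMeasure.onOpen_injective
  funext G
  change ⨆ s ∈ (fun t => t + b) '' (G : Set ℝ≥0), (coverSup z).supDeriv s
    = ⨆ t ∈ G, coverFun z (t + b)
  rw [iSup_image]
  refine le_antisymm (iSup₂_le fun t ht => ?_) (iSup₂_mono fun t _ => coverFun_le_supDeriv z _)
  rcases eq_or_ne t 0 with rfl | hne
  · rw [zero_add, hb]
    exact bot_le
  · let G' : TopologicalSpace.Opens ℝ≥0 := ⟨{s | b < s ∧ s - b ∈ G},
      (isOpen_lt continuous_const continuous_id).inter
        (G.isOpen.preimage (continuous_id.sub continuous_const))⟩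
    have htG' : t + b ∈ G' := ⟨lt_add_of_pos_left b (pos_of_ne_zero hne), by
      rw [add_tsub_cancel_right]
      exact ht⟩
    refine (SupMeasure.supDeriv_le _ htG').trans (iSup₂_le fun s hs => ?_)
    have hs' : coverFun z s = coverFun z (s - b + b) := by rw [tsub_add_cancel_of_le hs.1.le]
    rw [hs']
    exact le_iSup₂ (f := fun t (_ : t ∈ G) => coverFun z (t + b)) (s - b) hs.2

lemma coverSup_dilate (z : ℕ → ℝ≥0 × ClosedSets) {a : ℝ≥0} (ha : 0 < a) :
    (coverSup z).dilate a = coverSup fun j => ((z j).1, (z j).2.contract a) := by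
  apply SupMeasure.onOpen_injective
  funext G
  change ⨆ s ∈ (fun t => a * t) '' (G : Set ℝ≥0), (coverSup z).supDeriv s
    = ⨆ t ∈ G, coverFun z (a * t)
  rw [iSup_image]
  refine le_antisymm (iSup₂_le fun t ht => ?_) (iSup₂_mono fun t _ => coverFun_le_supDeriv z _)
  let G' : TopologicalSpace.Opens ℝ≥0 := ⟨(fun s => a⁻¹ * s) ⁻¹' G,
    G.isOpen.preimage (continuous_const.mul continuous_id)⟩
  have htG' : a * t ∈ G' := by
    change a⁻¹ * (a * t) ∈ G
    rw [inv_mul_cancel_left₀ ha.ne']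
    exact ht
  refine (SupMeasure.supDeriv_le _ htG').trans (iSup₂_le fun s hs => ?_)
  have hs' : coverFun z s = coverFun z (a * (a⁻¹ * s)) := by rw [mul_inv_cancel_left₀ ha.ne']
  rw [hs']
  exact le_iSup₂ (f := fun t (_ : t ∈ G) => coverFun z (a * t)) (a⁻¹ * s) hs

lemma coverSup_scale (z : ℕ → ℝ≥0 × ClosedSets) (c : ℝ≥0) :
    (coverSup z).scale c = coverSup fun j => (c * (z j).1, (z j).2) := by
  apply SupMeasure.onOpen_injective
  funext G
  change (c : ℝ≥0∞) * ⨆ t ∈ G, coverFun z t = ⨆ t ∈ G, coverFun _ t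
  simp only [ENNReal.mul_iSup]
  refine iSup_congr fun t => iSup_congr fun _ => ?_
  rw [coverFun, coverFun, ← ENNReal.tsum_mul_left]
  refine tsum_congr fun j => ?_
  by_cases h : t ∈ (z j).2.carrier <;> simp [h]

/-! ### Stationarity and self-similarity -/

lemma measurable_map_snd {f : ClosedSets → ClosedSets} (hf : Measurable f) :
    Measurable fun x : ℝ≥0 × ClosedSets => (x.1, f x.2) :=
  measurable_fst.prodMk (hf.comp measurable_snd)

lemma markedLaw_map_snd (α : ℝ) (μ : Measure ClosedSets) [SFinite μ] {f : ClosedSets → ClosedSets}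
    (hf : Measurable f) :
    (markedLaw α μ).map (fun x => (x.1, f x.2)) = markedLaw α (μ.map f) := by
  have h := Measure.map_prod_map (powerMeasure α (-(1 + α))) μ measurable_id hf
  rw [Measure.map_id] at h
  exact h.symm

lemma markedLaw_smul (α : ℝ) (μ : Measure ClosedSets) [SFinite μ] (c : ℝ≥0) :
    markedLaw α (c • μ) = c • markedLaw α μ := by
  ext A hA
  rw [Measure.smul_apply, markedLaw, markedLaw, Measure.prod_apply hA, Measure.prod_apply hA]
  simp only [Measure.smul_apply, ENNReal.smul_def, smul_eq_mul]
  exact lintegral_const_mul _ (measurable_measure_prodMk_left hA)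

lemma markedLaw_map_mul (α : ℝ) (μ : Measure ClosedSets) [SFinite μ] {c : ℝ≥0} (hc : 0 < c) :
    (markedLaw α μ).map (fun x => (c * x.1, x.2)) = (c ^ α : ℝ≥0) • markedLaw α μ := by
  have h := Measure.map_prod_map (powerMeasure α (-(1 + α))) μ
    (measurable_const_mul c) measurable_id
  rw [Measure.map_id, map_mul_powerMeasure _ _ hc, Measure.prod_smul_left,
    show -(-(1 + α) + 1) = α by ring] at h
  exact h.symm

section

variable {α β : ℝ} {μ : Measure ClosedSets} [SFinite μ] {Ω : Type*} [MeasurableSpace Ω]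
  {P : Measure Ω} [IsProbabilityMeasure P] {X : ℕ → Ω → ℝ≥0 × ClosedSets}

/-- The restarted sets form a Poisson process with the same mean measure, and their sup-measure is
almost surely the shifted one. This equality also supplies the almost everywhere measurability of
the shift. -/
lemma isStationarySupMeasure_coverSup (hX : IsPoissonEnumeration X (markedLaw α μ) P)
    (hμ : HasHittingBound β μ) (hα : 0 < α) (hβ1 : β < 1)
    (hrestart : ∀ b, μ.map (ClosedSets.restart b) = μ) :
    IsStationarySupMeasure (fun ω => coverSup fun j => X j ω) P := by
  intro b
  have hX' : IsPoissonEnumeration (fun j ω => ((X j ω).1, (X j ω).2.restart b))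
      (markedLaw α μ) P := by
    have h := hX.map (measurable_map_snd (ClosedSets.measurable_restart b))
    rwa [markedLaw_map_snd α μ (ClosedSets.measurable_restart b), hrestart b] at h
  have hae : (fun ω => coverSup fun j => ((X j ω).1, (X j ω).2.restart b))
      =ᵐ[P] fun ω => (coverSup fun j => X j ω).shift b := by
    filter_upwards [ae_supDeriv_eq_zero hX hμ hα hβ1 b] with ω hω
    exact (coverSup_shift hω).symm
  have hmeas := measurable_coverSup hX'.measurable
  refine ⟨hmeas.aemeasurable.congr hae, (measurable_coverSup hX.measurable).aemeasurable, ?_⟩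
  rw [← Measure.map_congr hae]
  exact hX'.map_coverSup_eq hX (markedLaw_heavyHit_ne_top hμ hα hβ1)

/-- Contracting the sets and multiplying the weights by `a ^ ((1 - β) / α)` both multiply the mean
measure by `a ^ (1 - β)`, which fixes the exponent. Dilation is a homeomorphism, so no exceptional
point arises. -/
lemma isSelfSimilarSupMeasure_coverSup (hX : IsPoissonEnumeration X (markedLaw α μ) P)
    (hμ : HasHittingBound β μ) (hα : 0 < α) (hβ1 : β < 1)
    (hcontract : ∀ a : ℝ≥0, 0 < a → μ.map (ClosedSets.contract a) = (a ^ (1 - β) : ℝ≥0) • μ) :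
    IsSelfSimilarSupMeasure ((1 - β) / α) (fun ω => coverSup fun j => X j ω) P := by
  intro a ha
  have hX₁ : IsPoissonEnumeration (fun j ω => ((X j ω).1, (X j ω).2.contract a))
      ((a ^ (1 - β) : ℝ≥0) • markedLaw α μ) P := by
    have h := hX.map (measurable_map_snd (ClosedSets.measurable_contract a))
    rwa [markedLaw_map_snd α μ (ClosedSets.measurable_contract a), hcontract a ha,
      markedLaw_smul] at h
  have hX₂ : IsPoissonEnumeration (fun j ω => (a ^ ((1 - β) / α) * (X j ω).1, (X j ω).2))
      ((a ^ (1 - β) : ℝ≥0) • markedLaw α μ) P := by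
    have h := hX.map (T := fun x => (a ^ ((1 - β) / α) * x.1, x.2))
      ((measurable_fst.const_mul _).prodMk measurable_snd)
    rwa [markedLaw_map_mul α μ (NNReal.rpow_pos ha), ← NNReal.rpow_mul,
      div_mul_cancel₀ _ hα.ne'] at h
  simp only [coverSup_dilate _ ha, coverSup_scale]
  refine ⟨(measurable_coverSup hX₁.measurable).aemeasurable,
    (measurable_coverSup hX₂.measurable).aemeasurable, hX₁.map_coverSup_eq hX₂ fun p => ?_⟩
  rw [Measure.smul_apply, ENNReal.smul_def, smul_eq_mul]
  exact ENNReal.mul_ne_top ENNReal.coe_ne_top (markedLaw_heavyHit_ne_top hμ hα hβ1 p)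

end

lemma meanMeasure_map_translate (α β : ℝ) (Q : Measure ClosedSets) [SFinite Q] :
    (meanMeasure α β Q).map (fun x => (x.1, x.2.2.translate x.2.1))
      = markedLaw α (shiftedLaw β Q) := by
  have h := Measure.map_prod_map (powerMeasure α (-(1 + α)))
    ((powerMeasure (1 - β) (-β)).prod Q) measurable_id ClosedSets.measurable_translate
  rw [Measure.map_id] at h
  exact h.symm

lemma eta_eq_coverSup {Ω : Type*} (U V : ℕ → Ω → ℝ≥0) (R : ℕ → Ω → ClosedSets) :
    eta U V R = fun ω => coverSup fun j => (U j ω, (R j ω).translate (V j ω)) := rfl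

end

theorem mainTheorem2 {Ω Ω' : Type*} [MeasurableSpace Ω] [MeasurableSpace Ω']
    (P : Measure Ω) [IsProbabilityMeasure P] (P' : Measure Ω') [IsProbabilityMeasure P']
    (α β : ℝ) (hα : 0 < α) (hβ : 0 < β) (hβ1 : β < 1)
    (S : ℝ≥0 → Ω' → ℝ≥0) (hS : IsStableSubordinator β S P')
    (U V : ℕ → Ω → ℝ≥0) (R : ℕ → Ω → ClosedSets)
    (hN : IsPoissonEnumeration (fun j ω => (U j ω, V j ω, R j ω))
      (meanMeasure α β (P'.map (closedRange S))) P) :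
    IsRandomSupMeasure (eta U V R) ∧
      IsStationarySupMeasure (eta U V R) P ∧
      IsSelfSimilarSupMeasure ((1 - β) / α) (eta U V R) P := by
  obtain ⟨c, hc, S', hS', hae⟩ := hS.exists_regular
  -- Passing to regular paths changes the closed range on a null set only, so the mean measure is
  -- the same.
  have hQ : P'.map (closedRange S) = P'.map (closedRange S') := by
    refine Measure.map_congr ?_
    filter_upwards [hae] with ω hω
    simp only [closedRange, hω]
  rw [hQ] at hN
  have := hS'.isProbabilityMeasure_map_closedRange
  have hX := hN.map (T := fun x => (x.1, x.2.2.translate x.2.1))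
    (measurable_fst.prodMk (ClosedSets.measurable_translate.comp measurable_snd))
  rw [meanMeasure_map_translate] at hX
  have hμ : HasHittingBound β (shiftedLaw β (P'.map (closedRange S'))) :=
    hS'.shiftedLaw_hit_Icc_le hc hβ1
  rw [eta_eq_coverSup]
  exact ⟨measurable_coverSup hX.measurable,
    isStationarySupMeasure_coverSup hX hμ hα hβ1 (hS'.map_restart_shiftedLaw hc hβ1),
    isSelfSimilarSupMeasure_coverSup hX hμ hα hβ1 fun a ha => hS'.map_contract_shiftedLaw ha⟩
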